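/- Let $\mathbb K$ be $\mathbb R$ or $\mathbb C$ and let $\mathcal U$ be a nonprincipal ultrafilter on $\mathbb N$. Subspaces are closed, and $L$, $K$, $S$ denote the bounded, the compact and the strictly singular operators (an operator is strictly singular if its restriction to any infinite-dimensional subspace is not an isomorphism onto its range). For $T\in L(Y)$ let $\|T\|_S$ be the infimum of all $\varepsilon>0$ such that every infinite-dimensional subspace of $Y$ contains an infinite-dimensional subspace $Z$ with $\|T|_Z\|\le\varepsilon$; it induces a norm $\|\cdot\|_S$ on $L(Y)/S(Y)$. For $1<p<\infty$, a singular self-extension of $\ell_p$ is a Banach space $Y$ with an exact sequence $0\to\ell_p\xrightarrow{\,i\,}Y\xrightarrow{\,\pi\,}\ell_p\to0$ of bounded operators such that $\pi$ is strictly singular; $\ell_p$ is regarded as a subspace of $Y$ through $i$. Let $W_p$ be the subspace of the ultrapower $(\ell_p)_{\mathcal U}$ formed by the classes of weakly null sequences. Let $\mathrm{ext}(\ell_p,Y)=\{T|_{\ell_p}:T\in L(Y)\}$ and $\mathrm{ext}_K(\ell_p,Y)=\mathrm{ext}(\ell_p,Y)+K(\ell_p,Y)$. Let $Y$ be a singular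 self-extension of $\ell_p$, $1<p<\infty$. Then for each $T\in L(Y)$ there is a unique $\beta(T)\in L(W_p)$ such that $\beta(T)\widetilde{(x_n)}=\widetilde{(Tx_n)}$ in $Y_{\mathcal U}$ for every $\widetilde{(x_n)}\in W_p$ (where $W_p$ is regarded as a subspace of $Y_{\mathcal U}$), and the following are equivalent: (b) $\beta(L(Y))$ is closed in $L(W_p)$; (c) $L(Y)/S(Y)$ is complete for $\|\cdot\|_S$; (d) $\|\cdot\|_S$ is equivalent to the quotient norm on $L(Y)/S(Y)$; (e) the image of $L(Y)/S(Y)$ under $\widetilde T\mapsto \widetilde{T|_{\ell_p}}$ is closed in the quotient $L(\ell_p,Y)/K(\ell_p,Y)$; (f) $\mathrm{ext}_K(\ell_p,Y)$ is norm closed in $L(\ell_p,Y)$. For the Kalton–Peck space $Y=Z_2=\{(w,z): z\in\ell_2,\ w-\Omega z\in\ell_2\}$, where $\Omega(z)(n)=z(n)\log(\|z\|/|z(n)|)$ and $Z_2$ carries a Banach space norm equivalent to the quasi-norm $\|w-\Omega z\|+\|z\|$, with $i(w)=(w,0)$ and $\pi(w,z)=z$, the operators $\beta(T)$ likewise exist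 and are unique, and conditions (b)–(f) (with $p=2$) are equivalent to each other and to (a) $\Lambda(L(Z_2))$ is closed in $L(H)$, where $H$ is the completion of the quotient of $L(Z_2)$ by $\{T:(T,T)=0\}$ for the norm $(T,T)^{1/2}$, with $(T,T)=\lim_{\mathcal U}\|T(e_n,0)\|^2$, the norm on $Z_2$ being chosen so that $w\mapsto(w,0)$ is isometric on $\ell_2$, and where $\Lambda(A)\in L(H)$ is defined by $\Lambda(A)\widetilde T=\widetilde{AT}$. -/

import Mathlib

open Filter Topology
open scoped ENNReal

section Operators

variable {𝕜 X Y : Type*} [RCLike 𝕜] [NormedAddCommGroup X] [NormedSpace 𝕜 X]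
  [NormedAddCommGroup Y] [NormedSpace 𝕜 Y]

/-- `W` is an infinite dimensional closed linear subspace. -/
def IsInfSubspace (W : Submodule 𝕜 X) : Prop :=
  IsClosed (W : Set X) ∧ ¬ FiniteDimensional 𝕜 W

/-- `T` is bounded below on no infinite dimensional closed subspace, that is, its restriction to
such a subspace is never an isomorphism onto its range. -/
def IsStrictlySingular (T : X →L[𝕜] Y) : Prop :=
  ∀ W : Submodule 𝕜 X, IsInfSubspace W → ¬ ∃ c : ℝ, 0 < c ∧ ∀ w ∈ W, c * ‖w‖ ≤ ‖T w‖

/-- Every infinite dimensional closed subspace has a further one on which the restriction of `T`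
has norm at most `ε`. -/
def IsStronglySingular (ε : ℝ) (T : X →L[𝕜] Y) : Prop :=
  ∀ W : Submodule 𝕜 X, IsInfSubspace W →
    ∃ Z : Submodule 𝕜 X, IsInfSubspace Z ∧ Z ≤ W ∧ ∀ z ∈ Z, ‖T z‖ ≤ ε * ‖z‖

/-- The quantity `‖T‖_S`: the infimum of the `ε > 0` such that `T` is `ε`-strongly singular. -/
noncomputable def singNorm (T : X →L[𝕜] Y) : ℝ :=
  sInf {ε : ℝ | 0 < ε ∧ IsStronglySingular ε T}

theorem isStronglySingular_of_norm_le {T : X →L[𝕜] Y} {ε : ℝ} (h : ‖T‖ ≤ ε) :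
    IsStronglySingular ε T := fun W hW =>
  ⟨W, hW, le_rfl, fun z _ => (T.le_opNorm z).trans (by gcongr)⟩

theorem singNorm_bddBelow (T : X →L[𝕜] Y) :
    BddBelow {ε : ℝ | 0 < ε ∧ IsStronglySingular ε T} := ⟨0, fun _ h => h.1.le⟩

theorem singNorm_nonempty (T : X →L[𝕜] Y) :
    {ε : ℝ | 0 < ε ∧ IsStronglySingular ε T}.Nonempty :=
  ⟨‖T‖ + 1, by positivity, isStronglySingular_of_norm_le (by linarith)⟩

theorem singNorm_nonneg (T : X →L[𝕜] Y) : 0 ≤ singNorm T :=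
  Real.sInf_nonneg fun _ h => h.1.le

theorem singNorm_le {T : X →L[𝕜] Y} {ε : ℝ} (h0 : 0 < ε) (h : IsStronglySingular ε T) :
    singNorm T ≤ ε := csInf_le (singNorm_bddBelow T) ⟨h0, h⟩

theorem IsStronglySingular.add {T U : X →L[𝕜] Y} {a b : ℝ} (hT : IsStronglySingular a T)
    (hU : IsStronglySingular b U) : IsStronglySingular (a + b) (T + U) := by
  intro W hW
  obtain ⟨Z, hZ, hZW, hTZ⟩ := hT W hW
  obtain ⟨V, hV, hVZ, hUV⟩ := hU Z hZ
  refine ⟨V, hV, hVZ.trans hZW, fun z hz => ?_⟩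
  calc ‖(T + U) z‖ ≤ ‖T z‖ + ‖U z‖ := norm_add_le _ _
    _ ≤ a * ‖z‖ + b * ‖z‖ := add_le_add (hTZ z (hVZ hz)) (hUV z hz)
    _ = (a + b) * ‖z‖ := by ring

theorem IsStronglySingular.smul {T : X →L[𝕜] Y} {a : ℝ} (hT : IsStronglySingular a T)
    (c : 𝕜) : IsStronglySingular (‖c‖ * a) (c • T) := by
  intro W hW
  obtain ⟨Z, hZ, hZW, hTZ⟩ := hT W hW
  refine ⟨Z, hZ, hZW, fun z hz => ?_⟩
  calc ‖(c • T) z‖ = ‖c‖ * ‖T z‖ := norm_smul c (T z)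
    _ ≤ ‖c‖ * (a * ‖z‖) := by gcongr; exact hTZ z hz
    _ = ‖c‖ * a * ‖z‖ := by ring

theorem singNorm_add_le (T U : X →L[𝕜] Y) : singNorm (T + U) ≤ singNorm T + singNorm U := by
  refine le_of_forall_pos_lt_add fun ε hε => ?_
  obtain ⟨a, ⟨ha0, ha⟩, haT⟩ := exists_lt_of_csInf_lt (singNorm_nonempty T)
    (show singNorm T < singNorm T + ε / 2 by linarith)
  obtain ⟨b, ⟨hb0, hb⟩, hbU⟩ := exists_lt_of_csInf_lt (singNorm_nonempty U)
    (show singNorm U < singNorm U + ε / 2 by linarith)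
  have := singNorm_le (add_pos ha0 hb0) (ha.add hb)
  linarith

theorem singNorm_smul_le (c : 𝕜) (T : X →L[𝕜] Y) : singNorm (c • T) ≤ ‖c‖ * singNorm T := by
  rcases eq_or_ne c 0 with rfl | hc
  · rw [norm_zero, zero_mul]
    refine le_of_forall_pos_le_add fun ε hε => ?_
    rw [zero_add]
    exact singNorm_le hε (isStronglySingular_of_norm_le (by simpa using hε.le))
  · have hc' : 0 < ‖c‖ := norm_pos_iff.2 hc
    refine le_of_forall_pos_lt_add fun ε hε => ?_
    obtain ⟨a, ⟨ha0, ha⟩, haT⟩ := exists_lt_of_csInf_lt (singNorm_nonempty T)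
      (show singNorm T < singNorm T + ε / ‖c‖ by linarith [div_pos hε hc'])
    have h1 := singNorm_le (mul_pos hc' ha0) (ha.smul c)
    have h2 : ‖c‖ * a < ‖c‖ * (singNorm T + ε / ‖c‖) := by
      change a < singNorm T + ε / ‖c‖ at haT
      gcongr
    have h3 : ‖c‖ * (singNorm T + ε / ‖c‖) = ‖c‖ * singNorm T + ε := by
      field_simp
    linarith

/-- A subspace of finite codimension in an infinite dimensional one is infinite dimensional. -/
theorem IsInfSubspace.inf_ker {W : Submodule 𝕜 X} (hW : IsInfSubspace W) (f : X →L[𝕜] 𝕜) :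
    IsInfSubspace (W ⊓ f.ker) := by
  refine ⟨hW.1.inter f.isClosed_ker, fun hfin => hW.2 ?_⟩
  let g : W →ₗ[𝕜] 𝕜 := (f : X →ₗ[𝕜] 𝕜).comp W.subtype
  have hk : FiniteDimensional 𝕜 (LinearMap.ker g) := by
    let e : LinearMap.ker g →ₗ[𝕜] (W ⊓ f.ker : Submodule 𝕜 X) :=
      { toFun := fun x => ⟨x.1.1, x.1.2, x.2⟩
        map_add' := fun _ _ => rfl
        map_smul' := fun _ _ => rfl }
    refine FiniteDimensional.of_injective e fun x y h => ?_
    exact Subtype.ext (Subtype.ext (congrArg (fun z : (W ⊓ f.ker : Submodule 𝕜 X) => (z : X)) h))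
  have hq : FiniteDimensional 𝕜 (W ⧸ LinearMap.ker g) :=
    FiniteDimensional.of_injective g.quotKerEquivRange.toLinearMap g.quotKerEquivRange.injective
  exact Module.Finite.of_submodule_quotient (LinearMap.ker g)

theorem IsStrictlySingular.exists_unit {T : X →L[𝕜] Y} (hT : IsStrictlySingular T)
    {W : Submodule 𝕜 X} (hW : IsInfSubspace W) {ε : ℝ} (hε : 0 < ε) :
    ∃ w ∈ W, ‖w‖ = 1 ∧ ‖T w‖ ≤ ε := by
  have h := hT W hW
  push Not at h
  obtain ⟨w, hw, hlt⟩ := h ε hε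
  have hw0 : w ≠ 0 := by
    rintro rfl
    simp at hlt
  have hn : 0 < ‖w‖ := norm_pos_iff.2 hw0
  refine ⟨((‖w‖⁻¹ : ℝ) : 𝕜) • w, W.smul_mem _ hw, ?_, ?_⟩
  · rw [norm_smul, RCLike.norm_ofReal, abs_of_pos (inv_pos.2 hn), inv_mul_cancel₀ hn.ne']
  · rw [map_smul, norm_smul, RCLike.norm_ofReal, abs_of_pos (inv_pos.2 hn), inv_mul_le_iff₀ hn]
    linarith


theorem exists_seq_of_isStrictlySingular {T : X →L[𝕜] Y} (hT : IsStrictlySingular T)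
    {W : Submodule 𝕜 X} (hW : IsInfSubspace W) {ε : ℝ} (hε : 0 < ε) :
    ∃ (w : ℕ → X) (f : ℕ → X →L[𝕜] 𝕜), (∀ n, w n ∈ W) ∧ (∀ n, ‖w n‖ = 1) ∧ (∀ n, ‖T (w n)‖ ≤ ε / 4 ^ (n + 1)) ∧
      (∀ n, ‖f n‖ = 1) ∧ (∀ n, f n (w n) = 1) ∧ ∀ k n, k < n → f k (w n) = 0 := by
  have key : ∀ (n : ℕ) (V : {V : Submodule 𝕜 X // IsInfSubspace V}),
      ∃ (w : X) (f : X →L[𝕜] 𝕜), w ∈ V.1 ∧ ‖w‖ = 1 ∧ ‖T w‖ ≤ ε / 4 ^ (n + 1) ∧ ‖f‖ = 1 ∧ f w = 1 := by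
    intro n V
    obtain ⟨w, hw, hw1, hTw⟩ := hT.exists_unit V.2 (show 0 < ε / 4 ^ (n + 1) by positivity)
    obtain ⟨f, hf, hfw⟩ := exists_dual_vector 𝕜 w (by rw [hw1]; exact one_ne_zero)
    exact ⟨w, f, hw, hw1, hTw, hf, by rw [hfw, hw1]; simp⟩
  choose w f hw hw1 hTw hf hfw using key
  let V : ℕ → {V : Submodule 𝕜 X // IsInfSubspace V} := fun n =>
    Nat.rec ⟨W, hW⟩ (fun n V => ⟨V.1 ⊓ (f n V).ker, V.2.inf_ker _⟩) n
  have hV : ∀ n, (V (n + 1)).1 = (V n).1 ⊓ (f n (V n)).ker := fun n => rfl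
  have hanti : Antitone fun n => (V n).1 := antitone_nat_of_succ_le fun n => by
    rw [hV]; exact inf_le_left
  refine ⟨fun n => w n (V n), fun n => f n (V n), fun n => hanti (Nat.zero_le n) (hw n (V n)),
    fun n => hw1 _ _, fun n => hTw _ _, fun n => hf _ _, fun n => hfw _ _, fun k n hkn => ?_⟩
  have h1 : w n (V n) ∈ (V (k + 1)).1 := hanti (Nat.succ_le_of_lt hkn) (hw n (V n))
  rw [hV] at h1
  exact h1.2

theorem coeff_le_of_triangular {w : ℕ → X} {f : ℕ → X →L[𝕜] 𝕜} (hf : ∀ n, ‖f n‖ = 1)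
    (hfw : ∀ n, f n (w n) = 1) (h0 : ∀ k n, k < n → f k (w n) = 0)
    (hw : ∀ n, ‖w n‖ = 1) (a : ℕ → 𝕜) (N n : ℕ) (hn : n < N) :
    ‖a n‖ ≤ 2 ^ n * ‖∑ i ∈ Finset.range N, a i • w i‖ := by
  set x := ∑ i ∈ Finset.range N, a i • w i with hx
  induction n using Nat.strong_induction_on with
  | _ n ih =>
    have h1 : f n x = ∑ i ∈ Finset.range n, a i * f n (w i) + a n := by
      rw [hx, map_sum]
      simp only [map_smul, smul_eq_mul]
      rw [← Finset.sum_range_add_sum_Ico _ (Nat.succ_le_of_lt hn), Finset.sum_range_succ, hfw,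
        mul_one]
      have : ∑ i ∈ Finset.Ico n.succ N, a i * f n (w i) = 0 := by
        refine Finset.sum_eq_zero fun i hi => ?_
        rw [h0 n i (Nat.lt_of_succ_le (Finset.mem_Ico.1 hi).1), mul_zero]
      rw [this, add_zero]
    have h2 : ‖∑ i ∈ Finset.range n, a i * f n (w i)‖ ≤ (2 ^ n - 1) * ‖x‖ := by
      calc _ ≤ ∑ i ∈ Finset.range n, ‖a i * f n (w i)‖ := norm_sum_le _ _
        _ ≤ ∑ i ∈ Finset.range n, 2 ^ i * ‖x‖ := by
          refine Finset.sum_le_sum fun i hi => ?_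
          have hi' := Finset.mem_range.1 hi
          rw [norm_mul]
          calc ‖a i‖ * ‖f n (w i)‖ ≤ ‖a i‖ * 1 := by gcongr; simpa [hf n, hw i] using (f n).le_opNorm (w i)
            _ ≤ _ := by rw [mul_one]; exact ih i hi' (hi'.trans hn)
        _ = _ := by
          rw [← Finset.sum_mul]
          congr 1
          have := geom_sum_mul (2 : ℝ) n
          linarith
    have h3 : ‖f n x‖ ≤ ‖x‖ := by simpa [hf n] using (f n).le_opNorm x
    have h4 : a n = f n x - ∑ i ∈ Finset.range n, a i * f n (w i) := by rw [h1]; ring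
    calc ‖a n‖ ≤ ‖f n x‖ + ‖∑ i ∈ Finset.range n, a i * f n (w i)‖ := by
          rw [h4]; exact norm_sub_le _ _
      _ ≤ ‖x‖ + (2 ^ n - 1) * ‖x‖ := add_le_add h3 h2
      _ = _ := by ring

theorem IsStrictlySingular.isStronglySingular {T : X →L[𝕜] Y} (hT : IsStrictlySingular T)
    {ε : ℝ} (hε : 0 < ε) : IsStronglySingular ε T := by
  intro W hW
  obtain ⟨w, f, hwW, hw1, hTw, hf, hfw, h0⟩ := exists_seq_of_isStrictlySingular hT hW hε
  have hco := fun a N n hn => coeff_le_of_triangular hf hfw h0 hw1 a N n hn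
  have hexp : ∀ c : ℕ →₀ 𝕜, ∃ N, (∀ n, N ≤ n → c n = 0) ∧
      Finsupp.linearCombination 𝕜 w c = ∑ i ∈ Finset.range N, c i • w i := by
    intro c
    have hsub : c.support ⊆ Finset.range (c.support.sup id + 1) := fun i hi =>
      Finset.mem_range.2 (Nat.lt_succ_of_le (Finset.le_sup (f := id) hi))
    refine ⟨c.support.sup id + 1, fun n hn => ?_, ?_⟩
    · by_contra hne
      have := Finset.mem_range.1 (hsub (Finsupp.mem_support_iff.2 hne))
      omega
    · rw [Finsupp.linearCombination_apply, Finsupp.sum]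
      refine Finset.sum_subset hsub fun i _ hi => ?_
      rw [Finsupp.notMem_support_iff.1 hi, zero_smul]
  have hli : LinearIndependent 𝕜 w := by
    rw [linearIndependent_iff]
    intro c hc
    obtain ⟨N, hN, hsum⟩ := hexp c
    ext n
    rcases le_or_gt N n with hn | hn
    · simpa using hN n hn
    · have := hco c N n hn
      rw [← hsum, hc, norm_zero, mul_zero] at this
      simpa using this
  have hspan : ∀ x ∈ Submodule.span 𝕜 (Set.range w), ‖T x‖ ≤ ε * ‖x‖ := by
    intro x hx
    obtain ⟨c, rfl⟩ := (Finsupp.mem_span_range_iff_exists_finsupp).1 hx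
    obtain ⟨N, hN, hsum⟩ := hexp c
    rw [Finsupp.linearCombination_apply] at hsum
    have hterm : ∀ i ∈ Finset.range N, ‖T (c i • w i)‖ ≤
        (1 / 2) ^ i * (1 / 4 * ε * ‖∑ i ∈ Finset.range N, c i • w i‖) := by
      intro i hi
      rw [map_smul, norm_smul]
      calc ‖c i‖ * ‖T (w i)‖
          ≤ (2 ^ i * ‖∑ i ∈ Finset.range N, c i • w i‖) * (ε / 4 ^ (i + 1)) :=
            mul_le_mul (hco c N i (Finset.mem_range.1 hi)) (hTw i) (norm_nonneg _) (by positivity)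
        _ = _ := by
          have : (4 : ℝ) ^ i = 2 ^ i * 2 ^ i := by rw [← mul_pow]; norm_num
          rw [pow_succ, this, one_div_pow]
          field_simp
    have hgeom : ∑ i ∈ Finset.range N, (1 / 2 : ℝ) ^ i ≤ 2 := by
      have := Summable.sum_le_tsum (Finset.range N) (fun i _ => by positivity)
        summable_geometric_two
      rwa [tsum_geometric_two] at this
    rw [hsum, map_sum]
    calc ‖∑ i ∈ Finset.range N, T (c i • w i)‖ ≤ ∑ i ∈ Finset.range N, ‖T (c i • w i)‖ :=
          norm_sum_le _ _
      _ ≤ ∑ i ∈ Finset.range N,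
          (1 / 2) ^ i * (1 / 4 * ε * ‖∑ i ∈ Finset.range N, c i • w i‖) :=
          Finset.sum_le_sum hterm
      _ ≤ 2 * (1 / 4 * ε * ‖∑ i ∈ Finset.range N, c i • w i‖) := by
          rw [← Finset.sum_mul]; gcongr
      _ ≤ ε * ‖∑ i ∈ Finset.range N, c i • w i‖ := by
          have : 0 ≤ ε * ‖∑ i ∈ Finset.range N, c i • w i‖ := by positivity
          linarith
  refine ⟨(Submodule.span 𝕜 (Set.range w)).topologicalClosure,
    ⟨Submodule.isClosed_topologicalClosure _, fun hfin => ?_⟩, ?_, ?_⟩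
  · have hle := Submodule.le_topologicalClosure (Submodule.span 𝕜 (Set.range w))
    have : FiniteDimensional 𝕜 (Submodule.span 𝕜 (Set.range w)) :=
      Submodule.finiteDimensional_of_le hle
    have hli' : LinearIndependent 𝕜 (fun n : ℕ =>
        (⟨w n, Submodule.subset_span ⟨n, rfl⟩⟩ : Submodule.span 𝕜 (Set.range w))) :=
      LinearIndependent.of_comp (Submodule.span 𝕜 (Set.range w)).subtype hli
    have : Finite ℕ := hli'.finite
    exact not_finite ℕ
  · refine Submodule.topologicalClosure_minimal _ (Submodule.span_le.2 ?_) hW.1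
    rintro _ ⟨n, rfl⟩
    exact hwW n
  · intro z hz
    have hcl : IsClosed {x : X | ‖T x‖ ≤ ε * ‖x‖} :=
      isClosed_le (by fun_prop) (by fun_prop)
    exact closure_minimal (fun x hx => hspan x hx) hcl hz

theorem isStrictlySingular_iff {T : X →L[𝕜] Y} :
    IsStrictlySingular T ↔ ∀ ε : ℝ, 0 < ε → IsStronglySingular ε T := by
  refine ⟨fun h ε hε => h.isStronglySingular hε, fun h W hW => ?_⟩
  rintro ⟨c, hc, hcW⟩
  obtain ⟨Z, hZ, hZW, hTZ⟩ := h (c / 2) (by positivity) W hW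
  refine hZ.2 ?_
  have : Z = ⊥ := by
    rw [Submodule.eq_bot_iff]
    intro z hz
    have h1 := hcW z (hZW hz)
    have h2 := hTZ z hz
    have : ‖z‖ ≤ 0 := by nlinarith [norm_nonneg z]
    exact norm_le_zero_iff.1 this
  rw [this]
  infer_instance

theorem IsStronglySingular.mono {T : X →L[𝕜] Y} {a b : ℝ} (hab : a ≤ b)
    (hT : IsStronglySingular a T) : IsStronglySingular b T := by
  intro W hW
  obtain ⟨Z, hZ, hZW, hTZ⟩ := hT W hW
  exact ⟨Z, hZ, hZW, fun z hz => (hTZ z hz).trans (by gcongr)⟩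

theorem isStrictlySingular_iff_singNorm {T : X →L[𝕜] Y} :
    IsStrictlySingular T ↔ singNorm T = 0 := by
  rw [isStrictlySingular_iff]
  refine ⟨fun h => le_antisymm (le_of_forall_pos_le_add fun ε hε => ?_) (singNorm_nonneg T),
    fun h ε hε => ?_⟩
  · rw [zero_add]
    exact singNorm_le hε (h ε hε)
  · obtain ⟨a, ⟨_, ha⟩, haε⟩ := exists_lt_of_csInf_lt (singNorm_nonempty T)
      (show singNorm T < ε by rw [h]; exact hε)
    exact ha.mono haε.le

variable (𝕜 X Y) in
/-- The space `S(X, Y)` of strictly singular operators. -/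
def strictlySingularOperators : Submodule 𝕜 (X →L[𝕜] Y) where
  carrier := {T | IsStrictlySingular T}
  zero_mem' := isStrictlySingular_iff.2 fun ε hε =>
    isStronglySingular_of_norm_le (by simpa using hε.le)
  add_mem' {T U} hT hU := isStrictlySingular_iff_singNorm.2 <|
    le_antisymm ((singNorm_add_le T U).trans (by
      rw [isStrictlySingular_iff_singNorm.1 hT, isStrictlySingular_iff_singNorm.1 hU, add_zero]))
      (singNorm_nonneg _)
  smul_mem' c T hT := isStrictlySingular_iff_singNorm.2 <|
    le_antisymm ((singNorm_smul_le c T).trans (by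
      rw [isStrictlySingular_iff_singNorm.1 hT, mul_zero])) (singNorm_nonneg _)

variable (𝕜 X Y) in
/-- The quotient `L(X, Y) / S(X, Y)`; its norm is the usual quotient norm. -/
abbrev OperatorsModSingular : Type _ := (X →L[𝕜] Y) ⧸ strictlySingularOperators 𝕜 X Y

/-- The norm `‖·‖_S` on `L(X, Y) / S(X, Y)`: it takes the value `‖T‖_S` at the class of `T`. -/
noncomputable def singNormQuot (q : OperatorsModSingular 𝕜 X Y) : ℝ :=
  Quotient.liftOn' q singNorm fun T U h => by
    have hTU : IsStrictlySingular (-T + U) := QuotientAddGroup.leftRel_apply.1 h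
    have hUT : IsStrictlySingular (-(-T + U)) :=
      (strictlySingularOperators 𝕜 X Y).neg_mem hTU
    refine le_antisymm ?_ ?_
    · calc singNorm T = singNorm (U + -(-T + U)) := by congr 1; abel
        _ ≤ singNorm U + singNorm (-(-T + U)) := singNorm_add_le _ _
        _ = singNorm U := by rw [isStrictlySingular_iff_singNorm.1 hUT, add_zero]
    · calc singNorm U = singNorm (T + (-T + U)) := by congr 1; abel
        _ ≤ singNorm T + singNorm (-T + U) := singNorm_add_le _ _
        _ = singNorm T := by rw [isStrictlySingular_iff_singNorm.1 hTU, add_zero]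

variable (𝕜 X Y) in
/-- `L(X, Y) / S(X, Y)` is complete for the norm `‖·‖_S`. -/
def IsSingNormComplete : Prop :=
  ∀ u : ℕ → OperatorsModSingular 𝕜 X Y,
    (∀ ε : ℝ, 0 < ε → ∃ N, ∀ m ≥ N, ∀ n ≥ N, singNormQuot (u m - u n) < ε) →
    ∃ l, Tendsto (fun n => singNormQuot (u n - l)) atTop (𝓝 0)

variable (𝕜 X Y) in
/-- On `L(X, Y) / S(X, Y)`, the norm `‖·‖_S` is equivalent to the quotient norm. -/
def IsSingNormEquivalent : Prop :=
  ∃ c C : ℝ, 0 < c ∧ 0 < C ∧ ∀ q : OperatorsModSingular 𝕜 X Y,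
    c * ‖q‖ ≤ singNormQuot q ∧ singNormQuot q ≤ C * ‖q‖

end Operators

section Ultrapower

variable {𝕜 E F : Type*} [RCLike 𝕜] [NormedAddCommGroup E] [NormedSpace 𝕜 E]
  [NormedAddCommGroup F] [NormedSpace 𝕜 F] (U : Ultrafilter ℕ)

/-- The Banach space `ℓ_∞(E)` of bounded sequences in `E`. -/
abbrev BddSeq (E : Type*) [NormedAddCommGroup E] : Type _ := lp (fun _ : ℕ => E) ∞

variable (𝕜 E) in
/-- The bounded sequences whose norms tend to `0` along `U`. -/
noncomputable def ultraNull : Submodule 𝕜 (BddSeq E) where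
  carrier := {x | Tendsto (fun n => ‖x n‖) U (𝓝 0)}
  zero_mem' := by simp
  add_mem' {x y} hx hy := by
    refine squeeze_zero (fun n => norm_nonneg _) (fun n => norm_add_le (x n) (y n)) ?_
    simpa using Tendsto.add hx hy
  smul_mem' c x hx := by
    have : Tendsto (fun n => ‖c‖ * ‖x n‖) U (𝓝 0) := by
      simpa using Tendsto.const_mul ‖c‖ hx
    simpa [norm_smul] using this

instance ultraNull_isClosed : IsClosed (ultraNull 𝕜 E U : Set (BddSeq E)) := by
  refine isClosed_of_closure_subset fun x hx => ?_
  change Tendsto (fun n => ‖x n‖) U (𝓝 0)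
  rw [Metric.tendsto_nhds]
  intro ε hε
  obtain ⟨y, hy, hxy⟩ := Metric.mem_closure_iff.1 hx (ε / 2) (by positivity)
  have hy' : Tendsto (fun n => ‖y n‖) U (𝓝 0) := hy
  filter_upwards [(Metric.tendsto_nhds.1 hy') (ε / 2) (by positivity)] with n hn
  have h1 : ‖x n - y n‖ ≤ ‖x - y‖ := lp.norm_apply_le_norm ENNReal.top_ne_zero (x - y) n
  have h2 : ‖x n‖ ≤ ‖x n - y n‖ + ‖y n‖ := by
    simpa using norm_add_le (x n - y n) (y n)
  rw [dist_eq_norm] at hxy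
  simp only [dist_zero_right, norm_norm] at hn ⊢
  linarith

variable (𝕜 E) in
/-- The ultrapower `E_U = ℓ_∞(E) / {x : lim_U ‖x_n‖ = 0}`, with the quotient norm. -/
abbrev Ultrapower : Type _ := BddSeq E ⧸ ultraNull 𝕜 E U

/-- The operator `(x_n) ↦ (T x_n)` on bounded sequences. -/
noncomputable def seqMap (T : E →L[𝕜] F) : BddSeq E →L[𝕜] BddSeq F :=
  LinearMap.mkContinuous
    { toFun := fun x => ⟨fun n => T (x n), memℓp_infty ⟨‖T‖ * ‖x‖, by
        rintro _ ⟨n, rfl⟩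
        exact (T.le_opNorm _).trans
          (by gcongr; exact lp.norm_apply_le_norm ENNReal.top_ne_zero x n)⟩⟩
      map_add' := fun x y => by ext n; exact map_add T (x n) (y n)
      map_smul' := fun c x => by ext n; exact map_smul T c (x n) }
    ‖T‖ fun x => lp.norm_le_of_forall_le (by positivity) fun n =>
      (T.le_opNorm _).trans (by gcongr; exact lp.norm_apply_le_norm ENNReal.top_ne_zero x n)

theorem seqMap_apply (T : E →L[𝕜] F) (x : BddSeq E) (n : ℕ) : seqMap T x n = T (x n) := rfl

theorem seqMap_mem (T : E →L[𝕜] F) {x : BddSeq E} (hx : x ∈ ultraNull 𝕜 E U) :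
    seqMap T x ∈ ultraNull 𝕜 F U := by
  have hx' : Tendsto (fun n => ‖T‖ * ‖x n‖) U (𝓝 0) := by
    simpa using Tendsto.const_mul ‖T‖ hx
  exact squeeze_zero (fun n => norm_nonneg _) (fun n => T.le_opNorm (x n)) hx'

/-- The operator `T_U : E_U → F_U`, sending the class of `(x_n)` to the class of `(T x_n)`. -/
noncomputable def ultraMap (T : E →L[𝕜] F) : Ultrapower 𝕜 E U →L[𝕜] Ultrapower 𝕜 F U :=
  LinearMap.mkContinuous
    ((ultraNull 𝕜 E U).mapQ (ultraNull 𝕜 F U) (seqMap T : BddSeq E →ₗ[𝕜] BddSeq F)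
      fun _ hx => seqMap_mem U T hx) ‖T‖ fun q => by
    refine le_of_forall_pos_le_add fun ε hε => ?_
    obtain ⟨x, rfl, hx⟩ := Submodule.Quotient.norm_mk_lt q
      (show 0 < ε / (‖T‖ + 1) by positivity)
    rw [Submodule.mapQ_apply]
    have h1 : ‖seqMap T x‖ ≤ ‖T‖ * ‖x‖ := LinearMap.mkContinuous_norm_le _ (norm_nonneg T) _ |>
      fun h => ((seqMap T).le_opNorm x).trans (by gcongr; exact h)
    have h2 : ‖T‖ * (ε / (‖T‖ + 1)) ≤ ε := by
      rw [mul_div_assoc', div_le_iff₀ (by positivity)]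
      nlinarith [norm_nonneg T]
    calc _ ≤ ‖seqMap T x‖ := Submodule.Quotient.norm_mk_le _ _
      _ ≤ ‖T‖ * ‖x‖ := h1
      _ ≤ ‖T‖ * (‖(Submodule.Quotient.mk x : Ultrapower 𝕜 E U)‖ + ε / (‖T‖ + 1)) := by gcongr
      _ ≤ _ := by rw [mul_add]; gcongr

theorem ultraMap_mk (T : E →L[𝕜] F) (x : BddSeq E) :
    ultraMap U T (Submodule.Quotient.mk x) = Submodule.Quotient.mk (seqMap T x) := rfl

theorem norm_ultraMap_le (T : E →L[𝕜] F) : ‖ultraMap U T‖ ≤ ‖T‖ :=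
  LinearMap.mkContinuous_norm_le _ (norm_nonneg T) _

/-- The norm of the ultrapower is the limit of the norms along `U`. -/
theorem ultrapower_tendsto_norm (x : BddSeq E) :
    Tendsto (fun n => ‖x n‖) U (𝓝 ‖(Submodule.Quotient.mk x : Ultrapower 𝕜 E U)‖) := by
  have hbd : ∀ n, ‖x n‖ ∈ Set.Icc (0 : ℝ) ‖x‖ := fun n =>
    ⟨norm_nonneg _, lp.norm_apply_le_norm ENNReal.top_ne_zero x n⟩
  obtain ⟨l, hl, hlim⟩ := (isCompact_Icc (a := (0 : ℝ)) (b := ‖x‖)).ultrafilter_le_nhds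
    (U.map fun n => ‖x n‖) (by
      rw [le_principal_iff]
      exact Filter.mem_map.2 (Filter.univ_mem' hbd))
  have hlim' : Tendsto (fun n => ‖x n‖) U (𝓝 l) := hlim
  suffices h : ‖(Submodule.Quotient.mk x : Ultrapower 𝕜 E U)‖ = l by rw [h]; exact hlim'
  refine le_antisymm (le_of_forall_pos_le_add fun ε hε => ?_)
    (le_of_forall_pos_le_add fun ε hε => ?_)
  · classical
    let y : BddSeq E := ⟨fun n => if ‖x n‖ ≤ l + ε then x n else 0, memℓp_infty ⟨‖x‖, by
      rintro _ ⟨n, rfl⟩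
      dsimp only
      split_ifs
      · exact (hbd n).2
      · simp⟩⟩
    have hxy : (Submodule.Quotient.mk x : Ultrapower 𝕜 E U) = Submodule.Quotient.mk y := by
      rw [Submodule.Quotient.eq]
      have hev : ∀ᶠ n in (U : Filter ℕ), ‖x n‖ ≤ l + ε :=
        (hlim'.eventually (gt_mem_nhds (show l < l + ε by linarith))).mono fun _ h => le_of_lt h
      refine tendsto_const_nhds.congr' ?_
      filter_upwards [hev] with n hn
      have : y n = x n := if_pos hn
      simp [this]
    rw [hxy]
    refine (Submodule.Quotient.norm_mk_le _ y).trans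
      (lp.norm_le_of_forall_le (by linarith [hl.1]) fun n => ?_)
    change ‖if ‖x n‖ ≤ l + ε then x n else 0‖ ≤ _
    split_ifs with h
    · exact h
    · simp only [norm_zero]; linarith [hl.1]
  · obtain ⟨y, hy, hyn⟩ := Submodule.Quotient.norm_mk_lt
      (Submodule.Quotient.mk x : Ultrapower 𝕜 E U) hε
    have hmem : y - x ∈ ultraNull 𝕜 E U := (Submodule.Quotient.eq _).1 hy
    have h0 : Tendsto (fun n => ‖(y - x) n‖) U (𝓝 0) := hmem
    have h1 : Tendsto (fun n => ‖x n‖ - ‖(y - x) n‖) U (𝓝 (l - 0)) := hlim'.sub h0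
    rw [sub_zero] at h1
    refine (le_of_tendsto h1 (Eventually.of_forall fun n => ?_)).trans hyn.le
    have h2 : ‖x n‖ ≤ ‖y n‖ + ‖y n - x n‖ := by
      simpa using norm_sub_le (y n) (y n - x n)
    have h3 : ‖y n‖ ≤ ‖y‖ := lp.norm_apply_le_norm ENNReal.top_ne_zero y n
    have h4 : (y - x) n = y n - x n := rfl
    rw [h4]
    linarith

variable (𝕜) in
/-- The bounded sequences in `E` that converge weakly to `0`. -/
noncomputable def weaklyNull (E : Type*) [NormedAddCommGroup E] [NormedSpace 𝕜 E] :
    Submodule 𝕜 (BddSeq E) where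
  carrier := {x | ∀ f : E →L[𝕜] 𝕜, Tendsto (fun n => f (x n)) atTop (𝓝 0)}
  zero_mem' f := by simp
  add_mem' {x y} hx hy f := by simpa using (hx f).add (hy f)
  smul_mem' c x hx f := by simpa using (hx f).const_mul c

end Ultrapower

/-- The sequence space `ℓ_p` over `𝕜`. -/
abbrev Ell (𝕜 : Type*) [RCLike 𝕜] (p : ℝ≥0∞) : Type _ := lp (fun _ : ℕ => 𝕜) p

/-- A self-extension `0 → ℓ_p → Y → ℓ_p → 0` of `ℓ_p`. -/
structure SelfExtension (𝕜 : Type*) [RCLike 𝕜] (p : ℝ≥0∞) [Fact (1 ≤ p)]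
    (Y : Type*) [NormedAddCommGroup Y] [NormedSpace 𝕜 Y] where
  /-- the embedding of the subspace `ℓ_p` -/
  incl : Ell 𝕜 p →L[𝕜] Y
  /-- the quotient map -/
  proj : Y →L[𝕜] Ell 𝕜 p
  incl_injective : Function.Injective incl
  exact : Function.Exact incl proj
  proj_surjective : Function.Surjective proj

/-- The subspace `W_p` of the ultrapower `(ℓ_p)_U`: the classes of weakly null sequences. -/
noncomputable def weakUltra (𝕜 : Type*) [RCLike 𝕜] (p : ℝ≥0∞) [Fact (1 ≤ p)] (U : Ultrafilter ℕ) :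
    Submodule 𝕜 (Ultrapower 𝕜 (Ell 𝕜 p) U) :=
  (weaklyNull 𝕜 (Ell 𝕜 p)).map (ultraNull 𝕜 (Ell 𝕜 p) U).mkQ

namespace SelfExtension

variable {𝕜 : Type*} [RCLike 𝕜] {p : ℝ≥0∞} [Fact (1 ≤ p)]
  {Y : Type*} [NormedAddCommGroup Y] [NormedSpace 𝕜 Y] (E : SelfExtension 𝕜 p Y)

/-- The extension is singular if its quotient map is strictly singular. -/
def IsSingular : Prop := IsStrictlySingular E.proj

/-- `B = β(T)`: for `x` in `W_p`, the class of `(x_n)`, one has `B x = (T x_n)` in `Y_U`, where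
`ℓ_p` is identified with its copy in `Y`, and so `W_p` with a subspace of `Y_U`. -/
def IsBeta (U : Ultrafilter ℕ) (T : Y →L[𝕜] Y) (B : weakUltra 𝕜 p U →L[𝕜] weakUltra 𝕜 p U) :
    Prop :=
  ∀ x : weakUltra 𝕜 p U,
    ultraMap U E.incl (B x : Ultrapower 𝕜 (Ell 𝕜 p) U) =
      ultraMap U T (ultraMap U E.incl (x : Ultrapower 𝕜 (Ell 𝕜 p) U))

/-- The range `β(L(Y))` of `β` in `L(W_p)`. -/
def betaRange (U : Ultrafilter ℕ) : Set (weakUltra 𝕜 p U →L[𝕜] weakUltra 𝕜 p U) :=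
  {B | ∃ T : Y →L[𝕜] Y, E.IsBeta U T B}

/-- The restriction map `r : L(Y) → L(ℓ_p, Y)`. -/
noncomputable def restr : (Y →L[𝕜] Y) →ₗ[𝕜] (Ell 𝕜 p →L[𝕜] Y) where
  toFun T := T.comp E.incl
  map_add' _ _ := rfl
  map_smul' _ _ := rfl

/-- The space `ext(ℓ_p, Y)` of operators `ℓ_p → Y` that extend to operators on `Y`. -/
noncomputable def ext : Submodule 𝕜 (Ell 𝕜 p →L[𝕜] Y) := LinearMap.range E.restr

/-- The space `ext_K(ℓ_p, Y) = ext(ℓ_p, Y) + K(ℓ_p, Y)`. -/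
noncomputable def extK : Submodule 𝕜 (Ell 𝕜 p →L[𝕜] Y) :=
  E.ext ⊔ compactOperator (RingHom.id 𝕜) (Ell 𝕜 p) Y

/-- The image in the Calkin quotient `L(ℓ_p, Y) / K(ℓ_p, Y)` of `L(Y)`, equivalently of
`L(Y) / S(Y)`, under the map induced by restriction: the classes of all `T|ℓ_p`, `T ∈ L(Y)`. -/
def calkinImage : Set ((Ell 𝕜 p →L[𝕜] Y) ⧸ compactOperator (RingHom.id 𝕜) (Ell 𝕜 p) Y) :=
  Set.range fun T : Y →L[𝕜] Y => Submodule.Quotient.mk (E.restr T)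

end SelfExtension

section KaltonPeck

variable {𝕜 : Type*} [RCLike 𝕜]

/-- The Kalton-Peck map `Ω(x)(n) = x(n) log (‖x‖ / |x(n)|)` on `ℓ_2` (with value `0` at a
coordinate where `x(n) = 0`). -/
noncomputable def kpMap (x : Ell 𝕜 2) : ℕ → 𝕜 :=
  fun n => x n * ((Real.log (‖x‖ / ‖x n‖) : ℝ) : 𝕜)

theorem kpMap_zero : kpMap (0 : Ell 𝕜 2) = 0 := by
  ext n; simp [kpMap]

theorem kpMap_smul (c : 𝕜) (x : Ell 𝕜 2) : kpMap (c • x) = c • kpMap x := by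
  ext n
  rcases eq_or_ne c 0 with rfl | hc
  · simp [kpMap]
  · have hc' : ‖c‖ ≠ 0 := norm_ne_zero_iff.2 hc
    have h : ‖c • x‖ / ‖(c • x) n‖ = ‖x‖ / ‖x n‖ := by
      rw [lp.coeFn_smul, Pi.smul_apply, norm_smul, norm_smul, mul_div_mul_left _ _ hc']
    have h2 : (c • x) n = c * x n := rfl
    rw [Pi.smul_apply, kpMap, kpMap, h, h2, smul_eq_mul, mul_assoc]

theorem kpMap_eq (x : Ell 𝕜 2) (n : ℕ) :
    kpMap x n = ((Real.log ‖x‖ : ℝ) : 𝕜) * x n - x n * ((Real.log ‖x n‖ : ℝ) : 𝕜) := by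
  rcases eq_or_ne (x n) 0 with h | h
  · simp [kpMap, h]
  · have hx : x ≠ 0 := by rintro rfl; exact h rfl
    rw [kpMap, Real.log_div (norm_ne_zero_iff.2 hx) (norm_ne_zero_iff.2 h)]
    push_cast
    ring

theorem abs_mul_log_sub_le {s M : ℝ} (hs : 0 ≤ s) (hsM : s ≤ M) :
    |s * (Real.log s - Real.log M)| ≤ M := by
  rcases hs.eq_or_lt with rfl | hs
  · simpa using hsM
  · have hM : 0 < M := hs.trans_le hsM
    have h := (Real.abs_log_mul_self_lt (s / M) (by positivity) ((div_le_one hM).2 hsM)).le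
    rw [← Real.log_div hs.ne' hM.ne']
    have h2 : s * Real.log (s / M) = M * (Real.log (s / M) * (s / M)) := by field_simp
    rw [h2, abs_mul, abs_of_pos hM]
    nlinarith

theorem norm_mul_log_add_le (s t : 𝕜) :
    ‖(s + t) * ((Real.log ‖s + t‖ : ℝ) : 𝕜) - s * ((Real.log ‖s‖ : ℝ) : 𝕜)
      - t * ((Real.log ‖t‖ : ℝ) : 𝕜)‖ ≤ 3 * (‖s‖ + ‖t‖) := by
  set M := ‖s‖ + ‖t‖ with hM
  have key : ∀ r : 𝕜, ‖r‖ ≤ M →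
      ‖r * ((Real.log ‖r‖ : ℝ) : 𝕜) - r * ((Real.log M : ℝ) : 𝕜)‖ ≤ M := by
    intro r hr
    rw [← mul_sub, ← RCLike.ofReal_sub, norm_mul, RCLike.norm_ofReal,
      ← abs_of_nonneg (norm_nonneg r), ← abs_mul, abs_of_nonneg (norm_nonneg r)]
    exact abs_mul_log_sub_le (norm_nonneg r) hr
  have h1 := key (s + t) (norm_add_le s t)
  have h2 := key s (by rw [hM]; linarith [norm_nonneg t])
  have h3 := key t (by rw [hM]; linarith [norm_nonneg s])
  have h4 : (s + t) * ((Real.log ‖s + t‖ : ℝ) : 𝕜) - s * ((Real.log ‖s‖ : ℝ) : 𝕜)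
      - t * ((Real.log ‖t‖ : ℝ) : 𝕜) =
      ((s + t) * ((Real.log ‖s + t‖ : ℝ) : 𝕜) - (s + t) * ((Real.log M : ℝ) : 𝕜))
      - (s * ((Real.log ‖s‖ : ℝ) : 𝕜) - s * ((Real.log M : ℝ) : 𝕜))
      - (t * ((Real.log ‖t‖ : ℝ) : 𝕜) - t * ((Real.log M : ℝ) : 𝕜)) := by ring
  rw [h4]
  refine (norm_sub_le _ _).trans ?_
  linarith [norm_sub_le ((s + t) * ((Real.log ‖s + t‖ : ℝ) : 𝕜) - (s + t) * ((Real.log M : ℝ) : 𝕜))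
    (s * ((Real.log ‖s‖ : ℝ) : 𝕜) - s * ((Real.log M : ℝ) : 𝕜))]

theorem memℓp_two_of_le {f : ℕ → 𝕜} (K : ℝ) (x y : Ell 𝕜 2)
    (h : ∀ n, ‖f n‖ ≤ K * (‖x n‖ + ‖y n‖)) : Memℓp f 2 := by
  have h2 : (2 : ℝ≥0∞).toReal = 2 := by norm_num
  have hs : ∀ z : Ell 𝕜 2, Summable fun n => ‖z n‖ ^ 2 := fun z => by
    simpa [h2] using (lp.memℓp z).summable (by norm_num)
  refine memℓp_gen ?_
  rw [h2]
  simp only [Real.rpow_ofNat]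
  refine Summable.of_nonneg_of_le (fun n => by positivity) (fun n => ?_)
    (((hs x).add (hs y)).mul_left (K ^ 2 * 2))
  calc ‖f n‖ ^ 2 ≤ (K * (‖x n‖ + ‖y n‖)) ^ 2 := by gcongr; exact h n
    _ ≤ K ^ 2 * 2 * (‖x n‖ ^ 2 + ‖y n‖ ^ 2) := by
      have : 0 ≤ K ^ 2 * (‖x n‖ - ‖y n‖) ^ 2 := by positivity
      nlinarith

/-- The Kalton-Peck map is additive up to elements of `ℓ_2`. -/
theorem kpMap_add_mem (x y : Ell 𝕜 2) : Memℓp (kpMap x + kpMap y - kpMap (x + y)) 2 := by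
  refine memℓp_two_of_le
    (|Real.log ‖x‖ - Real.log ‖x + y‖| + |Real.log ‖y‖ - Real.log ‖x + y‖| + 3) x y fun n => ?_
  have h0 : (kpMap x + kpMap y - kpMap (x + y)) n =
      ((Real.log ‖x‖ - Real.log ‖x + y‖ : ℝ) : 𝕜) * x n +
      ((Real.log ‖y‖ - Real.log ‖x + y‖ : ℝ) : 𝕜) * y n +
      ((x n + y n) * ((Real.log ‖x n + y n‖ : ℝ) : 𝕜) - x n * ((Real.log ‖x n‖ : ℝ) : 𝕜)
      - y n * ((Real.log ‖y n‖ : ℝ) : 𝕜)) := by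
    simp only [Pi.sub_apply, Pi.add_apply, kpMap_eq, lp.coeFn_add]
    push_cast
    ring
  rw [h0]
  refine (norm_add₃_le).trans ?_
  rw [norm_mul, norm_mul, RCLike.norm_ofReal, RCLike.norm_ofReal]
  have h1 := norm_mul_log_add_le (x n) (y n)
  have h2 : 0 ≤ |Real.log ‖x‖ - Real.log ‖x + y‖| * ‖y n‖ := by positivity
  have h3 : 0 ≤ |Real.log ‖y‖ - Real.log ‖x + y‖| * ‖x n‖ := by positivity
  nlinarith

variable (𝕜) in
/-- The vector space underlying `Z_2 = ℓ_2 ⊕_Ω ℓ_2`: the pairs `(w, z)` with `z ∈ ℓ_2` and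
`w - Ω z ∈ ℓ_2`. -/
def kpSubmodule : Submodule 𝕜 ((ℕ → 𝕜) × Ell 𝕜 2) where
  carrier := {u | Memℓp (u.1 - kpMap u.2) 2}
  zero_mem' := by
    change Memℓp ((0 : ℕ → 𝕜) - kpMap 0) 2
    rw [kpMap_zero, sub_zero]
    exact zero_memℓp
  add_mem' {u v} hu hv := by
    have h : (u + v).1 - kpMap (u + v).2 =
        (u.1 - kpMap u.2) + (v.1 - kpMap v.2) + (kpMap u.2 + kpMap v.2 - kpMap (u.2 + v.2)) := by
      rw [Prod.fst_add, Prod.snd_add]; abel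
    change Memℓp ((u + v).1 - kpMap (u + v).2) 2
    rw [h]
    exact (Memℓp.add hu hv).add (kpMap_add_mem _ _)
  smul_mem' c u hu := by
    change Memℓp ((c • u).1 - kpMap (c • u).2) 2
    rw [Prod.smul_fst, Prod.smul_snd, kpMap_smul, ← smul_sub]
    exact Memℓp.const_smul hu c

variable (𝕜) in
/-- The Kalton-Peck space `Z_2`. -/
def KaltonPeck : Type _ := kpSubmodule 𝕜

noncomputable instance : AddCommGroup (KaltonPeck 𝕜) := inferInstanceAs (AddCommGroup (kpSubmodule 𝕜))
noncomputable instance : Module 𝕜 (KaltonPeck 𝕜) := inferInstanceAs (Module 𝕜 (kpSubmodule 𝕜))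

namespace KaltonPeck

/-- The first coordinate `w` of `u = (w, z)`. -/
def fst (u : KaltonPeck 𝕜) : ℕ → 𝕜 := u.1.1

/-- The second coordinate `z` of `u = (w, z)`. -/
def snd (u : KaltonPeck 𝕜) : Ell 𝕜 2 := u.1.2

/-- The element `w - Ω z` of `ℓ_2`, for `u = (w, z)`. -/
noncomputable def defect (u : KaltonPeck 𝕜) : Ell 𝕜 2 := ⟨u.fst - kpMap u.snd, u.2⟩

/-- The element `(Ω z + a, z)`. -/
noncomputable def ofEll (a z : Ell 𝕜 2) : KaltonPeck 𝕜 :=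
  ⟨(kpMap z + (a : ℕ → 𝕜), z), by
    change Memℓp (kpMap z + (a : ℕ → 𝕜) - kpMap z) 2
    rw [add_sub_cancel_left]
    exact lp.memℓp a⟩

theorem fst_add (u v : KaltonPeck 𝕜) : (u + v).fst = u.fst + v.fst := rfl
theorem snd_add (u v : KaltonPeck 𝕜) : (u + v).snd = u.snd + v.snd := rfl
theorem fst_smul (c : 𝕜) (u : KaltonPeck 𝕜) : (c • u).fst = c • u.fst := rfl
theorem snd_smul (c : 𝕜) (u : KaltonPeck 𝕜) : (c • u).snd = c • u.snd := rfl

theorem fst_apply (u : KaltonPeck 𝕜) (n : ℕ) : u.fst n = kpMap u.snd n + u.defect n := by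
  change u.fst n = kpMap u.snd n + (u.fst n - kpMap u.snd n)
  ring

theorem snd_ofEll (a z : Ell 𝕜 2) : (ofEll a z).snd = z := rfl
theorem fst_ofEll (a z : Ell 𝕜 2) : (ofEll a z).fst = kpMap z + (a : ℕ → 𝕜) := rfl
theorem defect_ofEll (a z : Ell 𝕜 2) : (ofEll a z).defect = a := by
  ext n
  change (kpMap z n + a n) - kpMap z n = a n
  ring

theorem ext' {u v : KaltonPeck 𝕜} (h1 : u.fst = v.fst) (h2 : u.snd = v.snd) : u = v :=
  Subtype.ext (Prod.ext h1 h2)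

/-- The quasi-norm `‖(w, z)‖_Ω = ‖w - Ω z‖ + ‖z‖`. -/
noncomputable def quasiNorm (u : KaltonPeck 𝕜) : ℝ := ‖u.defect‖ + ‖u.snd‖

/-- The terms of the series defining the duality form. -/
noncomputable def term (u v : KaltonPeck 𝕜) (n : ℕ) : 𝕜 := v.snd n * u.fst n - v.fst n * u.snd n

/-- The duality form `B((w, z), (x, y)) = ⟨y, w⟩ - ⟨x, z⟩`. -/
noncomputable def form (u v : KaltonPeck 𝕜) : 𝕜 := ∑' n, term u v n

theorem real_log_bound {A B s t : ℝ} (hA : 0 < A) (hB : 0 < B) (hs : 0 < s) (ht : 0 < t) :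
    s * t * |Real.log (A / s) - Real.log (B / t)| ≤ B / A * s ^ 2 + A / B * t ^ 2 := by
  have key : ∀ {A B s t : ℝ}, 0 < A → 0 < B → 0 < s → 0 < t →
      s * t * (Real.log (A / s) - Real.log (B / t)) ≤ A / B * t ^ 2 := by
    intro A B s t hA hB hs ht
    rw [← Real.log_div (by positivity) (by positivity)]
    calc s * t * Real.log (A / s / (B / t)) ≤ s * t * (A / s / (B / t)) := by
          gcongr; exact Real.log_le_self (by positivity)
      _ = A / B * t ^ 2 := by field_simp
  have h1 := key hA hB hs ht
  have h2 := key hB hA ht hs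
  have h3 : 0 ≤ B / A * s ^ 2 := by positivity
  have h4 : 0 ≤ A / B * t ^ 2 := by positivity
  rw [← abs_of_pos (mul_pos hs ht), ← abs_mul, abs_le]
  constructor <;> nlinarith

theorem norm_sub_kpMap_le (z y : Ell 𝕜 2) (n : ℕ) :
    ‖y n * kpMap z n - kpMap y n * z n‖ ≤
      ‖y‖ / ‖z‖ * ‖z n‖ ^ 2 + ‖z‖ / ‖y‖ * ‖y n‖ ^ 2 := by
  have h0 : 0 ≤ ‖y‖ / ‖z‖ * ‖z n‖ ^ 2 + ‖z‖ / ‖y‖ * ‖y n‖ ^ 2 := by positivity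
  rcases eq_or_ne (z n) 0 with hz | hz
  · simpa [kpMap, hz] using h0
  rcases eq_or_ne (y n) 0 with hy | hy
  · simpa [kpMap, hy] using h0
  have hz' : z ≠ 0 := by rintro rfl; exact hz rfl
  have hy' : y ≠ 0 := by rintro rfl; exact hy rfl
  have h1 : y n * kpMap z n - kpMap y n * z n =
      z n * y n * ((Real.log (‖z‖ / ‖z n‖) - Real.log (‖y‖ / ‖y n‖) : ℝ) : 𝕜) := by
    simp only [kpMap]; push_cast; ring
  rw [h1, norm_mul, norm_mul, RCLike.norm_ofReal]
  exact real_log_bound (norm_pos_iff.2 hz') (norm_pos_iff.2 hy') (norm_pos_iff.2 hz)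
    (norm_pos_iff.2 hy)

theorem hasSum_sq (z : Ell 𝕜 2) : HasSum (fun n => ‖z n‖ ^ 2) (‖z‖ ^ 2) := by
  simpa using lp.hasSum_norm (p := 2) (by norm_num) z

theorem mul_bound (x y : Ell 𝕜 2) :
    (Summable fun n => ‖x n‖ * ‖y n‖) ∧ ∑' n, ‖x n‖ * ‖y n‖ ≤ ‖x‖ * ‖y‖ :=
  lp.tsum_mul_le_mul_norm (p := 2) (q := 2) (by
    norm_num [Real.holderConjugate_iff]) x y

/-- The part of the form that comes from the Kalton-Peck map is bounded. -/
theorem kpMap_form_bound (z y : Ell 𝕜 2) :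
    (Summable fun n => ‖y n * kpMap z n - kpMap y n * z n‖) ∧
      ∑' n, ‖y n * kpMap z n - kpMap y n * z n‖ ≤ 2 * (‖y‖ * ‖z‖) := by
  have hs := ((hasSum_sq z).mul_left (‖y‖ / ‖z‖)).add ((hasSum_sq y).mul_left (‖z‖ / ‖y‖))
  have hsum : Summable fun n => ‖y n * kpMap z n - kpMap y n * z n‖ :=
    Summable.of_nonneg_of_le (fun n => norm_nonneg _) (norm_sub_kpMap_le z y) hs.summable
  refine ⟨hsum, (hsum.tsum_le_tsum (norm_sub_kpMap_le z y) hs.summable).trans ?_⟩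
  rw [hs.tsum_eq]
  rcases eq_or_ne ‖z‖ 0 with hz | hz
  · simp [hz]
  rcases eq_or_ne ‖y‖ 0 with hy | hy
  · simp [hy]
  apply le_of_eq
  field_simp
  ring

theorem term_bound (u v : KaltonPeck 𝕜) :
    (Summable fun n => ‖term u v n‖) ∧
      ∑' n, ‖term u v n‖ ≤ 2 * (u.quasiNorm * v.quasiNorm) := by
  obtain ⟨s1, b1⟩ := kpMap_form_bound u.snd v.snd
  obtain ⟨s2, b2⟩ := mul_bound v.snd u.defect
  obtain ⟨s3, b3⟩ := mul_bound v.defect u.snd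
  have hle : ∀ n, ‖term u v n‖ ≤
      ‖v.snd n * kpMap u.snd n - kpMap v.snd n * u.snd n‖ + ‖v.snd n‖ * ‖u.defect n‖ +
        ‖v.defect n‖ * ‖u.snd n‖ := by
    intro n
    have : term u v n = (v.snd n * kpMap u.snd n - kpMap v.snd n * u.snd n) +
        v.snd n * u.defect n - v.defect n * u.snd n := by
      rw [term, fst_apply, fst_apply]; ring
    rw [this, ← norm_mul, ← norm_mul]
    exact (norm_sub_le _ _).trans (by gcongr; exact norm_add_le _ _)
  have s123 := (s1.add s2).add s3
  have hsum : Summable fun n => ‖term u v n‖ :=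
    Summable.of_nonneg_of_le (fun n => norm_nonneg _) hle s123
  refine ⟨hsum, (hsum.tsum_le_tsum hle s123).trans ?_⟩
  rw [(s1.add s2).tsum_add s3, s1.tsum_add s2]
  simp only [quasiNorm]
  nlinarith [mul_nonneg (norm_nonneg v.snd) (norm_nonneg u.defect),
    mul_nonneg (norm_nonneg v.defect) (norm_nonneg u.snd),
    mul_nonneg (norm_nonneg v.defect) (norm_nonneg u.defect)]

theorem norm_form_le (u v : KaltonPeck 𝕜) :
    ‖form u v‖ ≤ 2 * (u.quasiNorm * v.quasiNorm) :=
  (norm_tsum_le_tsum_norm (term_bound u v).1).trans (term_bound u v).2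

theorem form_add (u u' v : KaltonPeck 𝕜) : form (u + u') v = form u v + form u' v := by
  rw [form, form, form,
    ← ((term_bound u v).1.of_norm).tsum_add ((term_bound u' v).1.of_norm)]
  congr 1
  ext n
  simp only [term, fst_add, snd_add, Pi.add_apply, lp.coeFn_add]
  ring

theorem form_smul (c : 𝕜) (u v : KaltonPeck 𝕜) : form (c • u) v = c * form u v := by
  rw [form, form, ← tsum_mul_left]
  congr 1
  ext n
  simp only [term, fst_smul, snd_smul, Pi.smul_apply, lp.coeFn_smul, smul_eq_mul]
  ring

/-- The norm of `Z_2` is the norm dual to the quasi-norm: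
`‖u‖ = sup {|B(u, v)| : ‖v‖_Ω ≤ 1}`. It is equivalent to the quasi-norm `‖·‖_Ω`. -/
noncomputable instance : Norm (KaltonPeck 𝕜) where
  norm u := ⨆ v : {v : KaltonPeck 𝕜 // v.quasiNorm ≤ 1}, ‖form u v.1‖

theorem norm_def (u : KaltonPeck 𝕜) :
    ‖u‖ = ⨆ v : {v : KaltonPeck 𝕜 // v.quasiNorm ≤ 1}, ‖form u v.1‖ := rfl

theorem quasiNorm_nonneg (u : KaltonPeck 𝕜) : 0 ≤ u.quasiNorm :=
  add_nonneg (norm_nonneg _) (norm_nonneg _)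

theorem norm_form_le' (u : KaltonPeck 𝕜) {v : KaltonPeck 𝕜} (hv : v.quasiNorm ≤ 1) :
    ‖form u v‖ ≤ 2 * u.quasiNorm :=
  (norm_form_le u v).trans (by nlinarith [u.quasiNorm_nonneg])

theorem bddAbove_form (u : KaltonPeck 𝕜) :
    BddAbove (Set.range fun v : {v : KaltonPeck 𝕜 // v.quasiNorm ≤ 1} => ‖form u v.1‖) := by
  refine ⟨2 * u.quasiNorm, ?_⟩
  rintro _ ⟨v, rfl⟩
  exact norm_form_le' u v.2

theorem le_norm (u : KaltonPeck 𝕜) {v : KaltonPeck 𝕜} (hv : v.quasiNorm ≤ 1) :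
    ‖form u v‖ ≤ ‖u‖ := le_ciSup (bddAbove_form u) ⟨v, hv⟩

theorem quasiNorm_ofEll (a z : Ell 𝕜 2) : (ofEll a z).quasiNorm = ‖a‖ + ‖z‖ := by
  rw [quasiNorm, defect_ofEll, snd_ofEll]

instance : Nonempty {v : KaltonPeck 𝕜 // v.quasiNorm ≤ 1} :=
  ⟨⟨ofEll 0 0, by rw [quasiNorm_ofEll]; simp⟩⟩

theorem norm_le_of_forall {u : KaltonPeck 𝕜} {C : ℝ}
    (h : ∀ v : KaltonPeck 𝕜, v.quasiNorm ≤ 1 → ‖form u v‖ ≤ C) : ‖u‖ ≤ C :=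
  ciSup_le fun v => h v.1 v.2

theorem norm_le_quasiNorm (u : KaltonPeck 𝕜) : ‖u‖ ≤ 2 * u.quasiNorm :=
  norm_le_of_forall fun _ hv => norm_form_le' u hv

/-- The element of norm at most one of `ℓ_2` that norms `a`. -/
theorem exists_norming (a : Ell 𝕜 2) :
    ∃ b : Ell 𝕜 2, ‖b‖ ≤ 1 ∧ HasSum (fun n => b n * a n) ((‖a‖ : ℝ) : 𝕜) := by
  rcases eq_or_ne a 0 with rfl | ha
  · refine ⟨0, by simp, ?_⟩
    simp
  · have ha' : ‖a‖ ≠ 0 := norm_ne_zero_iff.2 ha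
    refine ⟨((‖a‖⁻¹ : ℝ) : 𝕜) • star a, ?_, ?_⟩
    · rw [norm_smul, norm_star, RCLike.norm_ofReal, abs_of_nonneg (by positivity),
        inv_mul_cancel₀ ha']
    · have h := ((hasSum_sq a).mul_left ‖a‖⁻¹).mapL (RCLike.ofRealCLM : ℝ →L[ℝ] 𝕜)
      convert h using 1
      · ext n
        simp only [lp.coeFn_smul, lp.coeFn_star, Pi.smul_apply, Pi.star_apply, smul_eq_mul,
          RCLike.ofRealCLM_apply, RCLike.ofReal_mul, RCLike.ofReal_pow]
        rw [mul_assoc, RCLike.star_def, RCLike.conj_mul]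
      · simp only [RCLike.ofRealCLM_apply]
        congr 1
        field_simp

theorem norm_snd_le (u : KaltonPeck 𝕜) : ‖u.snd‖ ≤ ‖u‖ := by
  obtain ⟨b, hb, hsum⟩ := exists_norming u.snd
  have h := le_norm u (v := ofEll b 0) (by rw [quasiNorm_ofEll]; simpa using hb)
  have hf : form u (ofEll b 0) = -((‖u.snd‖ : ℝ) : 𝕜) := by
    rw [form, ← hsum.neg.tsum_eq]
    congr 1
    ext n
    simp [term, snd_ofEll, fst_ofEll, kpMap_zero]
  rwa [hf, norm_neg, RCLike.norm_ofReal, abs_of_nonneg (norm_nonneg _)] at h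

theorem norm_defect_le (u : KaltonPeck 𝕜) : ‖u.defect‖ ≤ 3 * ‖u‖ := by
  obtain ⟨y, hy, hsum⟩ := exists_norming u.defect
  have h := le_norm u (v := ofEll 0 y) (by rw [quasiNorm_ofEll]; simpa using hy)
  obtain ⟨s1, b1⟩ := kpMap_form_bound u.snd y
  have hf : form u (ofEll 0 y) =
      ∑' n, (y n * kpMap u.snd n - kpMap y n * u.snd n) + ((‖u.defect‖ : ℝ) : 𝕜) := by
    rw [← hsum.tsum_eq, ← s1.of_norm.tsum_add hsum.summable, form]
    congr 1
    ext n
    rw [term, snd_ofEll, fst_ofEll, fst_apply]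
    simp only [Pi.add_apply, lp.coeFn_zero, Pi.zero_apply]
    ring
  have h2 : ((‖u.defect‖ : ℝ) : 𝕜) =
      form u (ofEll 0 y) - ∑' n, (y n * kpMap u.snd n - kpMap y n * u.snd n) := by
    rw [hf]; ring
  have h3 : ‖u.defect‖ = ‖((‖u.defect‖ : ℝ) : 𝕜)‖ := by
    rw [RCLike.norm_ofReal, abs_of_nonneg (norm_nonneg _)]
  have h4 := norm_snd_le u
  have h5 := (norm_tsum_le_tsum_norm s1).trans b1
  rw [h3, h2]
  refine (norm_sub_le _ _).trans ?_
  nlinarith [norm_nonneg u.snd]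

/-- Together with `norm_le_quasiNorm`: the norm is equivalent to the quasi-norm. -/
theorem quasiNorm_le_norm (u : KaltonPeck 𝕜) : u.quasiNorm ≤ 4 * ‖u‖ := by
  rw [quasiNorm]
  linarith [norm_snd_le u, norm_defect_le u]

theorem normCore : NormedSpace.Core 𝕜 (KaltonPeck 𝕜) where
  norm_nonneg u := (norm_nonneg _).trans (norm_snd_le u)
  norm_smul c u := by
    rw [norm_def, norm_def, Real.mul_iSup_of_nonneg (norm_nonneg c)]
    congr 1
    ext v
    rw [form_smul, norm_mul]
  norm_triangle u u' := norm_le_of_forall fun v hv => by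
    rw [form_add]
    exact (norm_add_le _ _).trans (add_le_add (le_norm u hv) (le_norm u' hv))
  norm_eq_zero_iff u := by
    refine ⟨fun h => ?_, ?_⟩
    · have h1 : u.snd = 0 := norm_le_zero_iff.1 (h ▸ norm_snd_le u)
      have h2 : u.defect = 0 := norm_le_zero_iff.1 (by simpa [h] using norm_defect_le u)
      refine ext' ?_ h1
      ext n
      rw [fst_apply, h1, h2, kpMap_zero]
      exact add_zero (0 : 𝕜)
    · rintro rfl
      refine le_antisymm (norm_le_of_forall fun v _ => ?_)
        ((norm_nonneg _).trans (norm_snd_le _))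
      have : form (0 : KaltonPeck 𝕜) v = 0 := by
        have := form_smul (0 : 𝕜) (0 : KaltonPeck 𝕜) v
        rwa [zero_smul, zero_mul] at this
      rw [this, norm_zero]

noncomputable instance : NormedAddCommGroup (KaltonPeck 𝕜) := NormedAddCommGroup.ofCore normCore
noncomputable instance : NormedSpace 𝕜 (KaltonPeck 𝕜) := NormedSpace.ofCore normCore

/-- The embedding `a ↦ (a, 0)` of `ℓ_2` into `Z_2`. -/
noncomputable def incl : Ell 𝕜 2 →L[𝕜] KaltonPeck 𝕜 :=
  LinearMap.mkContinuous
    { toFun := fun a => ofEll a 0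
      map_add' := fun a b => ext' (by
        rw [fst_add, fst_ofEll, fst_ofEll, fst_ofEll, kpMap_zero, lp.coeFn_add]; simp)
        (by rw [snd_add, snd_ofEll, snd_ofEll, snd_ofEll, add_zero])
      map_smul' := fun c a => ext' (by
        rw [RingHom.id_apply, fst_smul, fst_ofEll, fst_ofEll, kpMap_zero, lp.coeFn_smul]; simp)
        (by rw [RingHom.id_apply, snd_smul, snd_ofEll, snd_ofEll, smul_zero]) }
    2 fun a => by
      have := norm_le_quasiNorm (ofEll a 0)
      rwa [quasiNorm_ofEll, norm_zero, add_zero] at this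

/-- The quotient map `(w, z) ↦ z` of `Z_2` onto `ℓ_2`. -/
noncomputable def proj : KaltonPeck 𝕜 →L[𝕜] Ell 𝕜 2 :=
  LinearMap.mkContinuous
    { toFun := snd
      map_add' := snd_add
      map_smul' := snd_smul }
    1 fun u => by
      rw [one_mul]
      exact norm_snd_le u

theorem incl_apply (a : Ell 𝕜 2) : incl a = ofEll a 0 := rfl
theorem proj_apply (u : KaltonPeck 𝕜) : proj u = u.snd := rfl

/-- The embedding of `ℓ_2` into `Z_2` is isometric. -/
theorem norm_incl (a : Ell 𝕜 2) : ‖incl a‖ = ‖a‖ := by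
  refine le_antisymm (norm_le_of_forall fun v hv => ?_) ?_
  · obtain ⟨s, b⟩ := mul_bound v.snd a
    have hf : form (incl a) v = ∑' n, v.snd n * a n := by
      rw [form]
      congr 1
      ext n
      simp [term, incl_apply, snd_ofEll, fst_ofEll, kpMap_zero]
    have hv' : ‖v.snd‖ ≤ 1 := by
      rw [quasiNorm] at hv
      linarith [norm_nonneg v.defect]
    rw [hf]
    refine (norm_tsum_le_tsum_norm (by simpa only [norm_mul] using s)).trans ?_
    simp only [norm_mul]
    nlinarith [norm_nonneg a]
  · obtain ⟨y, hy, hsum⟩ := exists_norming a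
    have h := le_norm (incl a) (v := ofEll 0 y) (by rw [quasiNorm_ofEll]; simpa using hy)
    have hf : form (incl a) (ofEll 0 y) = ((‖a‖ : ℝ) : 𝕜) := by
      rw [form, ← hsum.tsum_eq]
      congr 1
      ext n
      simp [term, incl_apply, snd_ofEll, fst_ofEll, kpMap_zero]
    rwa [hf, RCLike.norm_ofReal, abs_of_nonneg (norm_nonneg _)] at h

variable (𝕜) in
/-- The self-extension `0 → ℓ_2 → Z_2 → ℓ_2 → 0`. -/
noncomputable def selfExtension : SelfExtension 𝕜 2 (KaltonPeck 𝕜) where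
  incl := incl
  proj := proj
  incl_injective a b h := by
    have := congrArg defect h
    rwa [incl_apply, incl_apply, defect_ofEll, defect_ofEll] at this
  exact u := by
    rw [proj_apply]
    refine ⟨fun h => ⟨u.defect, ext' ?_ ?_⟩, ?_⟩
    · ext n
      rw [incl_apply, fst_ofEll, fst_apply, h]
      rfl
    · rw [h]; rfl
    · rintro ⟨a, rfl⟩
      rfl
  proj_surjective z := ⟨ofEll 0 z, rfl⟩

end KaltonPeck

end KaltonPeck

section KaltonSwanson

/-- The space `L(Z_2)`, to be endowed with the seminorm `T ↦ lim_U ‖T(e_n, 0)‖`. -/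
def KSPre (𝕜 : Type*) [RCLike 𝕜] (_U : Ultrafilter ℕ) : Type _ :=
  KaltonPeck 𝕜 →L[𝕜] KaltonPeck 𝕜

variable (𝕜 : Type*) [RCLike 𝕜] (U : Ultrafilter ℕ)

/-- The bounded sequence of the unit vectors `e_n` of `ℓ_2`. -/
noncomputable def unitVectors : BddSeq (Ell 𝕜 2) :=
  ⟨fun n => lp.single 2 n (1 : 𝕜), memℓp_infty ⟨1, by
    rintro _ ⟨n, rfl⟩
    simp [lp.norm_single]⟩⟩

noncomputable instance : AddCommGroup (KSPre 𝕜 U) :=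
  inferInstanceAs (AddCommGroup (KaltonPeck 𝕜 →L[𝕜] KaltonPeck 𝕜))
noncomputable instance : Module 𝕜 (KSPre 𝕜 U) :=
  inferInstanceAs (Module 𝕜 (KaltonPeck 𝕜 →L[𝕜] KaltonPeck 𝕜))

variable {𝕜 U} in
/-- An element of `KSPre` seen as an operator on `Z_2`. -/
def KSPre.toOp (T : KSPre 𝕜 U) : KaltonPeck 𝕜 →L[𝕜] KaltonPeck 𝕜 := T

/-- The map `L(Z_2) → (Z_2)_U` that sends `T` to the class of the sequence `(T(e_n, 0))`. -/
noncomputable def ksMap : KSPre 𝕜 U →ₗ[𝕜] Ultrapower 𝕜 (KaltonPeck 𝕜) U where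
  toFun T := Submodule.Quotient.mk (seqMap T.toOp (seqMap KaltonPeck.incl (unitVectors 𝕜)))
  map_add' _ _ := rfl
  map_smul' _ _ := rfl

/-- The seminorm `T ↦ lim_U ‖T(e_n, 0)‖` on `L(Z_2)` (see `ksPre_tendsto_norm`). -/
noncomputable instance : SeminormedAddCommGroup (KSPre 𝕜 U) :=
  SeminormedAddCommGroup.induced _ _ (ksMap 𝕜 U)
noncomputable instance : NormedSpace 𝕜 (KSPre 𝕜 U) :=
  NormedSpace.induced 𝕜 (KSPre 𝕜 U) (Ultrapower 𝕜 (KaltonPeck 𝕜) U) (ksMap 𝕜 U)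

/-- The seminorm of `T ∈ L(Z_2)` is `lim_U ‖T(e_n, 0)‖`. -/
theorem ksPre_tendsto_norm (T : KSPre 𝕜 U) :
    Tendsto (fun n => ‖T.toOp (KaltonPeck.incl (unitVectors 𝕜 n))‖) U (𝓝 ‖T‖) := by
  have h := ultrapower_tendsto_norm (𝕜 := 𝕜) U
    (seqMap T.toOp (seqMap KaltonPeck.incl (unitVectors 𝕜)))
  simp only [seqMap_apply] at h
  exact h

/-- The Kalton-Swanson space `H`: the completion of the quotient of `L(Z_2)` by
`{T : (T, T) = 0}` with respect to the norm `(T, T)^{1/2} = lim_U ‖T(e_n, 0)‖`. (This is a Hilbert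
norm, since `T(e_n, 0)` approaches the isometric copy of `ℓ_2` in `Z_2`; for the same reason the
quasi-norm of `Z_2` gives the same limit.) -/
abbrev KSSpace : Type _ := UniformSpace.Completion (KSPre 𝕜 U)

variable {𝕜}

/-- Left multiplication `T ↦ A T`. -/
noncomputable def ksMul (A : KaltonPeck 𝕜 →L[𝕜] KaltonPeck 𝕜) : KSPre 𝕜 U →L[𝕜] KSPre 𝕜 U :=
  LinearMap.mkContinuous
    { toFun := fun T => A.comp T.toOp
      map_add' := fun S T => ContinuousLinearMap.comp_add A S T
      map_smul' := fun c T => ContinuousLinearMap.comp_smul A c T }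
    ‖A‖ fun T => ((ultraMap U A).le_opNorm (ksMap 𝕜 U T)).trans
      (mul_le_mul_of_nonneg_right (norm_ultraMap_le U A) (norm_nonneg _))

/-- The Kalton-Swanson representation `Λ : L(Z_2) → L(H)`: `Λ(A)` maps the class of `T` to the
class of `A T`. -/
noncomputable def ksLambda (A : KaltonPeck 𝕜 →L[𝕜] KaltonPeck 𝕜) :
    KSSpace 𝕜 U →L[𝕜] KSSpace 𝕜 U := (ksMul U A).completion

end KaltonSwanson

universe v

/-! Conditions (a), (b) and (e) each say that a bounded linear map on the Banach space `L(Y)` has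
closed range: `Λ`, `β`, and the map taking `T` to the class of `T|ℓ_p` modulo compact operators. The
norm of the image of `T` under each of them is equivalent to `‖T‖_S`. By the open mapping theorem,
closedness of the range of `φ` depends only on the equivalence class of the seminorm `‖φ T‖`: it
holds exactly when some `K` gives every `T` a representative `T'` modulo the kernel with `‖T'‖ ≤ K
‖T‖_S` (`isClosed_range_iff_of_seminorm`). As the kernel is `S(Y)`, this is also (d)
(`isSingNormEquivalent_iff`). Condition (f) is (e) pulled back along the quotient map, and (c)
enters through (d) → (c) → (b).

The seminorms are compared through one quantity, the asymptotic size of `T` on weakly null sequences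
of the unit ball of `ℓ_p` (`EssBound`). Upper bounds for it become bounds for the Calkin norm
because, for `p > 1`, normalized tails are weakly null, so `T|ℓ_p` is small on a tail of `ℓ_p`. They
become bounds for `‖T‖_S` because strict singularity of `π` puts every subspace of `Y`, after
shrinking, close to such a tail (`singNorm_le_of_essBound`). Conversely, a weakly null sequence with
large images under `T` yields, by a gliding hump, a block copy of `ℓ_p` on which `T` is bounded
below (`essBound_of_singNorm`). The same argument shows that `π T i` maps weakly null sequences to
norm null ones, and so `β(T)` takes its values in `W_p`.

For `Z_2` two more facts are needed. The quotient map is strictly singular, because signed sums of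
lifts of disjoint unit vectors acquire a factor `log √N` (`log_le_of_lift`). And every normalized
block sequence in `ℓ_2` is the image of the unit vectors under an operator on `Z_2`
(`KaltonPeck.exists_blockOperator`), so that `H` has enough elements for the norm of `Λ(A)` to
detect the behaviour of `A` on all weakly null sequences (`essBound_norm_ksLambda`). -/

/-! ### Disjoint blocks and gliding humps in `ℓ_p`. -/

section SequenceSpaces

/-- Nonnegativity allows the summation to be regrouped along the fibres of `κ`. With `κ j` the index
of the block containing `j`, this computes `ℓ_p` norms block by block. -/
theorem hasSum_of_fiberwise {f s : ℕ → ℝ} {S : ℝ} (hf : ∀ j, 0 ≤ f j) (κ : ℕ → ℕ)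
    (hs : ∀ k, HasSum (fun j => if κ j = k then f j else 0) (s k)) (h : HasSum s S) :
    HasSum f S := by
  have hfib : ∀ k, HasSum (fun j : {j // κ j = k} => f j) (s k) := fun k => by
    have := hs k
    rw [show (fun j => if κ j = k then f j else 0) = Set.indicator {j | κ j = k} f by
      ext j; simp [Set.indicator_apply]] at this
    exact hasSum_subtype_iff_indicator.2 this
  have hsum : Summable fun x : Σ k, {j // κ j = k} => f x.2 := by
    rw [summable_sigma_of_nonneg fun x => hf _]
    refine ⟨fun k => (hfib k).summable, ?_⟩
    simpa only [(hfib _).tsum_eq] using h.summable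
  have h2 := hsum.hasSum.sigma hfib
  have h3 := hsum.hasSum
  rw [h2.unique h] at h3
  exact (Equiv.sigmaFiberEquiv κ).hasSum_iff.1 h3

variable {𝕜 : Type*} [RCLike 𝕜] {p : ℝ≥0∞} [hp1 : Fact (1 ≤ p)]

theorem toReal_pos_of_ne_top (hp : p ≠ ∞) : 0 < p.toReal :=
  ENNReal.toReal_pos (zero_lt_one.trans_le hp1.out).ne' hp

theorem hasSum_block (hp : p ≠ ∞) {κ : ℕ → ℕ} {u : ℕ → Ell 𝕜 p}
    (hu : ∀ k j, κ j ≠ k → u k j = 0) {B : ℝ} (hB : ∀ k, ‖u k‖ ≤ B) (a : Ell 𝕜 p) :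
    Summable (fun k => (‖a k‖ * ‖u k‖) ^ p.toReal) ∧
    HasSum (fun j => ‖a (κ j) * u (κ j) j‖ ^ p.toReal) (∑' k, (‖a k‖ * ‖u k‖) ^ p.toReal) := by
  have hp0 := toReal_pos_of_ne_top hp
  have hB0 : 0 ≤ B := (norm_nonneg _).trans (hB 0)
  have hs : Summable fun k => (‖a k‖ * ‖u k‖) ^ p.toReal := by
    refine Summable.of_nonneg_of_le (fun k => by positivity) (fun k => ?_)
      (((lp.memℓp a).summable hp0).mul_left (B ^ p.toReal))
    rw [← Real.mul_rpow hB0 (norm_nonneg _), mul_comm B]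
    gcongr
    exact hB k
  refine ⟨hs, hasSum_of_fiberwise (fun j => by positivity) κ (fun k => ?_) hs.hasSum⟩
  rw [Real.mul_rpow (norm_nonneg _) (norm_nonneg _)]
  refine ((lp.hasSum_norm hp0 (u k)).mul_left (‖a k‖ ^ p.toReal)).congr_fun fun j => ?_
  split_ifs with h
  · rw [h, norm_mul, Real.mul_rpow (norm_nonneg _) (norm_nonneg _)]
  · rw [hu k j h, norm_zero, Real.zero_rpow hp0.ne', mul_zero]

/-- The operator on `ℓ_p` that maps the unit vectors to a bounded sequence of disjointly supported
vectors. -/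
theorem exists_blockOperator (hp : p ≠ ∞) {κ : ℕ → ℕ} {u : ℕ → Ell 𝕜 p}
    (hu : ∀ k j, κ j ≠ k → u k j = 0) {B : ℝ} (hB : ∀ k, ‖u k‖ ≤ B) :
    ∃ J : Ell 𝕜 p →L[𝕜] Ell 𝕜 p, (∀ a j, J a j = a (κ j) * u (κ j) j) ∧
      (∀ a, ‖J a‖ ≤ B * ‖a‖) ∧ ∀ A : ℝ, 0 ≤ A → (∀ k, A ≤ ‖u k‖) → ∀ a, A * ‖a‖ ≤ ‖J a‖ := by
  have hp0 := toReal_pos_of_ne_top hp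
  have hB0 : 0 ≤ B := (norm_nonneg _).trans (hB 0)
  let L : Ell 𝕜 p →ₗ[𝕜] Ell 𝕜 p :=
    { toFun := fun a => ⟨fun j => a (κ j) * u (κ j) j,
        memℓp_gen (hasSum_block hp hu hB a).2.summable⟩
      map_add' := fun a b => by ext j; exact add_mul _ _ _
      map_smul' := fun c a => by ext j; exact mul_assoc _ _ _ }
  have hL : ∀ a, ‖L a‖ ^ p.toReal = ∑' k, (‖a k‖ * ‖u k‖) ^ p.toReal := fun a => by
    rw [lp.norm_rpow_eq_tsum hp0]
    exact (hasSum_block hp hu hB a).2.tsum_eq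
  have hle : ∀ a, ‖L a‖ ≤ B * ‖a‖ := fun a => by
    rw [← Real.rpow_le_rpow_iff (norm_nonneg _) (by positivity) hp0, hL,
      Real.mul_rpow hB0 (norm_nonneg _), lp.norm_rpow_eq_tsum hp0, ← tsum_mul_left]
    refine (hasSum_block hp hu hB a).1.tsum_le_tsum (fun k => ?_)
      (((lp.memℓp a).summable hp0).mul_left _)
    rw [← Real.mul_rpow hB0 (norm_nonneg _), mul_comm B]
    gcongr
    exact hB k
  refine ⟨L.mkContinuous B hle, fun a j => rfl, hle, fun A hA hAu a => ?_⟩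
  change A * ‖a‖ ≤ ‖L a‖
  rw [← Real.rpow_le_rpow_iff (by positivity) (norm_nonneg _) hp0, hL,
    Real.mul_rpow hA (norm_nonneg _), lp.norm_rpow_eq_tsum hp0, ← tsum_mul_left]
  refine (((lp.memℓp a).summable hp0).mul_left _).tsum_le_tsum (fun k => ?_)
    (hasSum_block hp hu hB a).1
  rw [← Real.mul_rpow hA (norm_nonneg _), mul_comm A]
  gcongr
  exact hAu k

theorem memℓp_indicator {p : ℝ≥0∞} (s : Set ℕ) (a : Ell 𝕜 p) : Memℓp (s.indicator (a : ℕ → 𝕜)) p :=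
  (lp.memℓp a).mono' fun j => by
    by_cases h : j ∈ s <;> simp [h]

/-- The restriction of a sequence to a set of coordinates. -/
noncomputable def lpRestrict (s : Set ℕ) : Ell 𝕜 p →L[𝕜] Ell 𝕜 p :=
  LinearMap.mkContinuous
    { toFun := fun a => ⟨s.indicator (a : ℕ → 𝕜), memℓp_indicator s a⟩
      map_add' := fun a b => by
        ext j
        exact congrFun (Set.indicator_add s (a : ℕ → 𝕜) (b : ℕ → 𝕜)) j
      map_smul' := fun c a => by
        ext j
        exact congrFun (Set.indicator_const_smul s c (a : ℕ → 𝕜)) j }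
    1 fun a => by
      rw [one_mul]
      refine lp.norm_mono (zero_lt_one.trans_le hp1.out).ne' fun j => ?_
      change ‖s.indicator (a : ℕ → 𝕜) j‖ ≤ _
      by_cases h : j ∈ s <;> simp [h]

open Classical in
theorem lpRestrict_apply (s : Set ℕ) (a : Ell 𝕜 p) (j : ℕ) :
    lpRestrict s a j = if j ∈ s then a j else 0 := Set.indicator_apply _ _ _

theorem norm_lpRestrict_le (s : Set ℕ) (a : Ell 𝕜 p) : ‖lpRestrict s a‖ ≤ ‖a‖ := by
  refine lp.norm_mono (zero_lt_one.trans_le hp1.out).ne' fun j => ?_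
  rw [lpRestrict_apply]
  split_ifs <;> simp

theorem lpRestrict_Iio (m : ℕ) (a : Ell 𝕜 p) :
    lpRestrict (Set.Iio m) a = ∑ j ∈ Finset.range m, lp.single p j (a j) := by
  ext j
  rw [lpRestrict_apply, lp.coeFn_sum, Finset.sum_apply]
  simp only [Set.mem_Iio, lp.coeFn_single, Pi.single_apply]
  simp

theorem lpRestrict_compl (s : Set ℕ) (a : Ell 𝕜 p) :
    lpRestrict sᶜ a = a - lpRestrict s a := by
  ext j
  rw [lp.coeFn_sub, Pi.sub_apply, lpRestrict_apply, lpRestrict_apply]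
  by_cases h : j ∈ s <;> simp [h]

theorem norm_lpRestrict_Iio_le (m : ℕ) (a : Ell 𝕜 p) :
    ‖lpRestrict (Set.Iio m) a‖ ≤ ∑ j ∈ Finset.range m, ‖a j‖ := by
  rw [lpRestrict_Iio]
  refine (norm_sum_le _ _).trans (Finset.sum_le_sum fun j _ => ?_)
  rw [lp.norm_single (zero_lt_one.trans_le hp1.out)]

theorem tendsto_lpRestrict_Ici (hp : p ≠ ∞) (a : Ell 𝕜 p) :
    Tendsto (fun m => ‖lpRestrict (Set.Ici m) a‖) atTop (𝓝 0) := by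
  have h := (lp.hasSum_single hp a).tendsto_sum_nat
  have h2 : Tendsto (fun m => ‖a - lpRestrict (Set.Iio m) a‖) atTop (𝓝 0) := by
    simp only [lpRestrict_Iio]
    simpa using (tendsto_const_nhds (x := a)).sub h |>.norm
  refine h2.congr fun m => ?_
  rw [← lpRestrict_compl, Set.compl_Iio]

theorem tendsto_lpRestrict_Iio {x : ℕ → Ell 𝕜 p}
    (hx : ∀ j, Tendsto (fun n => x n j) atTop (𝓝 0)) (m : ℕ) :
    Tendsto (fun n => ‖lpRestrict (Set.Iio m) (x n)‖) atTop (𝓝 0) := by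
  refine squeeze_zero (fun n => norm_nonneg _) (fun n => norm_lpRestrict_Iio_le m (x n)) ?_
  have : Tendsto (fun n => ∑ j ∈ Finset.range m, ‖x n j‖) atTop
      (𝓝 (∑ j ∈ Finset.range m, (0 : ℝ))) :=
    tendsto_finsetSum _ fun j _ => by simpa using (hx j).norm
  simpa using this

theorem norm_sub_lpRestrict_le {l m : ℕ} {s : Set ℕ} (hs : Set.Ico l m ⊆ s) (a : Ell 𝕜 p) :
    ‖a - lpRestrict s a‖ ≤ ‖lpRestrict (Set.Iio l) a‖ + ‖lpRestrict (Set.Ici m) a‖ := by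
  rw [← lpRestrict_compl]
  -- A coordinate outside `s` lies before `l` or from `m` on. Removing `Iio l` in the second term
  -- prevents double counting when `m ≤ l`.
  have h : lpRestrict sᶜ a =
      lpRestrict sᶜ (lpRestrict (Set.Iio l) a) + lpRestrict (sᶜ \ Set.Iio l)
        (lpRestrict (Set.Ici m) a) := by
    ext j
    simp only [lp.coeFn_add, Pi.add_apply, lpRestrict_apply, Set.mem_compl_iff, Set.mem_sdiff,
      Set.mem_Iio, Set.mem_Ici]
    by_cases h1 : j ∈ s
    · simp [h1]
    · have h2 : j < l ∨ m ≤ j := by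
        by_contra! h
        exact h1 (hs ⟨h.1, h.2⟩)
      by_cases h3 : j < l
      · simp [h1, h3]
      · simp [h1, h3, h2.resolve_left h3]
  rw [h]
  exact (norm_add_le _ _).trans (add_le_add (norm_lpRestrict_le _ _) (norm_lpRestrict_le _ _))

/-- The map sending `j` to the index of the interval `[m k, m (k + 1))` containing it. -/
theorem exists_intervalIndex {m : ℕ → ℕ} (hm : StrictMono m) :
    ∃ κ : ℕ → ℕ, ∀ k, Set.Ico (m k) (m (k + 1)) ⊆ {j | κ j = k} := by
  -- Searching only up to `j` loses nothing, since `k ≤ m k ≤ j`. Indices below `m 0` receive the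
  -- value `0`, which the inclusion tolerates.
  refine ⟨fun j => Nat.findGreatest (fun k => m k ≤ j) j, fun k j hj => ?_⟩
  simp only [Set.mem_ofPred_eq]
  rw [Nat.findGreatest_eq_iff]
  refine ⟨(hm.id_le k).trans hj.1, fun _ => hj.1, fun n hn _ hle => ?_⟩
  have h1 := hm.monotone (Nat.succ_le_of_lt hn)
  have h2 := hj.2
  simp only [Nat.succ_eq_add_one] at h1
  omega

/-- The gliding hump: two coordinatewise null sequences have approximately disjointly supported
subsequences. -/
theorem exists_blocks (hp : p ≠ ∞) {x y : ℕ → Ell 𝕜 p}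
    (hx : ∀ j, Tendsto (fun n => x n j) atTop (𝓝 0))
    (hy : ∀ j, Tendsto (fun n => y n j) atTop (𝓝 0)) {ε : ℕ → ℝ} (hε : ∀ k, 0 < ε k)
    {P : ℕ → ℕ → Prop} (hP : ∀ k, ∀ᶠ n in atTop, P k n) :
    ∃ κ n : ℕ → ℕ, ∀ k, P k (n k) ∧
      ‖x (n k) - lpRestrict {j | κ j = k} (x (n k))‖ ≤ ε k ∧
      ‖y (n k) - lpRestrict {j | κ j = k} (y (n k))‖ ≤ ε k := by
  -- The index `n` is chosen first, so that both heads before `m` are small, and then `m'`, so that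
  -- both tails are. The predicate `P` lets further eventual properties be imposed on `n`.
  have step : ∀ k m : ℕ, ∃ n m', m < m' ∧ P k n ∧
      ‖lpRestrict (Set.Iio m) (x n)‖ ≤ ε k / 2 ∧ ‖lpRestrict (Set.Iio m) (y n)‖ ≤ ε k / 2 ∧
      ‖lpRestrict (Set.Ici m') (x n)‖ ≤ ε k / 2 ∧
      ‖lpRestrict (Set.Ici m') (y n)‖ ≤ ε k / 2 := by
    intro k m
    have hk : 0 < ε k / 2 := half_pos (hε k)
    obtain ⟨n, h1, h2, h3⟩ := ((hP k).and
      (((tendsto_lpRestrict_Iio hx m).eventually (ge_mem_nhds hk)).and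
        ((tendsto_lpRestrict_Iio hy m).eventually (ge_mem_nhds hk)))).exists
    obtain ⟨m', h4, h5, h6⟩ := ((eventually_gt_atTop m).and
      (((tendsto_lpRestrict_Ici hp (x n)).eventually (ge_mem_nhds hk)).and
        ((tendsto_lpRestrict_Ici hp (y n)).eventually (ge_mem_nhds hk)))).exists
    exact ⟨n, m', h4, h1, h2, h3, h5, h6⟩
  choose n m' hm' hPn hx1 hy1 hx2 hy2 using step
  let m : ℕ → ℕ := fun k => Nat.rec 0 (fun k m => m' k m) k
  have hm : StrictMono m := strictMono_nat_of_lt_succ fun k => hm' k (m k)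
  obtain ⟨κ, hκ⟩ := exists_intervalIndex hm
  refine ⟨κ, fun k => n k (m k), fun k => ⟨hPn _ _, ?_, ?_⟩⟩
  · linarith [norm_sub_lpRestrict_le (hκ k) (x (n k (m k))), hx1 k (m k),
      show ‖lpRestrict (Set.Ici (m (k + 1))) (x (n k (m k)))‖ ≤ ε k / 2 from hx2 k (m k)]
  · linarith [norm_sub_lpRestrict_le (hκ k) (y (n k (m k))), hy1 k (m k),
      show ‖lpRestrict (Set.Ici (m (k + 1))) (y (n k (m k)))‖ ≤ ε k / 2 from hy2 k (m k)]

variable {F : Type*} [NormedAddCommGroup F] [NormedSpace 𝕜 F]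

/-- An operator on `ℓ_p` is controlled by its values on the unit vectors. -/
theorem norm_le_of_norm_single_le (hp : p ≠ ∞) (S : Ell 𝕜 p →L[𝕜] F) {η : ℝ}
    (h : ∀ k, ‖S (lp.single p k 1)‖ ≤ η * (1 / 2) ^ k) (a : Ell 𝕜 p) : ‖S a‖ ≤ 2 * η * ‖a‖ := by
  have hsum := (lp.hasSum_single hp a).mapL S
  have hg : HasSum (fun k : ℕ => ‖a‖ * η * (1 / 2) ^ k) (‖a‖ * η * 2) :=
    hasSum_geometric_two.mul_left _
  have hle : ∀ k, ‖S (lp.single p k (a k))‖ ≤ ‖a‖ * η * (1 / 2) ^ k := fun k => by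
    have : lp.single p k (a k) = a k • lp.single (E := fun _ : ℕ => 𝕜) p k (1 : 𝕜) := by
      rw [← lp.single_smul, smul_eq_mul, mul_one]
    rw [this, map_smul, norm_smul, mul_assoc]
    gcongr
    · exact lp.norm_apply_le_norm (zero_lt_one.trans_le hp1.out).ne' a k
    · exact h k
  rw [← hsum.tsum_eq]
  exact (tsum_of_norm_bounded hg hle).trans (by linarith)

theorem blockOperator_single {κ : ℕ → ℕ} {u : ℕ → Ell 𝕜 p}
    (hu : ∀ k j, κ j ≠ k → u k j = 0) {J : Ell 𝕜 p →L[𝕜] Ell 𝕜 p}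
    (hJ : ∀ a j, J a j = a (κ j) * u (κ j) j) (k : ℕ) : J (lp.single p k 1) = u k := by
  ext j
  rw [hJ]
  rcases eq_or_ne (κ j) k with h | h
  · rw [h, lp.single_apply_self, one_mul]
  · rw [hu k j h, lp.single_apply_ne _ _ _ h, zero_mul]

theorem lpRestrict_fiber {κ : ℕ → ℕ} (x : ℕ → Ell 𝕜 p) (k j : ℕ) (h : κ j ≠ k) :
    lpRestrict {j | κ j = k} (x k) j = 0 := by
  rw [lpRestrict_apply]
  exact if_neg h

/-- If `R x_n` stays away from zero and is close to `j y_n`, where `j` is an embedding of `ℓ_p`,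
then `R` is bounded below on the span of approximate blocks of the sequence `x_n`. -/
theorem exists_blockOperator_bounded_below (hp : p ≠ ∞) (R j : Ell 𝕜 p →L[𝕜] F) {c : ℝ}
    (hc : 0 < c) (hj : ∀ y, c * ‖y‖ ≤ ‖j y‖) {x y : ℕ → Ell 𝕜 p}
    (hx : ∀ i, Tendsto (fun n => x n i) atTop (𝓝 0))
    (hy : ∀ i, Tendsto (fun n => y n i) atTop (𝓝 0))
    (hR : Tendsto (fun n => ‖R (x n) - j (y n)‖) atTop (𝓝 0)) {B B' D : ℝ}
    (hB : ∀ n, ‖x n‖ ≤ B) (hB' : ∀ n, ‖y n‖ ≤ B') (hD : 0 < D) (hRx : ∀ n, D ≤ ‖R (x n)‖) :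
    ∃ J : Ell 𝕜 p →L[𝕜] Ell 𝕜 p, (∀ a, ‖J a‖ ≤ B * ‖a‖) ∧
      ∀ a, c * D / (2 * (‖j‖ + 1)) * ‖a‖ ≤ ‖R (J a)‖ := by
  set M : ℝ := ‖R‖ + ‖j‖ + 1 with hM
  have hM0 : 0 < M := by positivity
  have hj0 : 0 < ‖j‖ + 1 := by positivity
  -- The first bound keeps the blocks of `y` away from zero; the second keeps the total error
  -- between `R ∘ J` and `j ∘ V` below a third of the lower bound of `j ∘ V`.
  obtain ⟨η, hη, hη1, hη2⟩ : ∃ η : ℝ, 0 < η ∧ 2 * M * η ≤ D / 4 ∧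
      2 * M * η ≤ c * D / (4 * (‖j‖ + 1)) := by
    refine ⟨min (D / 4) (c * D / (4 * (‖j‖ + 1))) / (2 * M), by positivity, ?_, ?_⟩
    · rw [mul_div_cancel₀ _ (by positivity)]; exact min_le_left _ _
    · rw [mul_div_cancel₀ _ (by positivity)]; exact min_le_right _ _
  have hε : ∀ k : ℕ, 0 < η * (1 / 2) ^ k := fun k => by positivity
  have hε1 : ∀ k : ℕ, η * (1 / 2) ^ k ≤ η := fun k =>
    mul_le_of_le_one_right hη.le (pow_le_one₀ (by norm_num) (by norm_num))
  obtain ⟨κ, n, h⟩ := exists_blocks hp hx hy hε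
    (P := fun k n => ‖R (x n) - j (y n)‖ ≤ η * (1 / 2) ^ k)
    (fun k => hR.eventually (ge_mem_nhds (hε k)))
  set u : ℕ → Ell 𝕜 p := fun k => lpRestrict {j | κ j = k} (x (n k)) with hu
  set v : ℕ → Ell 𝕜 p := fun k => lpRestrict {j | κ j = k} (y (n k)) with hv
  have hu0 : ∀ k j, κ j ≠ k → u k j = 0 := lpRestrict_fiber (fun k => x (n k))
  have hv0 : ∀ k j, κ j ≠ k → v k j = 0 := lpRestrict_fiber (fun k => y (n k))
  obtain ⟨J, hJ, hJB, -⟩ := exists_blockOperator hp hu0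
    fun k => (norm_lpRestrict_le _ _).trans (hB (n k))
  obtain ⟨V, hV, -, hVA⟩ := exists_blockOperator hp hv0
    fun k => (norm_lpRestrict_le _ _).trans (hB' (n k))
  have h1 : ∀ k, ‖R (x (n k)) - R (u k)‖ ≤ ‖R‖ * (η * (1 / 2) ^ k) := fun k => by
    rw [← map_sub]
    exact (R.le_opNorm _).trans (by gcongr; exact (h k).2.1)
  have h2 : ∀ k, ‖j (y (n k)) - j (v k)‖ ≤ ‖j‖ * (η * (1 / 2) ^ k) := fun k => by
    rw [← map_sub]
    exact (j.le_opNorm _).trans (by gcongr; exact (h k).2.2)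
  have h3 : ∀ k, ‖R (u k) - j (v k)‖ ≤ M * η * (1 / 2) ^ k := fun k => by
    have e : R (u k) - j (v k) = (R (x (n k)) - j (y (n k))) - (R (x (n k)) - R (u k)) +
        (j (y (n k)) - j (v k)) := by abel
    rw [e]
    refine (norm_add_le _ _).trans ?_
    have := norm_sub_le (R (x (n k)) - j (y (n k))) (R (x (n k)) - R (u k))
    nlinarith [h1 k, h2 k, (h k).1]
  -- The left side is `3D / (4 (‖j‖ + 1))`, split into the part that survives in the conclusion and
  -- the part spent on the perturbation.
  have h4 : ∀ k, D / (2 * (‖j‖ + 1)) * 1 + D / (4 * (‖j‖ + 1)) ≤ ‖v k‖ := fun k => by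
    have e1 := hRx (n k)
    have e2 : ‖R (x (n k))‖ ≤ ‖R (x (n k)) - j (y (n k))‖ + ‖j (y (n k)) - j (v k)‖ +
        ‖j (v k)‖ := by
      have : R (x (n k)) = (R (x (n k)) - j (y (n k))) + (j (y (n k)) - j (v k)) + j (v k) := by
        abel
      conv_lhs => rw [this]
      exact norm_add₃_le
    have e3 : ‖j (v k)‖ ≤ (‖j‖ + 1) * ‖v k‖ := (j.le_opNorm _).trans (by gcongr; linarith)
    have e4 := (h k).1
    have e5 : (1 + ‖j‖) * (η * (1 / 2) ^ k) ≤ M * η := by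
      gcongr
      · linarith [norm_nonneg R]
      · exact hε1 k
    have e6 : 3 / 4 * D ≤ (‖j‖ + 1) * ‖v k‖ := by nlinarith [h2 k]
    have e7 : D / (2 * (‖j‖ + 1)) * 1 + D / (4 * (‖j‖ + 1)) = 3 / 4 * D / (‖j‖ + 1) := by
      field_simp; ring
    rw [e7, div_le_iff₀ hj0]
    linarith
  refine ⟨J, hJB, fun a => ?_⟩
  have h5 := hVA _ (by positivity) h4 a
  have h6 : ‖(R.comp J - j.comp V) a‖ ≤ 2 * (M * η) * ‖a‖ :=
    norm_le_of_norm_single_le hp _ (fun k => by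
      have := h3 k
      rwa [← blockOperator_single hu0 hJ k, ← blockOperator_single hv0 hV k] at this) a
  have h7 : ‖j (V a)‖ ≤ ‖(R.comp J - j.comp V) a‖ + ‖R (J a)‖ := by
    have : j (V a) = R (J a) - (R.comp J - j.comp V) a := by
      simp
    rw [this, add_comm]
    exact norm_sub_le _ _
  have h8 := hj (V a)
  have h9 : c * ((D / (2 * (‖j‖ + 1)) * 1 + D / (4 * (‖j‖ + 1))) * ‖a‖) ≤ ‖j (V a)‖ :=
    (mul_le_mul_of_nonneg_left h5 hc.le).trans h8
  have h10 : c * ((D / (2 * (‖j‖ + 1)) * 1 + D / (4 * (‖j‖ + 1))) * ‖a‖) =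
      c * D / (2 * (‖j‖ + 1)) * ‖a‖ + c * D / (4 * (‖j‖ + 1)) * ‖a‖ := by ring
  have h11 : 2 * (M * η) * ‖a‖ ≤ c * D / (4 * (‖j‖ + 1)) * ‖a‖ := by
    gcongr
    linarith
  linarith

/-- For `p > 1`, a bounded sequence whose `m`-th term vanishes before `m` is weakly null. -/
theorem tendsto_of_apply_eq_zero (hp : p ≠ ∞) (h1 : 1 < p) {x : ℕ → Ell 𝕜 p} {B : ℝ}
    (hB : ∀ n, ‖x n‖ ≤ B) (hx : ∀ n j, j < n → x n j = 0) (f : Ell 𝕜 p →L[𝕜] 𝕜) :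
    Tendsto (fun n => f (x n)) atTop (𝓝 0) := by
  by_contra hcon
  have hB0 : 0 ≤ B := (norm_nonneg _).trans (hB 0)
  obtain ⟨δ, hδ, hfr⟩ : ∃ δ > 0, ∃ᶠ n in atTop, δ ≤ ‖f (x n)‖ := by
    rw [Metric.tendsto_nhds] at hcon
    push Not at hcon
    obtain ⟨δ, hδ, h⟩ := hcon
    exact ⟨δ, hδ, h.mono fun n hn => by simpa using hn⟩
  obtain ⟨φ, hφ, hle⟩ := extraction_of_frequently_atTop hfr
  -- The rescaling makes all values of `f` equal to `δ`, so that they add up without cancellation;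
  -- the factors have modulus at most one, so the bound `B` persists.
  let y : ℕ → Ell 𝕜 p := fun n => (δ / f (x (φ n)) : 𝕜) • x (φ n)
  have hf0 : ∀ n, f (x (φ n)) ≠ 0 := fun n h => by
    have := hle n
    rw [h, norm_zero] at this
    linarith
  have hfy : ∀ n, f (y n) = (δ : 𝕜) := fun n => by
    simp only [y, map_smul, smul_eq_mul]
    exact div_mul_cancel₀ _ (hf0 n)
  have hyB : ∀ n, ‖y n‖ ≤ B := fun n => by
    simp only [y, norm_smul, norm_div, RCLike.norm_ofReal, abs_of_pos hδ]
    calc δ / ‖f (x (φ n))‖ * ‖x (φ n)‖ ≤ 1 * B := by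
          gcongr
          · exact (div_le_one (norm_pos_iff.2 (hf0 n))).2 (hle n)
          · exact hB _
      _ = B := one_mul B
  have hy0 : ∀ j, Tendsto (fun n => y n j) atTop (𝓝 0) := fun j => by
    refine tendsto_const_nhds.congr' ?_
    filter_upwards [eventually_gt_atTop j] with n hn
    have : x (φ n) j = 0 := hx _ _ (hn.trans_le (hφ.id_le n))
    simp [y, this]
  have hε : 0 < δ / (2 * (‖f‖ + 1)) := by positivity
  obtain ⟨κ, n, h⟩ := exists_blocks hp hy0 hy0 (ε := fun _ => δ / (2 * (‖f‖ + 1)))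
    (fun _ => hε) (P := fun _ _ => True) (fun _ => Eventually.of_forall fun _ => trivial)
  set u : ℕ → Ell 𝕜 p := fun k => lpRestrict {j | κ j = k} (y (n k)) with hu
  have hu0 : ∀ k j, κ j ≠ k → u k j = 0 := lpRestrict_fiber (fun k => y (n k))
  obtain ⟨J, hJ, hJB, -⟩ := exists_blockOperator hp hu0
    fun k => (norm_lpRestrict_le _ _).trans (hyB (n k))
  have hre : ∀ k, δ / 2 ≤ RCLike.re (f (u k)) := fun k => by
    have e1 : ‖f (y (n k)) - f (u k)‖ ≤ δ / 2 := by
      rw [← map_sub]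
      refine (f.le_opNorm _).trans ((mul_le_mul_of_nonneg_left (h k).2.1 (norm_nonneg _)).trans ?_)
      rw [mul_div_assoc', div_le_div_iff₀ (by positivity) (by positivity)]
      nlinarith [norm_nonneg f]
    rw [hfy] at e1
    have e2 := (RCLike.re_le_norm _).trans e1
    rw [map_sub, RCLike.ofReal_re] at e2
    linarith
  have hp0 := toReal_pos_of_ne_top hp
  -- The sum of `N` disjoint blocks has norm of order `N^(1/p)`, while `f` takes there a value of
  -- order `N`. This is impossible for large `N` because `p > 1`.
  have hbound : ∀ N : ℕ, N * (δ / 2) ≤ ‖f‖ * B * (N : ℝ) ^ (1 / p.toReal) := fun N => by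
    set a : Ell 𝕜 p := ∑ k ∈ Finset.range N, lp.single p k (1 : 𝕜) with ha
    have hna : ‖a‖ = (N : ℝ) ^ (1 / p.toReal) := by
      have := lp.norm_sum_single hp0 (fun _ : ℕ => (1 : 𝕜)) (Finset.range N)
      rw [← ha] at this
      simp only [norm_one, Real.one_rpow, Finset.sum_const, Finset.card_range, nsmul_eq_mul,
        mul_one] at this
      rw [← this, ← Real.rpow_mul (norm_nonneg _), mul_one_div_cancel hp0.ne', Real.rpow_one]
    have hJa : J a = ∑ k ∈ Finset.range N, u k := by
      rw [ha, map_sum]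
      exact Finset.sum_congr rfl fun k _ => blockOperator_single hu0 hJ k
    calc (N : ℝ) * (δ / 2) = ∑ k ∈ Finset.range N, δ / 2 := by simp
      _ ≤ ∑ k ∈ Finset.range N, RCLike.re (f (u k)) := Finset.sum_le_sum fun k _ => hre k
      _ = RCLike.re (f (J a)) := by rw [hJa, map_sum, map_sum]
      _ ≤ ‖f (J a)‖ := RCLike.re_le_norm _
      _ ≤ ‖f‖ * (B * ‖a‖) := (f.le_opNorm _).trans (by gcongr; exact hJB a)
      _ = _ := by rw [hna]; ring
  have hpr : 1 < p.toReal := by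
    rw [← ENNReal.toReal_one]
    exact (ENNReal.toReal_lt_toReal ENNReal.one_ne_top hp).2 h1
  have htend : Tendsto (fun N : ℕ => (N : ℝ) ^ (1 - 1 / p.toReal)) atTop atTop :=
    (tendsto_rpow_atTop (by rw [sub_pos, div_lt_one hp0]; exact hpr)).comp
      tendsto_natCast_atTop_atTop
  obtain ⟨N, hN, hN0⟩ := ((htend.eventually_gt_atTop (‖f‖ * B / (δ / 2))).and
    (eventually_gt_atTop 0)).exists
  have hNr : (0 : ℝ) < N := Nat.cast_pos.2 hN0
  rw [div_lt_iff₀ (by positivity), Real.rpow_sub hNr, Real.rpow_one, div_mul_eq_mul_div,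
    lt_div_iff₀ (by positivity)] at hN
  exact (hbound N).not_gt hN

end SequenceSpaces

/-! ### A criterion for closed range in terms of a seminorm. -/

section ClosedRange

variable {𝕜 V A : Type*} [RCLike 𝕜] [NormedAddCommGroup V] [NormedSpace 𝕜 V] [CompleteSpace V]
  [NormedAddCommGroup A] [NormedSpace 𝕜 A]

/-- A point of the closure of the range is a series of points of the range with rapidly decreasing
norms; their controlled preimages are summable in the complete space `V`. Completeness of `A` plays
no role. -/
theorem isClosed_range_of_exists_preimage (φ : V →L[𝕜] A) {K : ℝ}
    (h : ∀ v, ∃ v', φ v' = φ v ∧ ‖v'‖ ≤ K * ‖φ v‖) : IsClosed (Set.range φ) := by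
  let f : NormedAddGroupHom V A :=
    ⟨φ, map_add φ, ⟨‖φ‖, φ.le_opNorm⟩⟩
  let R : AddSubgroup A := (φ : V →+ A).range
  have hyp : f.SurjectiveOnWith R (|K| + 1) := by
    rintro _ ⟨v, rfl⟩
    obtain ⟨v', h1, h2⟩ := h v
    exact ⟨v', h1, h2.trans (mul_le_mul_of_nonneg_right (by linarith [le_abs_self K])
      (norm_nonneg _))⟩
  have h2 := controlled_closure_of_complete (by positivity) one_pos hyp
  refine isClosed_of_closure_subset fun a ha => ?_
  obtain ⟨v, hv, -⟩ := h2 a ha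
  exact ⟨v, hv⟩

/-- This is the open mapping theorem for `φ` as a map onto its range, which is a Banach space. -/
theorem exists_preimage_of_isClosed_range [CompleteSpace A] (φ : V →L[𝕜] A)
    (h : IsClosed (Set.range φ)) : ∃ K, ∀ v, ∃ v', φ v' = φ v ∧ ‖v'‖ ≤ K * ‖φ v‖ := by
  have : CompleteSpace φ.range := by
    have h' : IsClosed (φ.range : Set A) := h
    exact h'.completeSpace_coe
  obtain ⟨C, -, hC⟩ := φ.rangeRestrict.exists_preimage_norm_le (by
    rintro ⟨_, v, rfl⟩
    exact ⟨v, rfl⟩)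
  refine ⟨C, fun v => ?_⟩
  obtain ⟨v', h1, h2⟩ := hC (φ.rangeRestrict v)
  exact ⟨v', congrArg Subtype.val h1, h2⟩

/-- Whether the range of an operator is closed depends only on the equivalence class of the
seminorm `v ↦ ‖φ v‖`. -/
theorem isClosed_range_iff_of_seminorm [CompleteSpace A] (φ : V →L[𝕜] A) (N : V → ℝ)
    {a b : ℝ} (h1 : ∀ v, ‖φ v‖ ≤ a * N v) (h2 : ∀ v, N v ≤ b * ‖φ v‖) (h0 : ∀ v, 0 ≤ N v) :
    IsClosed (Set.range φ) ↔ ∃ K, ∀ v, ∃ v', N (v' - v) = 0 ∧ ‖v'‖ ≤ K * N v := by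
  have hzero : ∀ v, N v = 0 ↔ φ v = 0 := fun v => by
    refine ⟨fun h => ?_, fun h => le_antisymm ?_ (h0 v)⟩
    · have := h1 v
      rw [h, mul_zero] at this
      exact norm_le_zero_iff.1 this
    · simpa [h] using h2 v
  refine ⟨fun h => ?_, fun ⟨K, hK⟩ => ?_⟩
  · obtain ⟨K, hK⟩ := exists_preimage_of_isClosed_range φ h
    refine ⟨|K| * a, fun v => ?_⟩
    obtain ⟨v', e1, e2⟩ := hK v
    refine ⟨v', (hzero _).2 (by rw [map_sub, e1, sub_self]), e2.trans ?_⟩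
    calc K * ‖φ v‖ ≤ |K| * ‖φ v‖ := by gcongr; exact le_abs_self K
      _ ≤ |K| * (a * N v) := by gcongr; exact h1 v
      _ = _ := by ring
  · refine isClosed_range_of_exists_preimage φ (K := |K| * b) fun v => ?_
    obtain ⟨v', e1, e2⟩ := hK v
    refine ⟨v', ?_, e2.trans ?_⟩
    · have := (hzero _).1 e1
      rwa [map_sub, sub_eq_zero] at this
    calc K * N v ≤ |K| * N v := mul_le_mul_of_nonneg_right (le_abs_self K) (h0 v)
      _ ≤ |K| * (b * ‖φ v‖) := by gcongr; exact h2 v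
      _ = _ := by ring

end ClosedRange

/-! ### The space `W_p` of classes of weakly null sequences. -/

section WeakUltrapower

variable {𝕜 E F : Type*} [RCLike 𝕜] [NormedAddCommGroup E] [NormedSpace 𝕜 E]
  [NormedAddCommGroup F] [NormedSpace 𝕜 F] (U : Ultrafilter ℕ)

theorem BddSeq.norm_apply_le (x : BddSeq E) (n : ℕ) : ‖x n‖ ≤ ‖x‖ :=
  lp.norm_apply_le_norm ENNReal.top_ne_zero x n

theorem isClosed_weaklyNull : IsClosed (weaklyNull 𝕜 E : Set (BddSeq E)) := by
  refine isClosed_of_closure_subset fun x hx f => ?_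
  rw [Metric.tendsto_nhds]
  intro ε hε
  obtain ⟨y, hy, hxy⟩ := Metric.mem_closure_iff.1 hx (ε / (2 * (‖f‖ + 1))) (by positivity)
  filter_upwards [(Metric.tendsto_nhds.1 (hy f)) (ε / 2) (by positivity)] with n hn
  have h1 : ‖x n - y n‖ ≤ ‖x - y‖ := BddSeq.norm_apply_le (x - y) n
  have h2 : ‖f (x n)‖ ≤ ‖f (x n - y n)‖ + ‖f (y n)‖ := by
    simpa using norm_add_le (f (x n - y n)) (f (y n))
  have h3 : ‖f (x n - y n)‖ ≤ ε / 2 := by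
    rw [dist_eq_norm, lt_div_iff₀ (by positivity)] at hxy
    have := f.le_opNorm (x n - y n)
    nlinarith [norm_nonneg f, norm_nonneg (x n - y n)]
  simp only [dist_zero_right] at hn ⊢
  linarith

/-- The class of a weakly null sequence is the class of a weakly null sequence of almost the same
norm. -/
theorem exists_weaklyNull_norm_le {x : BddSeq E} (hx : x ∈ weaklyNull 𝕜 E) {C : ℝ}
    (hC : ‖(Submodule.Quotient.mk x : Ultrapower 𝕜 E U)‖ < C) :
    ∃ y ∈ weaklyNull 𝕜 E, (Submodule.Quotient.mk y : Ultrapower 𝕜 E U) = Submodule.Quotient.mk x ∧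
      ∀ n, ‖y n‖ ≤ C := by
  classical
  have hC0 : 0 ≤ C := (norm_nonneg _).trans hC.le
  -- Zeroing the terms of norm above `C` preserves weak nullity, and along `U` it changes nothing
  -- because the norms there converge to a value below `C`.
  let y : BddSeq E := ⟨fun n => if ‖x n‖ ≤ C then x n else 0, memℓp_infty ⟨C, by
    rintro _ ⟨n, rfl⟩
    dsimp only
    split_ifs with h
    · exact h
    · simpa using hC0⟩⟩
  have hy : ∀ n, y n = if ‖x n‖ ≤ C then x n else 0 := fun n => rfl
  refine ⟨y, fun f => ?_, ?_, fun n => ?_⟩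
  · refine squeeze_zero_norm (fun n => ?_) (tendsto_zero_iff_norm_tendsto_zero.1 (hx f))
    rw [hy]
    split_ifs <;> simp
  · rw [Submodule.Quotient.eq]
    refine tendsto_const_nhds.congr' ?_
    filter_upwards [(ultrapower_tendsto_norm (𝕜 := 𝕜) U x).eventually (gt_mem_nhds hC)] with n hn
    have : (y - x) n = y n - x n := rfl
    rw [this, hy, if_pos (le_of_lt hn), sub_self, norm_zero]
  · rw [hy]
    split_ifs with h
    · exact h
    · simpa using hC0

theorem mul_norm_le_norm_ultraMap {T : E →L[𝕜] F} {c : ℝ} (h : ∀ x, c * ‖x‖ ≤ ‖T x‖)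
    (ξ : Ultrapower 𝕜 E U) : c * ‖ξ‖ ≤ ‖ultraMap U T ξ‖ := by
  obtain ⟨x, rfl⟩ := Submodule.Quotient.mk_surjective _ ξ
  rw [ultraMap_mk]
  exact le_of_tendsto_of_tendsto' ((ultrapower_tendsto_norm (𝕜 := 𝕜) U x).const_mul c)
    (ultrapower_tendsto_norm (𝕜 := 𝕜) U (seqMap T x)) fun n => h (x n)

theorem mk_eq_mk_of_tendsto (hU : (U : Filter ℕ) ≤ cofinite) {x y : BddSeq E}
    (h : Tendsto (fun n => ‖x n - y n‖) atTop (𝓝 0)) :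
    (Submodule.Quotient.mk x : Ultrapower 𝕜 E U) = Submodule.Quotient.mk y := by
  rw [Submodule.Quotient.eq]
  exact h.mono_left (hU.trans Nat.cofinite_eq_atTop.le)

variable (𝕜) in
/-- The space `W_p` as a normed space in its own right. -/
def WeakUltrapower (p : ℝ≥0∞) [Fact (1 ≤ p)] (U : Ultrafilter ℕ) : Type _ := weakUltra 𝕜 p U

noncomputable instance {p : ℝ≥0∞} [Fact (1 ≤ p)] : NormedAddCommGroup (WeakUltrapower 𝕜 p U) :=
  inferInstanceAs (NormedAddCommGroup (weakUltra 𝕜 p U))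

noncomputable instance {p : ℝ≥0∞} [Fact (1 ≤ p)] : NormedSpace 𝕜 (WeakUltrapower 𝕜 p U) :=
  inferInstanceAs (NormedSpace 𝕜 (weakUltra 𝕜 p U))

variable {U} in
/-- The inclusion of `W_p` in the ultrapower of `ℓ_p`. -/
noncomputable def WeakUltrapower.val {p : ℝ≥0∞} [Fact (1 ≤ p)] :
    WeakUltrapower 𝕜 p U →ₗ[𝕜] Ultrapower 𝕜 (Ell 𝕜 p) U := (weakUltra 𝕜 p U).subtype

theorem WeakUltrapower.norm_val {p : ℝ≥0∞} [Fact (1 ≤ p)] (ξ : WeakUltrapower 𝕜 p U) :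
    ‖ξ.val‖ = ‖ξ‖ := rfl

theorem WeakUltrapower.val_injective {p : ℝ≥0∞} [Fact (1 ≤ p)] :
    Function.Injective (WeakUltrapower.val : WeakUltrapower 𝕜 p U →ₗ[𝕜] _) :=
  Subtype.val_injective

/-- The class in `W_p` of a weakly null sequence. -/
noncomputable def WeakUltrapower.mk {p : ℝ≥0∞} [Fact (1 ≤ p)] (x : BddSeq (Ell 𝕜 p))
    (hx : x ∈ weaklyNull 𝕜 (Ell 𝕜 p)) : WeakUltrapower 𝕜 p U :=
  ⟨Submodule.Quotient.mk x, x, hx, rfl⟩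

theorem WeakUltrapower.val_mk {p : ℝ≥0∞} [Fact (1 ≤ p)] (x : BddSeq (Ell 𝕜 p))
    (hx : x ∈ weaklyNull 𝕜 (Ell 𝕜 p)) :
    (WeakUltrapower.mk U x hx).val = Submodule.Quotient.mk x := rfl

theorem WeakUltrapower.exists_mk {p : ℝ≥0∞} [Fact (1 ≤ p)] (ξ : WeakUltrapower 𝕜 p U) :
    ∃ x hx, WeakUltrapower.mk U x hx = ξ := by
  obtain ⟨_, x, hx, rfl⟩ := ξ
  exact ⟨x, hx, rfl⟩

/-- `W_p` is the image of the Banach space of weakly null sequences, and truncation gives preimages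
of at most twice the norm, so the image is closed in the ultrapower. -/
instance {p : ℝ≥0∞} [Fact (1 ≤ p)] : CompleteSpace (WeakUltrapower 𝕜 p U) := by
  have hcomp : CompleteSpace (weaklyNull 𝕜 (Ell 𝕜 p)) := isClosed_weaklyNull.completeSpace_coe
  let q : BddSeq (Ell 𝕜 p) →L[𝕜] Ultrapower 𝕜 (Ell 𝕜 p) U :=
    LinearMap.mkContinuous (ultraNull 𝕜 (Ell 𝕜 p) U).mkQ 1 fun x => by
      rw [one_mul]; exact Submodule.Quotient.norm_mk_le _ x
  let φ : weaklyNull 𝕜 (Ell 𝕜 p) →L[𝕜] Ultrapower 𝕜 (Ell 𝕜 p) U :=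
    q.comp (weaklyNull 𝕜 (Ell 𝕜 p)).subtypeL
  have hφ : IsClosed (Set.range φ) := by
    refine isClosed_range_of_exists_preimage φ (K := 2) fun v => ?_
    rcases eq_or_ne (φ v) 0 with h0 | h0
    · exact ⟨0, by rw [h0, map_zero], by simp⟩
    · have hpos := norm_pos_iff.2 h0
      obtain ⟨y, hy, hyv, hyC⟩ := exists_weaklyNull_norm_le U v.2
        (show ‖φ v‖ < 2 * ‖φ v‖ by linarith)
      exact ⟨⟨y, hy⟩, hyv, lp.norm_le_of_forall_le (by positivity) hyC⟩
  have : (weakUltra 𝕜 p U : Set (Ultrapower 𝕜 (Ell 𝕜 p) U)) = Set.range φ := by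
    ext ξ
    refine ⟨?_, ?_⟩
    · rintro ⟨x, hx, rfl⟩
      exact ⟨⟨x, hx⟩, rfl⟩
    · rintro ⟨x, rfl⟩
      exact ⟨x, x.2, rfl⟩
  have hcl : IsClosed (weakUltra 𝕜 p U : Set (Ultrapower 𝕜 (Ell 𝕜 p) U)) := this ▸ hφ
  have h2 : CompleteSpace (weakUltra 𝕜 p U) := hcl.completeSpace_coe
  exact h2

end WeakUltrapower

/-! ### Infinite-dimensional subspaces. -/

section InfiniteDimensional

variable {𝕜 : Type*} [RCLike 𝕜] {p : ℝ≥0∞} [Fact (1 ≤ p)]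
  {Y : Type*} [NormedAddCommGroup Y] [NormedSpace 𝕜 Y]

theorem not_finiteDimensional_ell {p : ℝ≥0∞} : ¬ FiniteDimensional 𝕜 (Ell 𝕜 p) := by
  intro h
  have hli : LinearIndependent 𝕜 fun k : ℕ => (lp.single p k (1 : 𝕜) : Ell 𝕜 p) := by
    rw [linearIndependent_iff']
    intro s g hg i hi
    have := congrFun (congrArg (fun z : Ell 𝕜 p => (z : ℕ → 𝕜)) hg) i
    simp only [lp.coeFn_sum, Finset.sum_apply, lp.coeFn_smul, Pi.smul_apply, lp.coeFn_single,
      Pi.single_apply, lp.coeFn_zero, Pi.zero_apply] at this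
    simpa [hi] using this
  have := hli.finite
  exact not_finite ℕ

theorem isInfSubspace_range {A : Ell 𝕜 p →L[𝕜] Y} {d : ℝ} (hd : 0 < d)
    (hA : ∀ a, d * ‖a‖ ≤ ‖A a‖) : IsInfSubspace A.range := by
  have hanti : AntilipschitzWith (Real.toNNReal d⁻¹) A := by
    refine A.antilipschitz_of_bound fun a => ?_
    rw [Real.coe_toNNReal _ (by positivity), inv_mul_eq_div, le_div_iff₀ hd, mul_comm]
    exact hA a
  refine ⟨?_, fun hfin => not_finiteDimensional_ell (𝕜 := 𝕜) (p := p) ?_⟩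
  · exact hanti.isClosed_range A.uniformContinuous
  · exact FiniteDimensional.of_injective ((A : Ell 𝕜 p →ₗ[𝕜] Y).rangeRestrict) fun a b hab =>
      hanti.injective (congrArg Subtype.val hab)

/-- Finitely many functionals cut out a subspace of finite codimension. With coordinate functionals,
this provides the vectors with vanishing initial coordinates. -/
theorem IsInfSubspace.exists_forall_eq_zero {W : Submodule 𝕜 Y} (hW : IsInfSubspace W)
    (g : ℕ → Y →L[𝕜] 𝕜) (m : ℕ) :
    ∃ Z : Submodule 𝕜 Y, IsInfSubspace Z ∧ Z ≤ W ∧ ∀ z ∈ Z, ∀ j < m, g j z = 0 := by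
  induction m with
  | zero => exact ⟨W, hW, le_rfl, fun _ _ j hj => absurd hj (Nat.not_lt_zero j)⟩
  | succ m ih =>
    obtain ⟨Z, hZ, hZW, hg⟩ := ih
    refine ⟨Z ⊓ (g m).ker, hZ.inf_ker _, inf_le_left.trans hZW, fun z hz j hj => ?_⟩
    rcases Nat.lt_succ_iff_lt_or_eq.1 hj with h | rfl
    · exact hg z hz.1 j h
    · exact hz.2

theorem IsInfSubspace.exists_ne_zero {W : Submodule 𝕜 Y} (hW : IsInfSubspace W) :
    ∃ w ∈ W, w ≠ 0 := by
  refine Submodule.exists_mem_ne_zero_of_ne_bot ?_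
  rintro rfl
  exact hW.2 inferInstance

end InfiniteDimensional

theorem tendsto_apply_of_mem_weaklyNull {𝕜 : Type*} [RCLike 𝕜] {p : ℝ≥0∞} [Fact (1 ≤ p)]
    {x : BddSeq (Ell 𝕜 p)} (hx : x ∈ weaklyNull 𝕜 (Ell 𝕜 p)) (j : ℕ) :
    Tendsto (fun n => x n j) atTop (𝓝 0) :=
  hx (lp.evalCLM 𝕜 (fun _ : ℕ => 𝕜) p j)

/-- A subsequence of a bounded sequence. -/
noncomputable def BddSeq.subseq {E : Type*} [NormedAddCommGroup E] (x : BddSeq E) (φ : ℕ → ℕ) :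
    BddSeq E :=
  ⟨fun n => x (φ n), memℓp_infty ⟨‖x‖, by
    rintro _ ⟨n, rfl⟩
    exact x.norm_apply_le (φ n)⟩⟩

theorem BddSeq.subseq_mem_weaklyNull {𝕜 E : Type*} [RCLike 𝕜] [NormedAddCommGroup E]
    [NormedSpace 𝕜 E] {x : BddSeq E} (hx : x ∈ weaklyNull 𝕜 E) {φ : ℕ → ℕ} (hφ : StrictMono φ) :
    x.subseq φ ∈ weaklyNull 𝕜 E := fun f => (hx f).comp hφ.tendsto_atTop

/-! ### Operators on a singular self-extension and the map `β`. -/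

namespace SelfExtension

variable {𝕜 : Type*} [RCLike 𝕜] {p : ℝ≥0∞} [hp1 : Fact (1 ≤ p)]
  {Y : Type*} [NormedAddCommGroup Y] [NormedSpace 𝕜 Y] {E : SelfExtension 𝕜 p Y}
  {U : Ultrafilter ℕ}

/-- Otherwise the operator `π T i` on `ℓ_p` stays away from zero on a weakly null subsequence, hence
is bounded below after composition with some block operator `J`. Then `π` is bounded below on the
range of `T i J`, which is closed and infinite-dimensional, contrary to strict singularity. -/
theorem tendsto_proj (hE : E.IsSingular) (hp : p ≠ ∞) (T : Y →L[𝕜] Y) {x : BddSeq (Ell 𝕜 p)}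
    (hx : x ∈ weaklyNull 𝕜 (Ell 𝕜 p)) :
    Tendsto (fun n => ‖E.proj (T (E.incl (x n)))‖) atTop (𝓝 0) := by
  by_contra hcon
  obtain ⟨δ, hδ, hfr⟩ : ∃ δ > 0, ∃ᶠ n in atTop, δ ≤ ‖E.proj (T (E.incl (x n)))‖ := by
    rw [Metric.tendsto_nhds] at hcon
    push Not at hcon
    obtain ⟨δ, hδ, h⟩ := hcon
    exact ⟨δ, hδ, h.mono fun n hn => by simpa using hn⟩
  obtain ⟨φ, hφ, hle⟩ := extraction_of_frequently_atTop hfr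
  let R : Ell 𝕜 p →L[𝕜] Ell 𝕜 p := E.proj.comp (T.comp E.incl)
  have hy : seqMap R (x.subseq φ) ∈ weaklyNull 𝕜 (Ell 𝕜 p) := fun f =>
    (BddSeq.subseq_mem_weaklyNull hx hφ) (f.comp R)
  obtain ⟨J, -, hJ⟩ := exists_blockOperator_bounded_below hp R (ContinuousLinearMap.id 𝕜 _)
    one_pos (fun y => by simp)
    (tendsto_apply_of_mem_weaklyNull (BddSeq.subseq_mem_weaklyNull hx hφ))
    (tendsto_apply_of_mem_weaklyNull hy) (by simp [seqMap_apply])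
    (x.subseq φ).norm_apply_le (seqMap R (x.subseq φ)).norm_apply_le hδ hle
  set d := 1 * δ / (2 * (‖ContinuousLinearMap.id 𝕜 (Ell 𝕜 p)‖ + 1)) with hd
  have hd0 : 0 < d := by positivity
  set A : Ell 𝕜 p →L[𝕜] Y := T.comp (E.incl.comp J) with hA
  have h1 : ∀ a, d * ‖a‖ ≤ ‖E.proj (A a)‖ := hJ
  have h2 : ∀ a, d / (‖E.proj‖ + 1) * ‖a‖ ≤ ‖A a‖ := fun a => by
    rw [div_mul_eq_mul_div, div_le_iff₀ (by positivity)]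
    have := (h1 a).trans (E.proj.le_opNorm _)
    nlinarith [norm_nonneg (A a)]
  refine hE _ (isInfSubspace_range (by positivity) h2) ⟨d / (‖A‖ + 1), by positivity, ?_⟩
  rintro _ ⟨a, rfl⟩
  rw [div_mul_eq_mul_div, div_le_iff₀ (by positivity)]
  have e1 := A.le_opNorm a
  have e2 := h1 a
  change d * ‖A a‖ ≤ ‖E.proj (A a)‖ * _
  nlinarith [norm_nonneg a, norm_nonneg A]

theorem IsBeta.apply {T : Y →L[𝕜] Y} {B : WeakUltrapower 𝕜 p U →L[𝕜] WeakUltrapower 𝕜 p U}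
    (hB : E.IsBeta U T B) (ξ : WeakUltrapower 𝕜 p U) :
    ultraMap U E.incl (B ξ).val = ultraMap U T (ultraMap U E.incl ξ.val) := hB ξ

theorem IsBeta.of_forall {T : Y →L[𝕜] Y} {B : WeakUltrapower 𝕜 p U →L[𝕜] WeakUltrapower 𝕜 p U}
    (h : ∀ ξ : WeakUltrapower 𝕜 p U,
      ultraMap U E.incl (B ξ).val = ultraMap U T (ultraMap U E.incl ξ.val)) :
    E.IsBeta U T B := h

theorem norm_ultraMap_ultraMap_le (T : Y →L[𝕜] Y) (ξ : WeakUltrapower 𝕜 p U) :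
    ‖ultraMap U T (ultraMap U E.incl ξ.val)‖ ≤ ‖T‖ * (‖E.incl‖ * ‖ξ‖) :=
  ((ultraMap U T).le_opNorm _).trans (mul_le_mul (norm_ultraMap_le U T)
    (((ultraMap U E.incl).le_opNorm ξ.val).trans
      (mul_le_mul_of_nonneg_right (norm_ultraMap_le U E.incl) (norm_nonneg _)))
    (norm_nonneg _) (norm_nonneg _))

variable (E)

section Complete

variable [CompleteSpace Y]

/-- By exactness the range of the embedding is the kernel of `π`, hence closed, and the open mapping
theorem applies. -/
theorem exists_mul_norm_le_norm_incl : ∃ c > 0, ∀ x, c * ‖x‖ ≤ ‖E.incl x‖ := by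
  have hcl : IsClosed (Set.range E.incl) := by
    have : Set.range E.incl = (E.proj.ker : Set Y) := by
      ext y; exact (E.exact y).symm
    rw [this]
    exact E.proj.isClosed_ker
  obtain ⟨K, hK⟩ := E.incl.antilipschitz_of_injective_of_isClosed_range E.incl_injective hcl
  refine ⟨((K : ℝ) + 1)⁻¹, by positivity, fun x => ?_⟩
  rw [inv_mul_le_iff₀ (by positivity)]
  have := hK.le_mul_dist x 0
  rw [map_zero, dist_zero_right, dist_zero_right] at this
  nlinarith [norm_nonneg (E.incl x)]

/-- Subtracting from `y` a controlled lift of `π y` leaves an element of `ker π`. Thus smallness of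
`π y` means closeness to the copy of `ℓ_p`. -/
theorem exists_norm_sub_incl_le : ∃ K > 0, ∀ y, ∃ x, ‖y - E.incl x‖ ≤ K * ‖E.proj y‖ := by
  obtain ⟨K, hK, h⟩ := E.proj.exists_preimage_norm_le E.proj_surjective
  refine ⟨K, hK, fun y => ?_⟩
  obtain ⟨z, hz, hzK⟩ := h (E.proj y)
  obtain ⟨x, hx⟩ := (E.exact (y - z)).1 (by rw [map_sub, hz, sub_self])
  exact ⟨x, by rwa [hx, sub_sub_cancel]⟩

theorem exists_extend_functional (f : Ell 𝕜 p →L[𝕜] 𝕜) :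
    ∃ g : Y →L[𝕜] 𝕜, ∀ x, g (E.incl x) = f x := by
  obtain ⟨c, hc, hinc⟩ := E.exists_mul_norm_le_norm_incl
  let e := LinearEquiv.ofInjective (E.incl : Ell 𝕜 p →ₗ[𝕜] Y) E.incl_injective
  let h : LinearMap.range (E.incl : Ell 𝕜 p →ₗ[𝕜] Y) →L[𝕜] 𝕜 :=
    LinearMap.mkContinuous ((f : Ell 𝕜 p →ₗ[𝕜] 𝕜).comp e.symm.toLinearMap) (‖f‖ / c) fun y => by
      obtain ⟨x, rfl⟩ := e.surjective y
      have h1 : ((f : Ell 𝕜 p →ₗ[𝕜] 𝕜).comp e.symm.toLinearMap) (e x) = f x := by simp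
      have h2 : ‖e x‖ = ‖E.incl x‖ := rfl
      rw [h1, h2, div_mul_eq_mul_div, le_div_iff₀ hc]
      have := hinc x
      nlinarith [f.le_opNorm x, norm_nonneg f]
  obtain ⟨g, hg, -⟩ := exists_extension_norm_eq _ h
  refine ⟨g, fun x => ?_⟩
  have h1 := hg (e x)
  have h2 : h (e x) = f x := by
    change f (e.symm (e x)) = f x
    rw [e.symm_apply_apply]
  rw [h2] at h1
  exact h1

variable {E}

/-- An operator on a singular self-extension maps weakly null sequences of `ℓ_p` to weakly null
sequences of `ℓ_p`, up to norm null sequences. -/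
theorem exists_weaklyNull_tendsto (hE : E.IsSingular) (hp : p ≠ ∞) (T : Y →L[𝕜] Y)
    {x : BddSeq (Ell 𝕜 p)} (hx : x ∈ weaklyNull 𝕜 (Ell 𝕜 p)) :
    ∃ y ∈ weaklyNull 𝕜 (Ell 𝕜 p),
      Tendsto (fun n => ‖T (E.incl (x n)) - E.incl (y n)‖) atTop (𝓝 0) := by
  obtain ⟨K, hK, h⟩ := E.exists_norm_sub_incl_le
  obtain ⟨c, hc, hinc⟩ := E.exists_mul_norm_le_norm_incl
  choose y hy using fun n => h (T (E.incl (x n)))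
  have hlim : Tendsto (fun n => ‖T (E.incl (x n)) - E.incl (y n)‖) atTop (𝓝 0) :=
    squeeze_zero (fun n => norm_nonneg _) hy (by
      simpa using (tendsto_proj hE hp T hx).const_mul K)
  have hbd : ∀ n, ‖y n‖ ≤ (K * ‖E.proj‖ + 1) * (‖T‖ * (‖E.incl‖ * ‖x‖)) / c := fun n => by
    have h1 : ‖T (E.incl (x n))‖ ≤ ‖T‖ * (‖E.incl‖ * ‖x‖) :=
      (T.le_opNorm _).trans (mul_le_mul_of_nonneg_left ((E.incl.le_opNorm _).trans
        (mul_le_mul_of_nonneg_left (x.norm_apply_le n) (norm_nonneg _))) (norm_nonneg _))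
    have h2 : ‖E.incl (y n)‖ ≤ ‖T (E.incl (x n)) - E.incl (y n)‖ + ‖T (E.incl (x n))‖ := by
      rw [norm_sub_rev]
      simpa using norm_add_le (E.incl (y n) - T (E.incl (x n))) (T (E.incl (x n)))
    have h3 : K * ‖E.proj (T (E.incl (x n)))‖ ≤
        K * ‖E.proj‖ * (‖T‖ * (‖E.incl‖ * ‖x‖)) := by
      rw [mul_assoc]
      gcongr
      exact (E.proj.le_opNorm _).trans (by gcongr)
    rw [le_div_iff₀ hc, mul_comm]
    linarith [hinc (y n), hy n]
  refine ⟨⟨y, memℓp_infty ⟨_, by rintro _ ⟨n, rfl⟩; exact hbd n⟩⟩, fun f => ?_, hlim⟩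
  -- Extended to `g` on `Y`, the functional can be evaluated on `T (i x_n)` and on the norm null
  -- difference `T (i x_n) - i y_n`.
  obtain ⟨g, hg⟩ := E.exists_extend_functional f
  have h1 : Tendsto (fun n => g (T (E.incl (x n)))) atTop (𝓝 0) :=
    hx (g.comp (T.comp E.incl))
  have h2 : Tendsto (fun n => g (T (E.incl (x n)) - E.incl (y n))) atTop (𝓝 0) := by
    have := (g.continuous.tendsto 0).comp (tendsto_zero_iff_norm_tendsto_zero.2 hlim)
    rwa [map_zero] at this
  have h3 := h1.sub h2
  rw [sub_zero] at h3
  refine h3.congr fun n => ?_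
  rw [map_sub, hg]
  exact sub_sub_cancel _ _

theorem ultraMap_incl_injective : Function.Injective (ultraMap U E.incl) := by
  obtain ⟨c, hc, hinc⟩ := E.exists_mul_norm_le_norm_incl
  refine (injective_iff_map_eq_zero _).2 fun ξ h => norm_le_zero_iff.1 ?_
  have := mul_norm_le_norm_ultraMap U hinc ξ
  rw [h, norm_zero] at this
  nlinarith

theorem isBeta_unique {T : Y →L[𝕜] Y} {B B' : WeakUltrapower 𝕜 p U →L[𝕜] WeakUltrapower 𝕜 p U}
    (hB : E.IsBeta U T B) (hB' : E.IsBeta U T B') : B = B' := by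
  ext ξ : 1
  exact WeakUltrapower.val_injective U (ultraMap_incl_injective
    ((IsBeta.apply hB ξ).trans (IsBeta.apply hB' ξ).symm))

theorem exists_isBeta (hU : (U : Filter ℕ) ≤ cofinite) (hE : E.IsSingular) (hp : p ≠ ∞)
    (T : Y →L[𝕜] Y) :
    ∃ B : WeakUltrapower 𝕜 p U →L[𝕜] WeakUltrapower 𝕜 p U, E.IsBeta U T B := by
  obtain ⟨c, hc, hinc⟩ := E.exists_mul_norm_le_norm_incl
  have hex : ∀ ξ : WeakUltrapower 𝕜 p U, ∃ η : WeakUltrapower 𝕜 p U,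
      ultraMap U E.incl η.val = ultraMap U T (ultraMap U E.incl ξ.val) := by
    intro ξ
    obtain ⟨x, hx, rfl⟩ := WeakUltrapower.exists_mk U ξ
    obtain ⟨y, hy, hlim⟩ := exists_weaklyNull_tendsto hE hp T hx
    exact ⟨WeakUltrapower.mk U y hy, (mk_eq_mk_of_tendsto (𝕜 := 𝕜) U hU
      (x := seqMap T (seqMap E.incl x)) (y := seqMap E.incl y) hlim).symm⟩
  choose b hb using hex
  -- The values `b ξ` are determined by their images in `Y_U`, so the arbitrary choice of `b` is
  -- automatically linear.
  have hinj := (ultraMap_incl_injective (U := U) (E := E)).comp (WeakUltrapower.val_injective U)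
  refine ⟨LinearMap.mkContinuous
    { toFun := b
      map_add' := fun ξ η => hinj (by
        simp only [Function.comp_apply, hb, map_add])
      map_smul' := fun a ξ => hinj (by
        simp only [Function.comp_apply, hb, map_smul, RingHom.id_apply]) }
    (‖T‖ * ‖E.incl‖ / c) fun ξ => ?_, hb⟩
  have h1 := mul_norm_le_norm_ultraMap U hinc (b ξ).val
  rw [hb, WeakUltrapower.norm_val] at h1
  rw [div_mul_eq_mul_div, le_div_iff₀ hc, mul_comm, mul_assoc]
  exact h1.trans (norm_ultraMap_ultraMap_le T ξ)

theorem existsUnique_isBeta (hU : (U : Filter ℕ) ≤ cofinite) (hE : E.IsSingular) (hp : p ≠ ∞)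
    (T : Y →L[𝕜] Y) : ∃! B, E.IsBeta U T B := by
  obtain ⟨B, hB⟩ := exists_isBeta hU hE hp T
  exact ⟨B, hB, fun B' hB' => isBeta_unique hB' hB⟩

/-- The operator `β`. -/
theorem exists_betaMap (hU : (U : Filter ℕ) ≤ cofinite) (hE : E.IsSingular) (hp : p ≠ ∞) :
    ∃ β : (Y →L[𝕜] Y) →L[𝕜] (WeakUltrapower 𝕜 p U →L[𝕜] WeakUltrapower 𝕜 p U),
      (∀ T, E.IsBeta U T (β T)) ∧ E.betaRange U = Set.range β := by
  obtain ⟨c, hc, hinc⟩ := E.exists_mul_norm_le_norm_incl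
  choose b hb using exists_isBeta (U := U) hU hE hp
  refine ⟨LinearMap.mkContinuous
    { toFun := b
      map_add' := fun S T => isBeta_unique (hb _) (IsBeta.of_forall fun ξ => ?_)
      map_smul' := fun a T => isBeta_unique (hb _) (IsBeta.of_forall fun ξ => ?_) }
    (‖E.incl‖ / c) fun T => ?_, hb, ?_⟩
  · rw [add_apply, map_add, map_add, IsBeta.apply (hb S), IsBeta.apply (hb T)]
    obtain ⟨x, hx⟩ := Submodule.Quotient.mk_surjective _ ξ.val
    rw [← hx]
    rfl
  · rw [smul_apply, map_smul, map_smul, IsBeta.apply (hb T)]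
    obtain ⟨x, hx⟩ := Submodule.Quotient.mk_surjective _ ξ.val
    rw [← hx]
    rfl
  · refine ContinuousLinearMap.opNorm_le_bound _ (by positivity) fun ξ => ?_
    have h1 := mul_norm_le_norm_ultraMap U hinc (b T ξ).val
    rw [IsBeta.apply (hb T), WeakUltrapower.norm_val] at h1
    have h2 := h1.trans (norm_ultraMap_ultraMap_le T ξ)
    change ‖b T ξ‖ ≤ _
    rw [div_mul_eq_mul_div, div_mul_eq_mul_div, le_div_iff₀ hc]
    linarith
  · ext B
    refine ⟨fun ⟨T, hT⟩ => ⟨T, isBeta_unique (hb T) hT⟩, ?_⟩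
    rintro ⟨T, rfl⟩
    exact ⟨T, hb T⟩

end Complete

end SelfExtension

/-! ### Asymptotic bounds on weakly null sequences, and the norm modulo compact operators. -/

section EssentialBound

variable {𝕜 : Type*} [RCLike 𝕜] {p : ℝ≥0∞} [hp1 : Fact (1 ≤ p)]
  {Y : Type*} [NormedAddCommGroup Y] [NormedSpace 𝕜 Y]

/-- The norms of the images under `S` of a weakly null sequence in the unit ball are
asymptotically at most `C`. -/
def EssBound (S : Ell 𝕜 p →L[𝕜] Y) (C : ℝ) : Prop :=
  ∀ x ∈ weaklyNull 𝕜 (Ell 𝕜 p), (∀ n, ‖x n‖ ≤ 1) → ∀ D, (∀ n, D ≤ ‖S (x n)‖) → D ≤ C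

namespace EssBound

variable {S : Ell 𝕜 p →L[𝕜] Y} {C : ℝ}

/-- `EssBound` tests only sequences all of whose images are large. As weakly null sequences may be
thinned out and rescaled, it nevertheless controls the upper limit of the norms. -/
theorem eventually_le (h : EssBound S C) {x : BddSeq (Ell 𝕜 p)}
    (hx : x ∈ weaklyNull 𝕜 (Ell 𝕜 p)) {B : ℝ} (hB : 0 < B) (hxB : ∀ n, ‖x n‖ ≤ B) {D : ℝ}
    (hD : C * B < D) : ∀ᶠ n in atTop, ‖S (x n)‖ ≤ D := by
  by_contra hcon
  have hfr : ∃ᶠ n in atTop, D ≤ ‖S (x n)‖ := by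
    exact (not_eventually.1 hcon).mono fun n hn => (lt_of_not_ge hn).le
  obtain ⟨φ, hφ, hle⟩ := extraction_of_frequently_atTop hfr
  have hn : ‖((B⁻¹ : ℝ) : 𝕜)‖ = B⁻¹ := by
    rw [RCLike.norm_ofReal, abs_of_pos (inv_pos.2 hB)]
  have := h (((B⁻¹ : ℝ) : 𝕜) • x.subseq φ)
    (Submodule.smul_mem _ _ (BddSeq.subseq_mem_weaklyNull hx hφ))
    (fun n => by
      change ‖((B⁻¹ : ℝ) : 𝕜) • x (φ n)‖ ≤ 1
      rw [norm_smul, hn, inv_mul_le_iff₀ hB, mul_one]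
      exact hxB _) (D / B) (fun n => by
      change _ ≤ ‖S (((B⁻¹ : ℝ) : 𝕜) • x (φ n))‖
      rw [map_smul, norm_smul, hn, div_eq_inv_mul]
      gcongr
      exact hle n)
  rw [div_le_iff₀ hB] at this
  linarith

/-- If every tail failed, the normalized counterexamples, the `m`-th of which is supported on `[m,
∞)`, would form a weakly null sequence in the unit ball, because `p > 1`, and contradict the bound.
-/
theorem exists_tail (h : EssBound S C) (hp : p ≠ ∞) (h1 : 1 < p) {D : ℝ} (hD : C < D) :
    ∃ m, ∀ a, ‖S (lpRestrict (Set.Ici m) a)‖ ≤ D * ‖a‖ := by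
  by_contra! hcon
  choose a ha using hcon
  have ha0 : ∀ m, 0 < ‖a m‖ := fun m => norm_pos_iff.2 fun h0 => by
    have := ha m
    rw [h0] at this
    simp at this
  have hn : ∀ m, ‖((‖a m‖⁻¹ : ℝ) : 𝕜)‖ = ‖a m‖⁻¹ := fun m => by
    rw [RCLike.norm_ofReal, abs_of_pos (inv_pos.2 (ha0 m))]
  let x : ℕ → Ell 𝕜 p := fun m => ((‖a m‖⁻¹ : ℝ) : 𝕜) • lpRestrict (Set.Ici m) (a m)
  have hx1 : ∀ m, ‖x m‖ ≤ 1 := fun m => by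
    simp only [x]
    rw [norm_smul, hn, inv_mul_le_iff₀ (ha0 m), mul_one]
    exact norm_lpRestrict_le _ _
  have hx0 : ∀ m j, j < m → x m j = 0 := fun m j hj => by
    simp only [x, lp.coeFn_smul, Pi.smul_apply]
    rw [lpRestrict_apply, if_neg (by simpa using hj), smul_zero]
  refine hD.not_ge (h ⟨x, memℓp_infty ⟨1, by rintro _ ⟨m, rfl⟩; exact hx1 m⟩⟩
    (tendsto_of_apply_eq_zero hp h1 hx1 hx0) hx1 D fun m => ?_)
  change D ≤ ‖S (x m)‖
  simp only [x]
  rw [map_smul, norm_smul, hn, inv_mul_eq_div, le_div_iff₀ (ha0 m)]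
  exact (ha m).le

end EssBound

theorem isCompactOperator_comp_lpRestrict_Iio (S : Ell 𝕜 p →L[𝕜] Y) (m : ℕ) :
    S.comp (lpRestrict (Set.Iio m)) ∈ compactOperator (RingHom.id 𝕜) (Ell 𝕜 p) Y := by
  have h : S.comp (lpRestrict (Set.Iio m)) = ∑ j ∈ Finset.range m,
      (S.comp (lp.singleContinuousLinearMap 𝕜 (fun _ : ℕ => 𝕜) p j)).comp
        (lp.evalCLM 𝕜 (fun _ : ℕ => 𝕜) p j) := by
    ext1 a
    rw [ContinuousLinearMap.comp_apply, lpRestrict_Iio, map_sum, sum_apply]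
    rfl
  rw [h]
  refine Submodule.sum_mem _ fun j _ => ?_
  exact (isCompactOperator_of_locallyCompactSpace_rng
    (S.comp (lp.singleContinuousLinearMap 𝕜 (fun _ : ℕ => 𝕜) p j))).comp_clm _

/-- `S` differs from its composition with a tail projection by a finite rank operator, and
`exists_tail` bounds that composition. -/
theorem EssBound.norm_mk_le {S : Ell 𝕜 p →L[𝕜] Y} {C : ℝ} (h : EssBound S C) (hp : p ≠ ∞)
    (h1 : 1 < p) (hC : 0 ≤ C) :
    ‖(Submodule.Quotient.mk S :
      (Ell 𝕜 p →L[𝕜] Y) ⧸ compactOperator (RingHom.id 𝕜) (Ell 𝕜 p) Y)‖ ≤ C := by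
  refine le_of_forall_gt_imp_ge_of_dense fun D hD => ?_
  obtain ⟨m, hm⟩ := h.exists_tail hp h1 hD
  have : (Submodule.Quotient.mk S :
      (Ell 𝕜 p →L[𝕜] Y) ⧸ compactOperator (RingHom.id 𝕜) (Ell 𝕜 p) Y) =
      Submodule.Quotient.mk (S.comp (lpRestrict (Set.Ici m))) := by
    rw [Submodule.Quotient.eq]
    convert isCompactOperator_comp_lpRestrict_Iio S m using 1
    ext1 a
    rw [sub_apply, ContinuousLinearMap.comp_apply, ContinuousLinearMap.comp_apply, ← map_sub,
      ← Set.compl_Iio, lpRestrict_compl, sub_sub_cancel]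
  rw [this]
  exact (Submodule.Quotient.norm_mk_le _ _).trans
    (ContinuousLinearMap.opNorm_le_bound _ (hC.trans hD.le) hm)

/-- By compactness the images have a norm convergent subsequence; its limit is also the weak limit,
which is zero. -/
theorem IsCompactOperator.exists_norm_le {K : Ell 𝕜 p →L[𝕜] Y} (hK : IsCompactOperator K)
    {x : BddSeq (Ell 𝕜 p)} (hx : x ∈ weaklyNull 𝕜 (Ell 𝕜 p)) {ε : ℝ} (hε : 0 < ε) :
    ∃ n, ‖K (x n)‖ ≤ ε := by
  have hcpt := IsCompactOperator.isCompact_closure_image_closedBall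
    (f := (K : Ell 𝕜 p →ₗ[𝕜] Y)) hK ‖x‖
  obtain ⟨z, -, φ, hφ, hlim⟩ := hcpt.tendsto_subseq (x := fun n => K (x n)) fun n =>
    subset_closure ⟨x n, by simpa using x.norm_apply_le n, rfl⟩
  have hz : z = 0 := by
    refine SeparatingDual.eq_zero_of_forall_dual_eq_zero (R := 𝕜) fun g => ?_
    have e1 : Tendsto (fun n => g (K (x (φ n)))) atTop (𝓝 (g z)) :=
      (g.continuous.tendsto z).comp hlim
    have e2 : Tendsto (fun n => g (K (x (φ n)))) atTop (𝓝 0) :=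
      (hx (g.comp K)).comp hφ.tendsto_atTop
    exact tendsto_nhds_unique e1 e2
  rw [hz] at hlim
  have h2 : Tendsto (fun n => ‖K (x (φ n))‖) atTop (𝓝 0) := by simpa using hlim.norm
  obtain ⟨n, hn⟩ := (h2.eventually (ge_mem_nhds hε)).exists
  exact ⟨φ n, hn⟩

theorem essBound_norm_mk (S : Ell 𝕜 p →L[𝕜] Y) :
    EssBound S ‖(Submodule.Quotient.mk S :
      (Ell 𝕜 p →L[𝕜] Y) ⧸ compactOperator (RingHom.id 𝕜) (Ell 𝕜 p) Y)‖ := by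
  intro x hx hx1 D hD
  refine le_of_forall_pos_le_add fun ε hε => ?_
  obtain ⟨S', hS', hlt⟩ := Submodule.Quotient.norm_mk_lt (Submodule.Quotient.mk S :
      (Ell 𝕜 p →L[𝕜] Y) ⧸ compactOperator (RingHom.id 𝕜) (Ell 𝕜 p) Y) (half_pos hε)
  have hK : IsCompactOperator (S' - S) := (Submodule.Quotient.eq _).1 hS'
  obtain ⟨n, hn⟩ := IsCompactOperator.exists_norm_le hK hx (half_pos hε)
  have h1 : ‖S' (x n)‖ ≤ ‖S'‖ := (S'.le_opNorm _).trans
    (mul_le_of_le_one_right (norm_nonneg _) (hx1 n))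
  have h2 : ‖S (x n)‖ ≤ ‖S' (x n)‖ + ‖(S' - S) (x n)‖ := by
    have : S (x n) = S' (x n) - (S' - S) (x n) := by simp
    rw [this]
    exact norm_sub_le _ _
  linarith [hD n]

end EssentialBound

/-! ### Comparison of the seminorms and the equivalence of (b) to (f). -/

namespace SelfExtension

variable {𝕜 : Type*} [RCLike 𝕜] {p : ℝ≥0∞} [hp1 : Fact (1 ≤ p)]
  {Y : Type*} [NormedAddCommGroup Y] [NormedSpace 𝕜 Y] {E : SelfExtension 𝕜 p Y}
  {U : Ultrafilter ℕ}

theorem norm_isBeta_le_of_essBound (hU : (U : Filter ℕ) ≤ cofinite) {c : ℝ} (hc : 0 < c)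
    (hinc : ∀ x, c * ‖x‖ ≤ ‖E.incl x‖) {T : Y →L[𝕜] Y}
    {B : WeakUltrapower 𝕜 p U →L[𝕜] WeakUltrapower 𝕜 p U} (hB : E.IsBeta U T B) {C : ℝ}
    (hC : 0 ≤ C) (h : EssBound (T.comp E.incl) C) : ‖B‖ ≤ C / c := by
  refine B.opNorm_le_bound (by positivity) fun ξ => ?_
  have h1 := mul_norm_le_norm_ultraMap U hinc (B ξ).val
  rw [IsBeta.apply hB, WeakUltrapower.norm_val] at h1
  rw [div_mul_eq_mul_div, le_div_iff₀ hc, mul_comm]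
  refine h1.trans ?_
  -- The slack `δ` allows a representative with all terms of norm at most `‖ξ‖ + δ`; this bound is
  -- positive even for `ξ = 0`, as `eventually_le` requires.
  have key : ∀ δ : ℝ, 0 < δ →
      ‖ultraMap U T (ultraMap U E.incl ξ.val)‖ ≤ C * (‖ξ‖ + δ) + δ := fun δ hδ => by
    obtain ⟨x, hx, rfl⟩ := WeakUltrapower.exists_mk U ξ
    obtain ⟨y, hy, hyx, hyC⟩ := exists_weaklyNull_norm_le U hx
      (show _ < ‖WeakUltrapower.mk U x hx‖ + δ from lt_add_of_pos_right _ hδ)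
    rw [WeakUltrapower.val_mk, ← hyx]
    have hev := h.eventually_le hy (by positivity) hyC
      (D := C * (‖WeakUltrapower.mk U x hx‖ + δ) + δ) (by linarith)
    exact le_of_tendsto (ultrapower_tendsto_norm (𝕜 := 𝕜) U (seqMap T (seqMap E.incl y)))
      (hev.filter_mono (hU.trans Nat.cofinite_eq_atTop.le))
  have hlim : Tendsto (fun δ : ℝ => C * (‖ξ‖ + δ) + δ) (𝓝[>] 0) (𝓝 (C * ‖ξ‖)) := by
    have : Continuous fun δ : ℝ => C * (‖ξ‖ + δ) + δ := by fun_prop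
    simpa using (this.tendsto 0).mono_left nhdsWithin_le_nhds
  exact ge_of_tendsto hlim (eventually_mem_nhdsWithin.mono fun δ hδ => key δ hδ)

theorem essBound_of_isBeta {T : Y →L[𝕜] Y}
    {B : WeakUltrapower 𝕜 p U →L[𝕜] WeakUltrapower 𝕜 p U} (hB : E.IsBeta U T B) :
    EssBound (T.comp E.incl) (‖E.incl‖ * ‖B‖) := by
  intro x hx hx1 D hD
  have h1 : D ≤ ‖ultraMap U T (ultraMap U E.incl (WeakUltrapower.mk U x hx).val)‖ :=
    ge_of_tendsto (ultrapower_tendsto_norm (𝕜 := 𝕜) U (seqMap T (seqMap E.incl x)))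
      (Eventually.of_forall hD)
  have h2 : ‖WeakUltrapower.mk U x hx‖ ≤ 1 :=
    (Submodule.Quotient.norm_mk_le _ x).trans (lp.norm_le_of_forall_le zero_le_one hx1)
  rw [← IsBeta.apply hB] at h1
  calc D ≤ _ := h1
    _ ≤ ‖E.incl‖ * ‖B (WeakUltrapower.mk U x hx)‖ :=
      ((ultraMap U E.incl).le_opNorm _).trans
        (mul_le_mul_of_nonneg_right (norm_ultraMap_le U _) (norm_nonneg _))
    _ ≤ ‖E.incl‖ * ‖B‖ := by
      gcongr
      exact (B.le_opNorm _).trans (mul_le_of_le_one_right (norm_nonneg _) h2)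

theorem singNormQuot_nonneg (q : OperatorsModSingular 𝕜 Y Y) : 0 ≤ singNormQuot q := by
  obtain ⟨T, rfl⟩ := Submodule.Quotient.mk_surjective _ q
  exact singNorm_nonneg T

/-- The right-hand side is the criterion of `isClosed_range_iff_of_seminorm` for `‖·‖_S`: here
`singNorm (T' - T) = 0` means that `T'` is another representative of the class of `T` modulo `S(Y)`.
-/
theorem isSingNormEquivalent_iff : IsSingNormEquivalent 𝕜 Y Y ↔
    ∃ K, ∀ T : Y →L[𝕜] Y, ∃ T', singNorm (T' - T) = 0 ∧ ‖T'‖ ≤ K * singNorm T := by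
  have hquot : ∀ T : Y →L[𝕜] Y,
      singNormQuot (Submodule.Quotient.mk T : OperatorsModSingular 𝕜 Y Y) = singNorm T :=
    fun T => rfl
  refine ⟨fun ⟨c, C, hc, _, hcC⟩ => ⟨2 / c, fun T => ?_⟩, fun ⟨K, hK⟩ => ?_⟩
  -- A representative almost attaining the quotient norm exists only up to a positive slack, taken
  -- to be `‖T‖_S / c`; hence the constant `2 / c` and the separate case `‖T‖_S = 0`.
  · rcases (singNorm_nonneg T).eq_or_lt with h0 | h0
    · refine ⟨0, ?_, by rw [← h0]; simp⟩
      have := (strictlySingularOperators 𝕜 Y Y).neg_mem (isStrictlySingular_iff_singNorm.2 h0.symm)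
      rw [zero_sub]
      exact isStrictlySingular_iff_singNorm.1 this
    · obtain ⟨T', hT', hlt⟩ := Submodule.Quotient.norm_mk_lt
        (Submodule.Quotient.mk T : OperatorsModSingular 𝕜 Y Y)
        (show 0 < singNorm T / c by positivity)
      refine ⟨T', isStrictlySingular_iff_singNorm.1 ((Submodule.Quotient.eq _).1 hT'),
        hlt.le.trans ?_⟩
      have h1 := (hcC (Submodule.Quotient.mk T)).1
      rw [hquot] at h1
      rw [div_mul_eq_mul_div, le_div_iff₀ hc, add_mul, div_mul_cancel₀ _ hc.ne']
      linarith
  · refine ⟨(|K| + 1)⁻¹, 1, by positivity, one_pos, fun q => ⟨?_, ?_⟩⟩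
    · obtain ⟨T, rfl⟩ := Submodule.Quotient.mk_surjective _ q
      obtain ⟨T', h0, hle⟩ := hK T
      have h1 : (Submodule.Quotient.mk T : OperatorsModSingular 𝕜 Y Y) =
          Submodule.Quotient.mk T' :=
        ((Submodule.Quotient.eq _).2 (isStrictlySingular_iff_singNorm.2 h0)).symm
      rw [inv_mul_le_iff₀ (by positivity), hquot, h1]
      refine (Submodule.Quotient.norm_mk_le _ _).trans (hle.trans ?_)
      exact mul_le_mul_of_nonneg_right (by linarith [le_abs_self K]) (singNorm_nonneg T)
    · rw [one_mul]
      refine le_of_forall_pos_le_add fun ε hε => ?_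
      obtain ⟨T, rfl, hlt⟩ := Submodule.Quotient.norm_mk_lt q (half_pos hε)
      rw [hquot]
      have h1 : singNorm T ≤ ‖T‖ + ε / 2 := singNorm_le (by positivity)
        (isStronglySingular_of_norm_le (by linarith))
      linarith

/-- `ext_K` is the full preimage of the image in the Calkin quotient, and preimages under a
topological quotient map detect closedness. -/
theorem isClosed_extK_iff : IsClosed (E.extK : Set (Ell 𝕜 p →L[𝕜] Y)) ↔
    IsClosed E.calkinImage := by
  have h : (E.extK : Set (Ell 𝕜 p →L[𝕜] Y)) =
      (compactOperator (RingHom.id 𝕜) (Ell 𝕜 p) Y).mkQ ⁻¹' E.calkinImage := by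
    ext S
    simp only [SetLike.mem_coe, extK, ext, Submodule.mem_sup, Set.mem_preimage, calkinImage,
      Set.mem_range, LinearMap.mem_range, Submodule.mkQ_apply, Submodule.Quotient.eq]
    constructor
    · rintro ⟨_, ⟨T, rfl⟩, K, hK, rfl⟩
      exact ⟨T, by rw [sub_add_cancel_left]; exact Submodule.neg_mem _ hK⟩
    · rintro ⟨T, hT⟩
      exact ⟨_, ⟨T, rfl⟩, S - E.restr T, by rw [← neg_sub]; exact Submodule.neg_mem _ hT,
        add_sub_cancel _ _⟩
  rw [h]
  exact (Submodule.isOpenQuotientMap_mkQ _).isQuotientMap.isClosed_preimage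

variable [CompleteSpace Y]

/-- Any infinite-dimensional subspace contains one on which `π` is small, so that its elements are
close to elements `i x`. Imposing the vanishing of finitely many extended coordinate functionals
makes the head of `x` small as well, and on the tail `T i` is almost bounded by `C`. The factor `1 /
c` converts `‖x‖` into `‖i x‖`. -/
theorem singNorm_le_of_essBound (hE : E.IsSingular) (hp : p ≠ ∞) (h1 : 1 < p) {c : ℝ} (hc : 0 < c)
    (hinc : ∀ x, c * ‖x‖ ≤ ‖E.incl x‖) {T : Y →L[𝕜] Y} {C : ℝ}
    (hC : 0 ≤ C) (h : EssBound (T.comp E.incl) C) : singNorm T ≤ C / c := by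
  refine le_of_forall_pos_le_add fun δ hδ => singNorm_le (by positivity) ?_
  obtain ⟨K, hK, hlift⟩ := E.exists_norm_sub_incl_le
  obtain ⟨m, hm⟩ := h.exists_tail hp h1 (show C < C + c * δ / 2 by linarith [mul_pos hc hδ])
  choose g hg using fun j => E.exists_extend_functional (lp.evalCLM 𝕜 (fun _ : ℕ => 𝕜) p j)
  -- `R` extends the projection of `ℓ_p` onto its first `m` coordinates to `Y`. It vanishes on the
  -- final subspace, so the head of `x` equals `-R (z - i x)` and is small.
  let R : Y →L[𝕜] Ell 𝕜 p := ∑ j ∈ Finset.range m,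
    (lp.singleContinuousLinearMap 𝕜 (fun _ : ℕ => 𝕜) p j).comp (g j)
  have hR : ∀ y, R y = ∑ j ∈ Finset.range m, lp.single p j (g j y) := fun y => by
    simp only [R, sum_apply]
    rfl
  have hRi : ∀ x, R (E.incl x) = lpRestrict (Set.Iio m) x := fun x => by
    rw [hR, lpRestrict_Iio]
    refine Finset.sum_congr rfl fun j _ => ?_
    rw [hg]
    rfl
  set A := (C + c * δ / 2) / c with hA
  have hA0 : 0 ≤ A := by positivity
  set G := ‖T‖ + A + ‖T.comp E.incl‖ * ‖R‖ with hG
  have hG0 : 0 ≤ G := by positivity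
  -- `G` collects the coefficients of all error terms, so that they contribute at most `δ / 2`; the
  -- other half of `δ` is already contained in `A`.
  set ε := δ / (2 * K * (G + 1)) with hε
  have hε0 : 0 < ε := by positivity
  intro W hW
  obtain ⟨Z, hZ, hZW, hπ⟩ := IsStrictlySingular.isStronglySingular hE hε0 W hW
  obtain ⟨Z', hZ', hZZ', hgz⟩ := hZ.exists_forall_eq_zero g m
  refine ⟨Z', hZ', hZZ'.trans hZW, fun z hz => ?_⟩
  obtain ⟨x, hx⟩ := hlift z
  have e1 : ‖z - E.incl x‖ ≤ K * ε * ‖z‖ := by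
    rw [mul_assoc]
    exact hx.trans (by gcongr; exact hπ z (hZZ' hz))
  have e2 : c * ‖x‖ ≤ (1 + K * ε) * ‖z‖ := by
    have := norm_sub_le z (z - E.incl x)
    rw [sub_sub_cancel] at this
    linarith [hinc x]
  have hRz : R z = 0 := by
    rw [hR]
    refine Finset.sum_eq_zero fun j hj => ?_
    rw [hgz z hz j (Finset.mem_range.1 hj), lp.single_zero]
  have e3 : lpRestrict (Set.Iio m) x = -R (z - E.incl x) := by
    rw [map_sub, hRz, hRi, zero_sub, neg_neg]
  have e4 : T z = T (z - E.incl x) + (T.comp E.incl) (lpRestrict (Set.Ici m) x) -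
      (T.comp E.incl) (R (z - E.incl x)) := by
    have : x = lpRestrict (Set.Ici m) x - R (z - E.incl x) := by
      rw [← Set.compl_Iio, lpRestrict_compl, e3]
      abel
    calc T z = T (z - E.incl x) + (T.comp E.incl) x := by
          rw [ContinuousLinearMap.comp_apply, ← map_add, sub_add_cancel]
      _ = T (z - E.incl x) +
          (T.comp E.incl) (lpRestrict (Set.Ici m) x - R (z - E.incl x)) := by rw [← this]
      _ = _ := by rw [map_sub (T.comp E.incl)]; abel
  have e5 : ‖(T.comp E.incl) (lpRestrict (Set.Ici m) x)‖ ≤ A * ((1 + K * ε) * ‖z‖) := by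
    refine (hm x).trans ?_
    rw [hA, div_mul_eq_mul_div, le_div_iff₀ hc, mul_assoc, mul_comm _ c]
    gcongr
  have e6 : ‖T (z - E.incl x)‖ ≤ ‖T‖ * (K * ε * ‖z‖) := (T.le_opNorm _).trans (by gcongr)
  have e7 : ‖(T.comp E.incl) (R (z - E.incl x))‖ ≤
      ‖T.comp E.incl‖ * (‖R‖ * (K * ε * ‖z‖)) :=
    ((T.comp E.incl).le_opNorm _).trans (by gcongr; exact (R.le_opNorm _).trans (by gcongr))
  have e8 : K * ε * G ≤ δ / 2 := by
    rw [hε, mul_div_assoc', div_mul_eq_mul_div, div_le_div_iff₀ (by positivity) (by positivity)]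
    nlinarith [mul_pos hK hδ]
  have e9 : A = C / c + δ / 2 := by
    rw [hA]; field_simp
  calc ‖T z‖ ≤ ‖T (z - E.incl x)‖ + ‖(T.comp E.incl) (lpRestrict (Set.Ici m) x)‖ +
        ‖(T.comp E.incl) (R (z - E.incl x))‖ := by
        rw [e4]
        exact (norm_sub_le _ _).trans (by gcongr; exact norm_add_le _ _)
    _ ≤ ‖T‖ * (K * ε * ‖z‖) + A * ((1 + K * ε) * ‖z‖) +
        ‖T.comp E.incl‖ * (‖R‖ * (K * ε * ‖z‖)) := by gcongr
    _ = (A + K * ε * G) * ‖z‖ := by rw [hG]; ring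
    _ ≤ (C / c + δ) * ‖z‖ :=
      mul_le_mul_of_nonneg_right (by rw [e9]; linarith) (norm_nonneg z)

/-- Along a weakly null sequence with `‖T i x_n‖ ≥ D > 0`, the images are asymptotically in the copy
of `ℓ_p`. The gliding hump then provides a block operator `J` with `T i J` bounded below, so `T` is
bounded below on the range of `i J`. This forbids small values of `‖T‖_S`. -/
theorem essBound_of_singNorm (hE : E.IsSingular) (hp : p ≠ ∞) {c : ℝ} (hc : 0 < c)
    (hinc : ∀ x, c * ‖x‖ ≤ ‖E.incl x‖) (T : Y →L[𝕜] Y) :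
    EssBound (T.comp E.incl) (2 * (‖E.incl‖ + 1) ^ 2 / c * singNorm T) := by
  intro x hx hx1 D hD
  have hi : 0 < ‖E.incl‖ + 1 := by positivity
  rcases le_or_gt D 0 with hD0 | hD0
  · exact hD0.trans (mul_nonneg (by positivity) (singNorm_nonneg T))
  obtain ⟨y, hy, hlim⟩ := exists_weaklyNull_tendsto hE hp T hx
  obtain ⟨J, hJ1, hJ⟩ := exists_blockOperator_bounded_below hp (T.comp E.incl) E.incl hc hinc
    (tendsto_apply_of_mem_weaklyNull hx) (tendsto_apply_of_mem_weaklyNull hy) hlim hx1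
    y.norm_apply_le hD0 hD
  set d := c * D / (2 * (‖E.incl‖ + 1)) with hd
  have hd0 : 0 < d := by positivity
  set A : Ell 𝕜 p →L[𝕜] Y := E.incl.comp J with hA
  have h1 : ∀ a, d * ‖a‖ ≤ ‖T (A a)‖ := hJ
  have h2 : ∀ a, d / (‖T‖ + 1) * ‖a‖ ≤ ‖A a‖ := fun a => by
    rw [div_mul_eq_mul_div, div_le_iff₀ (by positivity)]
    have := (h1 a).trans (T.le_opNorm _)
    nlinarith [norm_nonneg (A a)]
  have h3 : ∀ a, ‖A a‖ ≤ (‖E.incl‖ + 1) * ‖a‖ := fun a => by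
    refine (E.incl.le_opNorm _).trans (mul_le_mul (by linarith) ?_ (norm_nonneg _) hi.le)
    simpa using hJ1 a
  have h4 : d / (‖E.incl‖ + 1) ≤ singNorm T := by
    refine le_csInf (singNorm_nonempty T) fun ε ⟨hε0, hε⟩ => ?_
    obtain ⟨Z, hZ, hZA, hTZ⟩ := hε _ (isInfSubspace_range (by positivity) h2)
    obtain ⟨z, hz, hz0⟩ := hZ.exists_ne_zero
    obtain ⟨a, rfl⟩ := hZA hz
    have ha : 0 < ‖a‖ := norm_pos_iff.2 fun h => hz0 (by rw [h]; exact map_zero A)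
    have h5 : d * ‖a‖ ≤ ε * ((‖E.incl‖ + 1) * ‖a‖) :=
      (h1 a).trans ((hTZ _ hz).trans (mul_le_mul_of_nonneg_left (h3 a) hε0.le))
    rw [div_le_iff₀ hi]
    nlinarith
  rw [hd, div_div, div_le_iff₀ (by positivity)] at h4
  rw [div_mul_eq_mul_div, le_div_iff₀ hc]
  linarith

theorem isSingNormComplete_of_equivalent (h : IsSingNormEquivalent 𝕜 Y Y) :
    IsSingNormComplete 𝕜 Y Y := by
  obtain ⟨c, C, hc, hC, hcC⟩ := h
  intro u hu
  have hcau : CauchySeq u := by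
    rw [Metric.cauchySeq_iff]
    intro ε hε
    obtain ⟨N, hN⟩ := hu (c * ε) (by positivity)
    refine ⟨N, fun m hm n hn => ?_⟩
    rw [dist_eq_norm]
    have := (hcC (u m - u n)).1.trans_lt (hN m hm n hn)
    exact lt_of_mul_lt_mul_left this hc.le
  obtain ⟨l, hl⟩ := cauchySeq_tendsto_of_complete hcau
  refine ⟨l, ?_⟩
  have h0 : Tendsto (fun n => C * ‖u n - l‖) atTop (𝓝 0) := by
    have h1 := (tendsto_iff_dist_tendsto_zero.1 hl).const_mul C
    simpa only [dist_eq_norm, mul_zero] using h1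
  exact squeeze_zero (fun n => singNormQuot_nonneg _) (fun n => (hcC (u n - l)).2) h0

instance isClosed_compactOperator :
    IsClosed (compactOperator (RingHom.id 𝕜) (Ell 𝕜 p) Y : Set (Ell 𝕜 p →L[𝕜] Y)) :=
  isClosed_setOfPred_isCompactOperator

variable (𝕜 p Y) in
/-- The quotient `L(ℓ_p, Y) / K(ℓ_p, Y)` as a normed space. -/
def CalkinQuotient : Type _ := (Ell 𝕜 p →L[𝕜] Y) ⧸ compactOperator (RingHom.id 𝕜) (Ell 𝕜 p) Y

noncomputable instance : NormedAddCommGroup (CalkinQuotient 𝕜 p Y) :=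
  Submodule.Quotient.normedAddCommGroup (compactOperator (RingHom.id 𝕜) (Ell 𝕜 p) Y)

noncomputable instance : NormedSpace 𝕜 (CalkinQuotient 𝕜 p Y) :=
  Submodule.Quotient.normedSpace (compactOperator (RingHom.id 𝕜) (Ell 𝕜 p) Y) 𝕜

instance : CompleteSpace (CalkinQuotient 𝕜 p Y) :=
  Submodule.Quotient.completeSpace (compactOperator (RingHom.id 𝕜) (Ell 𝕜 p) Y)

theorem isClosed_calkinImage_iff_seminorm (hE : E.IsSingular) (hp : p ≠ ∞) (h1 : 1 < p) :
    IsClosed E.calkinImage ↔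
      ∃ K, ∀ T : Y →L[𝕜] Y, ∃ T', singNorm (T' - T) = 0 ∧ ‖T'‖ ≤ K * singNorm T := by
  obtain ⟨c, hc, hinc⟩ := E.exists_mul_norm_le_norm_incl
  let q : (Ell 𝕜 p →L[𝕜] Y) →ₗ[𝕜] CalkinQuotient 𝕜 p Y :=
    (compactOperator (RingHom.id 𝕜) (Ell 𝕜 p) Y).mkQ
  let φ : (Y →L[𝕜] Y) →L[𝕜] CalkinQuotient 𝕜 p Y :=
    LinearMap.mkContinuous (q.comp E.restr) ‖E.incl‖ fun T => by
      refine (Submodule.Quotient.norm_mk_le _ (E.restr T)).trans ?_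
      rw [mul_comm]
      exact T.opNorm_comp_le E.incl
  refine isClosed_range_iff_of_seminorm φ singNorm (a := 2 * (‖E.incl‖ + 1) ^ 2 / c)
    (b := 1 / c) (fun T => ?_) (fun T => ?_) singNorm_nonneg
  · exact (essBound_of_singNorm hE hp hc hinc T).norm_mk_le hp h1
      (mul_nonneg (by positivity) (singNorm_nonneg T))
  · rw [div_mul_eq_mul_div, one_mul]
    exact singNorm_le_of_essBound hE hp h1 hc hinc (norm_nonneg _) (essBound_norm_mk _)

/-- The norms of `β(T)` and `‖T‖_S` are equivalent. -/
theorem exists_norm_beta_equiv (hU : (U : Filter ℕ) ≤ cofinite) (hE : E.IsSingular) (hp : p ≠ ∞)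
    (h1 : 1 < p) {β : (Y →L[𝕜] Y) → (WeakUltrapower 𝕜 p U →L[𝕜] WeakUltrapower 𝕜 p U)}
    (hβ : ∀ T, E.IsBeta U T (β T)) :
    ∃ a b : ℝ, 0 ≤ a ∧ 0 ≤ b ∧
      ∀ T : Y →L[𝕜] Y, ‖β T‖ ≤ a * singNorm T ∧ singNorm T ≤ b * ‖β T‖ := by
  obtain ⟨c, hc, hinc⟩ := E.exists_mul_norm_le_norm_incl
  refine ⟨2 * (‖E.incl‖ + 1) ^ 2 / c / c, ‖E.incl‖ / c, by positivity, by positivity,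
    fun T => ⟨?_, ?_⟩⟩
  · rw [div_mul_eq_mul_div]
    exact norm_isBeta_le_of_essBound hU hc hinc (hβ T)
      (mul_nonneg (by positivity) (singNorm_nonneg T)) (essBound_of_singNorm hE hp hc hinc T)
  · rw [div_mul_eq_mul_div]
    exact singNorm_le_of_essBound hE hp h1 hc hinc (by positivity) (essBound_of_isBeta (hβ T))

theorem isClosed_betaRange_iff_seminorm (hU : (U : Filter ℕ) ≤ cofinite) (hE : E.IsSingular)
    (hp : p ≠ ∞) (h1 : 1 < p) :
    IsClosed (E.betaRange U) ↔
      ∃ K, ∀ T : Y →L[𝕜] Y, ∃ T', singNorm (T' - T) = 0 ∧ ‖T'‖ ≤ K * singNorm T := by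
  obtain ⟨β, hβ, hrange⟩ := exists_betaMap (E := E) hU hE hp
  obtain ⟨a, b, -, -, hab⟩ := exists_norm_beta_equiv hU hE hp h1 hβ
  rw [hrange]
  exact isClosed_range_iff_of_seminorm β singNorm (fun T => (hab T).1) (fun T => (hab T).2)
    singNorm_nonneg

/-- A convergent sequence `β(T_n)` makes the classes of `T_n` Cauchy for `‖·‖_S`, and `β` of a
`‖·‖_S`-limit is the limit. Both directions of the norm equivalence are used. -/
theorem isClosed_betaRange_of_isSingNormComplete (hU : (U : Filter ℕ) ≤ cofinite)
    (hE : E.IsSingular) (hp : p ≠ ∞) (h1 : 1 < p) (h : IsSingNormComplete 𝕜 Y Y) :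
    IsClosed (E.betaRange U) := by
  obtain ⟨β, hβ, hrange⟩ := exists_betaMap (E := E) hU hE hp
  obtain ⟨a, b, ha, hb, hab⟩ := exists_norm_beta_equiv hU hE hp h1 hβ
  suffices hcl : IsClosed (Set.range β) by rw [hrange]; exact hcl
  refine isClosed_of_closure_subset fun B hB => ?_
  obtain ⟨v, hv, hlim⟩ := mem_closure_iff_seq_limit.1 hB
  choose T hT using hv
  have hcau := hlim.cauchySeq
  rw [Metric.cauchySeq_iff] at hcau
  obtain ⟨l, hl⟩ := h (fun n => Submodule.Quotient.mk (T n)) fun ε hε => by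
    obtain ⟨N, hN⟩ := hcau (ε / (b + 1)) (by positivity)
    refine ⟨N, fun m hm n hn => ?_⟩
    have e1 := hN m hm n hn
    rw [dist_eq_norm, ← hT, ← hT, ← map_sub, lt_div_iff₀ (by positivity)] at e1
    have e2 := (hab (T m - T n)).2
    change singNorm (T m - T n) < ε
    nlinarith [norm_nonneg (β (T m - T n))]
  obtain ⟨S, rfl⟩ := Submodule.Quotient.mk_surjective _ l
  have hl' : Tendsto (fun n => singNorm (T n - S)) atTop (𝓝 0) := hl
  refine ⟨S, tendsto_nhds_unique ?_ hlim⟩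
  rw [tendsto_iff_norm_sub_tendsto_zero]
  refine squeeze_zero (fun n => norm_nonneg _) (fun n => ?_)
    (by simpa using hl'.const_mul a)
  rw [← hT, ← map_sub]
  exact (hab _).1

theorem tfae (hU : (U : Filter ℕ) ≤ cofinite) (hE : E.IsSingular) (hp : p ≠ ∞) (h1 : 1 < p) :
    List.TFAE [
      IsClosed (E.betaRange U),
      IsSingNormComplete 𝕜 Y Y,
      IsSingNormEquivalent 𝕜 Y Y,
      IsClosed E.calkinImage,
      IsClosed (E.extK : Set (Ell 𝕜 p →L[𝕜] Y))] := by
  tfae_have 2 → 1 := isClosed_betaRange_of_isSingNormComplete hU hE hp h1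
  tfae_have 1 ↔ 3 :=
    (isClosed_betaRange_iff_seminorm hU hE hp h1).trans isSingNormEquivalent_iff.symm
  tfae_have 3 → 2 := isSingNormComplete_of_equivalent
  tfae_have 4 ↔ 3 :=
    (isClosed_calkinImage_iff_seminorm hE hp h1).trans isSingNormEquivalent_iff.symm
  tfae_have 5 ↔ 4 := isClosed_extK_iff
  tfae_finish

end SelfExtension

/-! ### The Kalton–Peck space: completeness, block operators, strict singularity of the quotient
map. -/

section KaltonPeckSingular

variable {𝕜 : Type*} [RCLike 𝕜]

/-- The signs are chosen one at a time: by the parallelogram law at least one of `‖S + b‖²` and `‖S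
- b‖²` is not below `‖S‖² + ‖b‖²`. -/
theorem exists_signs {H : Type*} [NormedAddCommGroup H] [InnerProductSpace 𝕜 H] (b : ℕ → H)
    (N : ℕ) : ∃ s : ℕ → 𝕜, (∀ k, ‖s k‖ = 1) ∧
      ∑ k ∈ Finset.range N, ‖b k‖ ^ 2 ≤ ‖∑ k ∈ Finset.range N, s k • b k‖ ^ 2 := by
  induction N with
  | zero => exact ⟨fun _ => 1, fun _ => norm_one, by simp⟩
  | succ N ih =>
    obtain ⟨s, hs, hle⟩ := ih
    set S := ∑ k ∈ Finset.range N, s k • b k with hS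
    have key : ∀ r : 𝕜, ‖r‖ = 1 → ‖S‖ ^ 2 + ‖b N‖ ^ 2 ≤ ‖S + r • b N‖ ^ 2 →
        ∃ s : ℕ → 𝕜, (∀ k, ‖s k‖ = 1) ∧ ∑ k ∈ Finset.range (N + 1), ‖b k‖ ^ 2 ≤
          ‖∑ k ∈ Finset.range (N + 1), s k • b k‖ ^ 2 := fun r hr h => by
      refine ⟨Function.update s N r, fun k => ?_, ?_⟩
      · rcases eq_or_ne k N with rfl | hk
        · simpa using hr
        · simpa [hk] using hs k
      · have : ∑ k ∈ Finset.range N, Function.update s N r k • b k = S :=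
          Finset.sum_congr rfl fun k hk => by
            rw [Function.update_of_ne (Finset.mem_range.1 hk).ne]
        rw [Finset.sum_range_succ, Finset.sum_range_succ, this, Function.update_self]
        linarith
    have hpar := parallelogram_law_with_norm 𝕜 S (b N)
    by_cases h : ‖S‖ ^ 2 + ‖b N‖ ^ 2 ≤ ‖S + b N‖ ^ 2
    · exact key 1 norm_one (by rwa [one_smul])
    · refine key (-1) (by simp) ?_
      rw [neg_one_smul, ← sub_eq_add_neg]
      nlinarith

/-- On normalized blocks the quotient `‖Ja‖ / |Ja(j)|` factors, so its logarithm splits.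
Consequently `Ω J - J Ω` is linear in `a`, and this correction makes block operators lift to `Z_2`.
-/
theorem kpMap_blockOperator {κ : ℕ → ℕ} {u : ℕ → Ell 𝕜 2} (hu1 : ∀ k, ‖u k‖ = 1) {a Ja : Ell 𝕜 2}
    (hJ : ∀ j, Ja j = a (κ j) * u (κ j) j) (hJa : ‖Ja‖ = ‖a‖) (j : ℕ) :
    kpMap Ja j = kpMap a (κ j) * u (κ j) j + a (κ j) * kpMap (u (κ j)) j := by
  rcases eq_or_ne (a (κ j)) 0 with h0 | h0
  · simp [kpMap, hJ, h0]
  rcases eq_or_ne (u (κ j) j) 0 with h1 | h1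
  · simp [kpMap, hJ, h1]
  have ha : a ≠ 0 := by rintro rfl; exact h0 rfl
  have hlog : Real.log (‖Ja‖ / ‖Ja j‖) =
      Real.log (‖a‖ / ‖a (κ j)‖) + Real.log (‖u (κ j)‖ / ‖u (κ j) j‖) := by
    have e1 : 0 < ‖a‖ := norm_pos_iff.2 ha
    have e2 : 0 < ‖a (κ j)‖ := norm_pos_iff.2 h0
    have e3 : 0 < ‖u (κ j) j‖ := norm_pos_iff.2 h1
    rw [hJa, hJ, norm_mul, hu1, ← Real.log_mul (by positivity) (by positivity)]
    congr 1
    field_simp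
  simp only [kpMap]
  rw [hlog, hJ]
  push_cast
  ring

namespace KaltonPeck

theorem eq_of_defect_eq {u v : KaltonPeck 𝕜} (h1 : u.defect = v.defect) (h2 : u.snd = v.snd) :
    u = v :=
  ext' (by ext n; rw [fst_apply, fst_apply, h1, h2]) h2

theorem norm_ofEll_zero_le (z : Ell 𝕜 2) : ‖ofEll 0 z‖ ≤ 2 * ‖z‖ := by
  have := norm_le_quasiNorm (ofEll 0 z)
  rwa [quasiNorm_ofEll, norm_zero, zero_add] at this

theorem eq_incl_of_proj_eq_zero {u : KaltonPeck 𝕜} (h : proj u = 0) : u = incl u.defect :=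
  eq_of_defect_eq (by rw [incl_apply, defect_ofEll]) h

/-- A Cauchy sequence has convergent second coordinates. Subtracting bounded lifts of the null
differences and of the limit moves the sequence into the isometric copy of `ℓ_2`, which is complete.
-/
instance : CompleteSpace (KaltonPeck 𝕜) := by
  refine Metric.complete_of_cauchySeq_tendsto fun u hu => ?_
  obtain ⟨z, hz⟩ := cauchySeq_tendsto_of_complete
    ((proj : KaltonPeck 𝕜 →L[𝕜] Ell 𝕜 2).uniformContinuous.comp_cauchySeq hu)
  set v : ℕ → KaltonPeck 𝕜 := fun n => ofEll 0 (proj (u n) - z) with hv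
  have hv0 : Tendsto v atTop (𝓝 0) := by
    rw [tendsto_zero_iff_norm_tendsto_zero]
    refine squeeze_zero (fun n => norm_nonneg _) (fun n => norm_ofEll_zero_le _) ?_
    simpa using (tendsto_iff_norm_sub_tendsto_zero.1 hz).const_mul 2
  have ha : ∀ n, ∃ a, incl a = u n - v n - ofEll 0 z := fun n => by
    refine ⟨_, (eq_incl_of_proj_eq_zero ?_).symm⟩
    rw [map_sub, map_sub, proj_apply (v n), proj_apply (ofEll 0 z), snd_ofEll, snd_ofEll,
      sub_sub_cancel, sub_self]
  choose a ha using ha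
  have hisom : Isometry (incl : Ell 𝕜 2 →L[𝕜] KaltonPeck 𝕜) :=
    AddMonoidHomClass.isometry_of_norm _ norm_incl
  have hac : CauchySeq a := by
    have : CauchySeq fun n => u n - v n - ofEll 0 z := by
      refine uniformContinuous_sub.comp_cauchySeq ((uniformContinuous_sub.comp_cauchySeq
        (hu.prodMk hv0.cauchySeq)).prodMk tendsto_const_nhds.cauchySeq)
    rw [Metric.cauchySeq_iff] at this ⊢
    refine fun ε hε => (this ε hε).imp fun N hN m hm n hn => ?_
    rw [← hisom.dist_eq, ha, ha]
    exact hN m hm n hn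
  obtain ⟨l, hl⟩ := cauchySeq_tendsto_of_complete hac
  refine ⟨incl l + ofEll 0 z, ?_⟩
  have h1 : Tendsto (fun n => incl (a n)) atTop (𝓝 (incl l)) := (incl.continuous.tendsto l).comp hl
  have h2 := (h1.add_const (ofEll 0 z)).add hv0
  rw [add_zero] at h2
  refine h2.congr fun n => ?_
  rw [ha]
  abel

/-- The operator on `Z_2` induced by a normalized sequence of disjointly supported vectors. -/
theorem exists_blockOperator {κ : ℕ → ℕ} {u : ℕ → Ell 𝕜 2} (hu : ∀ k j, κ j ≠ k → u k j = 0)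
    (hu1 : ∀ k, ‖u k‖ = 1) :
    ∃ T : KaltonPeck 𝕜 →L[𝕜] KaltonPeck 𝕜, ∀ k, T (incl (lp.single 2 k 1)) = incl (u k) := by
  obtain ⟨J, hJ, hJ1, hJ2⟩ := _root_.exists_blockOperator (𝕜 := 𝕜) (p := 2) (by norm_num) hu
    (B := 1) fun k => (hu1 k).le
  have hJn : ∀ a, ‖J a‖ = ‖a‖ := fun a => le_antisymm (by simpa using hJ1 a)
    (by simpa using hJ2 1 zero_le_one (fun k => (hu1 k).ge) a)
  -- The second summand is the correction from `kpMap_blockOperator`. With it, `J` acts on the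
  -- defect as it does on the second coordinate, and the lifted operator preserves the quasi-norm.
  have hdef : ∀ v : KaltonPeck 𝕜, (fun j => v.fst (κ j) * u (κ j) j +
      v.snd (κ j) * kpMap (u (κ j)) j) - kpMap (J v.snd) = J v.defect := fun v => by
    ext j
    rw [Pi.sub_apply, kpMap_blockOperator hu1 (hJ v.snd) (hJn v.snd), hJ, fst_apply]
    ring
  let L : KaltonPeck 𝕜 →ₗ[𝕜] KaltonPeck 𝕜 :=
    { toFun := fun v => ⟨(fun j => v.fst (κ j) * u (κ j) j + v.snd (κ j) * kpMap (u (κ j)) j,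
        J v.snd), by
          change Memℓp (_ - kpMap (J v.snd)) 2
          rw [hdef]
          exact lp.memℓp _⟩
      map_add' := fun v w => ext' (by
          ext j
          change (v + w).fst (κ j) * _ + (v + w).snd (κ j) * _ =
            (v.fst (κ j) * _ + v.snd (κ j) * _) + (w.fst (κ j) * _ + w.snd (κ j) * _)
          rw [fst_add, snd_add, lp.coeFn_add, Pi.add_apply, Pi.add_apply]
          ring) (J.map_add v.snd w.snd)
      map_smul' := fun c v => ext' (by
          ext j
          change (c • v).fst (κ j) * _ + (c • v).snd (κ j) * _ =
            c * (v.fst (κ j) * _ + v.snd (κ j) * _)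
          rw [fst_smul, snd_smul, lp.coeFn_smul, Pi.smul_apply, Pi.smul_apply, smul_eq_mul,
            smul_eq_mul]
          ring) (J.map_smul c v.snd) }
  have hLs : ∀ v, (L v).snd = J v.snd := fun v => rfl
  have hLd : ∀ v, (L v).defect = J v.defect := fun v => lp.ext (hdef v)
  refine ⟨L.mkContinuous 8 fun v => ?_, fun k => ?_⟩
  · have h1 : (L v).quasiNorm = v.quasiNorm := by
      rw [quasiNorm, quasiNorm, hLs, hLd, hJn, hJn]
    linarith [norm_le_quasiNorm (L v), quasiNorm_le_norm v]
  · change L (incl (lp.single 2 k 1)) = incl (u k)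
    refine eq_of_defect_eq ?_ ?_
    · rw [hLd, incl_apply, incl_apply, defect_ofEll, defect_ofEll, blockOperator_single hu hJ]
    · rw [hLs, incl_apply, incl_apply, snd_ofEll, snd_ofEll, map_zero]

/-- In `Z_2`, lifts of disjointly supported normalized vectors of `ℓ_2`, whose signed sums have
norms of order `√N`, are far from bounded. -/
theorem log_le_of_lift {κ : ℕ → ℕ} {u : ℕ → Ell 𝕜 2} (hu : ∀ k j, κ j ≠ k → u k j = 0)
    (hu1 : ∀ k, ‖u k‖ = 1) {h : ℕ → KaltonPeck 𝕜} (hh : ∀ k, (h k).snd = u k) {M : ℝ}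
    (hM : ∀ k, ‖h k‖ ≤ M) {N : ℕ} (hN : 0 < N)
    (hsum : ∀ s : ℕ → 𝕜, (∀ k, ‖s k‖ = 1) →
      ‖∑ k ∈ Finset.range N, s k • h k‖ ≤ M * Real.sqrt N) :
    Real.log (Real.sqrt N) ≤ 6 * M := by
  have hNr : (0 : ℝ) < N := Nat.cast_pos.2 hN
  have hM0 : 0 ≤ M := (norm_nonneg _).trans (hM 0)
  set ℓ := Real.log (Real.sqrt N) with hℓ
  -- For unimodular coefficients on `N` coordinates `Ω` is multiplication by `ℓ = log √N`, so the
  -- defect of `∑ s_k h_k` is exactly `∑ s_k b_k`. Each `b_k` has norm at least `ℓ - 3M`, whereas a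
  -- suitable signed sum has norm at most `3M √N`.
  set b : ℕ → Ell 𝕜 2 := fun k => (h k).defect - (ℓ : 𝕜) • u k with hb
  obtain ⟨s, hs, hle⟩ := exists_signs (𝕜 := 𝕜) b N
  set v := ∑ k ∈ Finset.range N, s k • h k with hv
  have hdefect : v.defect = ∑ k ∈ Finset.range N, s k • b k := by
    obtain ⟨J, hJ, hJ1, hJ2⟩ := _root_.exists_blockOperator (𝕜 := 𝕜) (p := 2) (by norm_num) hu
      (B := 1) fun k => (hu1 k).le
    set z : Ell 𝕜 2 := ∑ k ∈ Finset.range N, lp.single 2 k (s k) with hz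
    have hJn : ‖J z‖ = ‖z‖ := le_antisymm (by simpa using hJ1 z)
      (by simpa using hJ2 1 zero_le_one (fun k => (hu1 k).ge) z)
    have hzk : ∀ k, z k = if k < N then s k else 0 := fun k => by
      rw [hz, lp.coeFn_sum, Finset.sum_apply]
      simp only [lp.coeFn_single, Pi.single_apply]
      simp
    have hzn : ‖z‖ = Real.sqrt N := by
      have := lp.norm_sum_single (p := 2) (by norm_num) (fun k : ℕ => s k) (Finset.range N)
      simp only [hs, Real.one_rpow, Finset.sum_const, Finset.card_range, nsmul_eq_mul,
        mul_one, ← hz] at this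
      rw [← this]
      norm_num
    have hkz : ∀ k, kpMap z k = (ℓ : 𝕜) * z k := fun k => by
      rw [kpMap, hzn, hzk]
      split_ifs
      · rw [hs, div_one, mul_comm]
      · simp
    have hsingle : ∀ k, lp.single 2 k (s k) =
        s k • (lp.single (E := fun _ : ℕ => 𝕜) 2 k (1 : 𝕜)) := fun k => by
      rw [← lp.single_smul, smul_eq_mul, mul_one]
    have hJz : J z = ∑ k ∈ Finset.range N, s k • u k := by
      rw [hz, map_sum]
      refine Finset.sum_congr rfl fun k _ => ?_
      rw [hsingle, map_smul, blockOperator_single hu hJ]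
    have hsnd : v.snd = J z := by
      rw [hJz, ← proj_apply, hv, map_sum]
      refine Finset.sum_congr rfl fun k _ => ?_
      rw [map_smul, proj_apply, hh]
    have hfst : ∀ j, v.fst j = ∑ k ∈ Finset.range N, s k * (h k).fst j := fun j => by
      let F : KaltonPeck 𝕜 →ₗ[𝕜] 𝕜 :=
        { toFun := fun w => w.fst j
          map_add' := fun _ _ => rfl
          map_smul' := fun _ _ => rfl }
      change F v = ∑ k ∈ Finset.range N, s k * F (h k)
      rw [hv, map_sum]
      exact Finset.sum_congr rfl fun k _ => F.map_smul _ _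
    ext j
    have e1 : v.defect j = v.fst j - kpMap v.snd j := rfl
    have e2 : ∀ k, (h k).fst j = kpMap (u k) j + (h k).defect j := fun k => by
      rw [fst_apply, hh]
    have e3 : z (κ j) * kpMap (u (κ j)) j = ∑ k ∈ Finset.range N, s k * kpMap (u k) j := by
      rw [hzk]
      split_ifs with hlt
      · rw [Finset.sum_eq_single_of_mem (κ j) (Finset.mem_range.2 hlt)]
        intro k _ hk
        rw [kpMap, hu k j hk.symm, zero_mul, mul_zero]
      · rw [zero_mul]
        refine (Finset.sum_eq_zero fun k hk => ?_).symm
        have hne : κ j ≠ k := by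
          rintro rfl
          exact hlt (Finset.mem_range.1 hk)
        rw [kpMap, hu k j hne, zero_mul, mul_zero]
    have e4 : (∑ k ∈ Finset.range N, s k • u k : Ell 𝕜 2) j =
        ∑ k ∈ Finset.range N, s k * u k j := by
      rw [lp.coeFn_sum, Finset.sum_apply]; rfl
    have e5 : (∑ k ∈ Finset.range N, s k • b k : Ell 𝕜 2) j =
        ∑ k ∈ Finset.range N, s k * ((h k).defect j - ℓ * u k j) := by
      rw [lp.coeFn_sum, Finset.sum_apply]; rfl
    rw [e1, hsnd, kpMap_blockOperator hu1 (hJ z) hJn, hkz, mul_assoc, ← hJ, hJz, e3, e4, hfst,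
      e5, Finset.mul_sum, ← Finset.sum_add_distrib, ← Finset.sum_sub_distrib]
    refine Finset.sum_congr rfl fun k _ => ?_
    rw [e2]
    ring
  have hvn : ‖∑ k ∈ Finset.range N, s k • b k‖ ≤ 3 * (M * Real.sqrt N) := by
    rw [← hdefect]
    exact (norm_defect_le v).trans (by gcongr; exact hsum s hs)
  have hbk : ∀ k, ℓ - 3 * M ≤ ‖b k‖ := fun k => by
    have e1 : ‖(ℓ : 𝕜) • u k‖ ≤ ‖(h k).defect‖ + ‖b k‖ := by
      have : (ℓ : 𝕜) • u k = (h k).defect - b k := by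
        simp only [hb, sub_sub_cancel]
      rw [this]
      exact norm_sub_le _ _
    rw [norm_smul, hu1, mul_one, RCLike.norm_ofReal] at e1
    linarith [norm_defect_le (h k), hM k, le_abs_self ℓ]
  by_contra! hcon
  have h1 : ∑ k ∈ Finset.range N, (ℓ - 3 * M) ^ 2 ≤ ∑ k ∈ Finset.range N, ‖b k‖ ^ 2 :=
    Finset.sum_le_sum fun k _ => by
      gcongr
      · linarith
      · exact hbk k
  rw [Finset.sum_const, Finset.card_range, nsmul_eq_mul] at h1
  have h2 : ‖∑ k ∈ Finset.range N, s k • b k‖ ^ 2 ≤ (3 * (M * Real.sqrt N)) ^ 2 := by gcongr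
  have h3 : (3 * (M * Real.sqrt N)) ^ 2 = N * (3 * M) ^ 2 := by
    rw [mul_pow, mul_pow, mul_pow, Real.sq_sqrt hNr.le]; ring
  have h4 : (N : ℝ) * (ℓ - 3 * M) ^ 2 ≤ N * (3 * M) ^ 2 := by linarith
  have h5 := le_of_mul_le_mul_left h4 hNr
  nlinarith

theorem norm_inv_norm_smul {r : Ell 𝕜 2} (hr : r ≠ 0) : ‖((‖r‖⁻¹ : ℝ) : 𝕜) • r‖ = 1 := by
  have h := norm_pos_iff.2 hr
  rw [norm_smul, RCLike.norm_ofReal, abs_of_pos (inv_pos.2 h), inv_mul_cancel₀ h.ne']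

theorem norm_sub_inv_norm_smul_le {x r : Ell 𝕜 2} (hx : ‖x‖ = 1) (hr : r ≠ 0) :
    ‖x - ((‖r‖⁻¹ : ℝ) : 𝕜) • r‖ ≤ 2 * ‖x - r‖ := by
  have h := norm_pos_iff.2 hr
  have e1 : ‖r - ((‖r‖⁻¹ : ℝ) : 𝕜) • r‖ ≤ ‖x - r‖ := by
    have : r - ((‖r‖⁻¹ : ℝ) : 𝕜) • r = ((1 - ‖r‖⁻¹ : ℝ) : 𝕜) • r := by
      rw [RCLike.ofReal_sub, sub_smul, RCLike.ofReal_one, one_smul]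
    rw [this, norm_smul, RCLike.norm_ofReal]
    nth_rewrite 2 [← abs_of_pos h]
    rw [← abs_mul, sub_mul, one_mul, inv_mul_cancel₀ h.ne', ← hx, abs_sub_comm]
    exact abs_norm_sub_norm_le x r
  calc ‖x - ((‖r‖⁻¹ : ℝ) : 𝕜) • r‖ = ‖(x - r) + (r - ((‖r‖⁻¹ : ℝ) : 𝕜) • r)‖ := by
        rw [sub_add_sub_cancel]
    _ ≤ ‖x - r‖ + ‖r - ((‖r‖⁻¹ : ℝ) : 𝕜) • r‖ := norm_add_le _ _
    _ ≤ _ := by linarith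

/-- If the quotient map were bounded below on `W`, a gliding sequence of unit vectors in the image
of `W` would have bounded lifts whose signed sums have norm `O(√N)`, and this persists after
perturbation to exact blocks. Then `log_le_of_lift` applies. -/
theorem log_sqrt_le_of_bounded_below {W : Submodule 𝕜 (KaltonPeck 𝕜)} (hW : IsInfSubspace W)
    {c : ℝ} (hc : 0 < c) (hcW : ∀ w ∈ W, c * ‖w‖ ≤ ‖proj w‖) :
    ∃ M : ℝ, ∀ N : ℕ, 0 < N → Real.log (Real.sqrt N) ≤ M := by
  have hex : ∀ n : ℕ, ∃ w : KaltonPeck 𝕜, ‖proj w‖ = 1 ∧ ‖w‖ ≤ c⁻¹ ∧ w ∈ W ∧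
      ∀ j < n, proj w j = 0 := fun n => by
    obtain ⟨Z, hZ, hZW, hZ0⟩ := hW.exists_forall_eq_zero
      (fun j => (lp.evalCLM 𝕜 (fun _ : ℕ => 𝕜) 2 j).comp proj) n
    obtain ⟨w, hw, hw0⟩ := hZ.exists_ne_zero
    have h1 := hcW w (hZW hw)
    have h2 : 0 < ‖proj w‖ := (mul_pos hc (norm_pos_iff.2 hw0)).trans_le h1
    refine ⟨((‖proj w‖⁻¹ : ℝ) : 𝕜) • w, ?_, ?_, W.smul_mem _ (hZW hw), fun j hj => ?_⟩
    · rw [map_smul]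
      exact norm_inv_norm_smul (norm_pos_iff.1 h2)
    · rw [norm_smul, RCLike.norm_ofReal, abs_of_pos (inv_pos.2 h2), inv_mul_le_iff₀ h2,
        ← div_eq_mul_inv, le_div_iff₀ hc, mul_comm]
      exact h1
    · have := hZ0 w hw j hj
      rw [map_smul, lp.coeFn_smul, Pi.smul_apply,
        show proj w j = 0 from this, smul_zero]
  choose w hw1 hwM hwW hw0 using hex
  have hx0 : ∀ j, Tendsto (fun n => proj (w n) j) atTop (𝓝 0) := fun j =>
    tendsto_const_nhds.congr' (by
      filter_upwards [eventually_gt_atTop j] with n hn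
      exact (hw0 n j hn).symm)
  obtain ⟨κ, n, hblk⟩ := exists_blocks (p := 2) (by norm_num) hx0 hx0
    -- Normalizing the blocks at most doubles the errors, so the corrections `d k` have norms of
    -- total at most `1 / 2`.
    (ε := fun k => 1 / 8 * (1 / 2) ^ k) (fun k => by positivity) (P := fun _ _ => True)
    (fun _ => Eventually.of_forall fun _ => trivial)
  set r : ℕ → Ell 𝕜 2 := fun k => lpRestrict {j | κ j = k} (proj (w (n k))) with hr
  have hsmall : ∀ k : ℕ, (1 / 8 : ℝ) * (1 / 2) ^ k ≤ 1 / 8 := fun k =>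
    mul_le_of_le_one_right (by norm_num) (pow_le_one₀ (by norm_num) (by norm_num))
  have hr0 : ∀ k, r k ≠ 0 := fun k h0 => by
    have h1 : ‖proj (w (n k)) - r k‖ ≤ 1 / 8 * (1 / 2) ^ k := (hblk k).2.1
    rw [h0, sub_zero, hw1] at h1
    linarith [hsmall k]
  set u : ℕ → Ell 𝕜 2 := fun k => ((‖r k‖⁻¹ : ℝ) : 𝕜) • r k with hu
  have hu1 : ∀ k, ‖u k‖ = 1 := fun k => norm_inv_norm_smul (hr0 k)
  have hu0 : ∀ k j, κ j ≠ k → u k j = 0 := fun k j hj => by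
    have : r k j = 0 := lpRestrict_fiber (fun k => proj (w (n k))) k j hj
    simp only [hu, lp.coeFn_smul, Pi.smul_apply, this, smul_zero]
  set d : ℕ → Ell 𝕜 2 := fun k => proj (w (n k)) - u k with hd
  have hdk : ∀ k, ‖d k‖ ≤ 1 / 4 * (1 / 2) ^ k := fun k => by
    have h1 := norm_sub_inv_norm_smul_le (hw1 (n k)) (hr0 k)
    have h2 : ‖proj (w (n k)) - r k‖ ≤ 1 / 8 * (1 / 2) ^ k := (hblk k).2.1
    have h3 : ‖d k‖ ≤ 2 * ‖proj (w (n k)) - r k‖ := h1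
    linarith
  have hdsum : ∀ N, ∑ k ∈ Finset.range N, ‖d k‖ ≤ 1 / 2 := fun N => by
    calc ∑ k ∈ Finset.range N, ‖d k‖ ≤ ∑ k ∈ Finset.range N, 1 / 4 * (1 / 2 : ℝ) ^ k :=
          Finset.sum_le_sum fun k _ => hdk k
      _ ≤ 1 / 4 * 2 := by
          rw [← Finset.mul_sum]
          gcongr
          have := Summable.sum_le_tsum (Finset.range N) (fun i _ => by positivity)
            summable_geometric_two
          rwa [tsum_geometric_two] at this
      _ = 1 / 2 := by norm_num
  set h : ℕ → KaltonPeck 𝕜 := fun k => w (n k) - ofEll 0 (d k) with hh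
  have hhs : ∀ k, (h k).snd = u k := fun k => by
    rw [← proj_apply, hh, map_sub, proj_apply (ofEll 0 (d k)), snd_ofEll, hd, sub_sub_cancel]
  obtain ⟨J, hJ, hJ1, -⟩ := _root_.exists_blockOperator (𝕜 := 𝕜) (p := 2) (by norm_num) hu0
    (B := 1) fun k => (hu1 k).le
  have hcinv : 0 < c⁻¹ := inv_pos.2 hc
  refine ⟨6 * (2 * c⁻¹ + 1), fun N hN => log_le_of_lift hu0 hu1 hhs (fun k => ?_) hN
    fun s hs => ?_⟩
  · have h1 : ‖h k‖ ≤ ‖w (n k)‖ + ‖ofEll 0 (d k)‖ := norm_sub_le _ _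
    have h2 := norm_ofEll_zero_le (d k)
    have h3 : ‖d k‖ ≤ 1 / 4 := (hdk k).trans
      (mul_le_of_le_one_right (by norm_num) (pow_le_one₀ (by norm_num) (by norm_num)))
    linarith [hwM (n k)]
  · have hN1 : 1 ≤ Real.sqrt N := by
      rw [Real.one_le_sqrt]
      exact_mod_cast hN
    set z : Ell 𝕜 2 := ∑ k ∈ Finset.range N, lp.single 2 k (s k) with hz
    have hzn : ‖z‖ = Real.sqrt N := by
      have := lp.norm_sum_single (p := 2) (by norm_num) (fun k : ℕ => s k) (Finset.range N)
      simp only [hs, Real.one_rpow, Finset.sum_const, Finset.card_range, nsmul_eq_mul,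
        mul_one, ← hz] at this
      rw [← this]
      norm_num
    have hJz : J z = ∑ k ∈ Finset.range N, s k • u k := by
      rw [hz, map_sum]
      refine Finset.sum_congr rfl fun k _ => ?_
      have : lp.single 2 k (s k) = s k • (lp.single (E := fun _ : ℕ => 𝕜) 2 k (1 : 𝕜)) := by
        rw [← lp.single_smul, smul_eq_mul, mul_one]
      rw [this, map_smul, blockOperator_single hu0 hJ]
    have hWs : ∑ k ∈ Finset.range N, s k • w (n k) ∈ W :=
      W.sum_mem fun k _ => W.smul_mem _ (hwW _)
    have e1 : proj (∑ k ∈ Finset.range N, s k • w (n k)) =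
        J z + ∑ k ∈ Finset.range N, s k • d k := by
      rw [hJz, ← Finset.sum_add_distrib, map_sum]
      refine Finset.sum_congr rfl fun k _ => ?_
      rw [map_smul, ← smul_add, hd, add_sub_cancel]
    have e2 : ‖∑ k ∈ Finset.range N, s k • d k‖ ≤ 1 / 2 := by
      refine (norm_sum_le _ _).trans ((Finset.sum_le_sum fun k _ => ?_).trans (hdsum N))
      rw [norm_smul, hs, one_mul]
    have e3 : ‖∑ k ∈ Finset.range N, s k • w (n k)‖ ≤ c⁻¹ * (Real.sqrt N + 1 / 2) := by
      have h1 := hcW _ hWs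
      rw [e1] at h1
      rw [← div_eq_inv_mul, le_div_iff₀ hc, mul_comm]
      refine h1.trans ((norm_add_le _ _).trans (add_le_add ?_ e2))
      simpa [hzn] using hJ1 z
    have e4 : ‖∑ k ∈ Finset.range N, s k • ofEll 0 (d k)‖ ≤ 1 := by
      refine (norm_sum_le _ _).trans ?_
      calc ∑ k ∈ Finset.range N, ‖s k • ofEll 0 (d k)‖
          ≤ ∑ k ∈ Finset.range N, 2 * ‖d k‖ := Finset.sum_le_sum fun k _ => by
            rw [norm_smul, hs, one_mul]
            exact norm_ofEll_zero_le _
        _ ≤ 1 := by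
          rw [← Finset.mul_sum]
          linarith [hdsum N]
    have e5 : ∑ k ∈ Finset.range N, s k • h k =
        ∑ k ∈ Finset.range N, s k • w (n k) - ∑ k ∈ Finset.range N, s k • ofEll 0 (d k) := by
      rw [← Finset.sum_sub_distrib]
      exact Finset.sum_congr rfl fun k _ => smul_sub _ _ _
    rw [e5]
    refine (norm_sub_le _ _).trans ((add_le_add e3 e4).trans ?_)
    nlinarith

/-- The quotient map of `Z_2` onto `ℓ_2` is strictly singular. -/
theorem isSingular_selfExtension : (selfExtension 𝕜).IsSingular := by
  rintro W hW ⟨c, hc, hcW⟩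
  obtain ⟨M, hM⟩ := log_sqrt_le_of_bounded_below hW hc hcW
  have htend : Tendsto (fun N : ℕ => Real.log (Real.sqrt N)) atTop atTop :=
    Real.tendsto_log_atTop.comp (Real.tendsto_sqrt_atTop.comp tendsto_natCast_atTop_atTop)
  obtain ⟨N, hN, hN0⟩ := ((htend.eventually_gt_atTop M).and (eventually_gt_atTop 0)).exists
  exact (hM N hN0).not_gt hN

end KaltonPeck

end KaltonPeckSingular

/-! ### The representation `Λ` on the Kalton–Swanson space. -/

section KaltonSwansonRepresentation

variable {𝕜 : Type*} [RCLike 𝕜] {U : Ultrafilter ℕ}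

theorem norm_ultraMap_apply_le {X Y : Type*} [NormedAddCommGroup X] [NormedSpace 𝕜 X]
    [NormedAddCommGroup Y] [NormedSpace 𝕜 Y] (T : X →L[𝕜] Y) (x : Ultrapower 𝕜 X U) :
    ‖ultraMap U T x‖ ≤ ‖T‖ * ‖x‖ :=
  ((ultraMap U T).le_opNorm x).trans
    (mul_le_mul_of_nonneg_right (norm_ultraMap_le U T) (norm_nonneg _))

theorem norm_unitVectors_apply (n : ℕ) : ‖unitVectors 𝕜 n‖ = 1 :=
  (lp.norm_single (E := fun _ : ℕ => 𝕜) (p := 2) (by norm_num) n 1).trans norm_one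

theorem unitVectors_mem_weaklyNull : unitVectors 𝕜 ∈ weaklyNull 𝕜 (Ell 𝕜 2) :=
  tendsto_of_apply_eq_zero (B := 1) (by norm_num) (by norm_num)
    (fun n => (norm_unitVectors_apply n).le)
    fun n j hj => lp.single_apply_ne _ _ _ hj.ne

theorem norm_ksMap (T : KSPre 𝕜 U) : ‖ksMap 𝕜 U T‖ = ‖T‖ := rfl

theorem ksMap_apply (T : KSPre 𝕜 U) : ksMap 𝕜 U T =
    ultraMap U T.toOp (ultraMap U KaltonPeck.incl (Submodule.Quotient.mk (unitVectors 𝕜))) := rfl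

theorem ksMap_ksMul (A : KaltonPeck 𝕜 →L[𝕜] KaltonPeck 𝕜) (T : KSPre 𝕜 U) :
    ksMap 𝕜 U (ksMul U A T) = ultraMap U A (ksMap 𝕜 U T) := rfl

theorem norm_le_norm_ultraMap_incl (x : Ultrapower 𝕜 (Ell 𝕜 2) U) :
    ‖x‖ ≤ ‖ultraMap U (KaltonPeck.incl (𝕜 := 𝕜)) x‖ := by
  have := mul_norm_le_norm_ultraMap U (T := KaltonPeck.incl (𝕜 := 𝕜)) (c := 1)
    (fun x => by rw [one_mul, KaltonPeck.norm_incl]) x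
  rwa [one_mul] at this

/-- With `e ∈ W_2` the class of the unit vectors, the element of `H` given by `T` is `β(T) e` and
that given by `A T` is `β(A) β(T) e`. Hence `Λ(A)` is controlled by `β(A)`. -/
theorem norm_ksMul_apply_le (hU : (U : Filter ℕ) ≤ cofinite)
    {A : KaltonPeck 𝕜 →L[𝕜] KaltonPeck 𝕜}
    {B : WeakUltrapower 𝕜 2 U →L[𝕜] WeakUltrapower 𝕜 2 U}
    (hB : (KaltonPeck.selfExtension 𝕜).IsBeta U A B) (T : KSPre 𝕜 U) :
    ‖ksMul U A T‖ ≤ ‖(KaltonPeck.incl : Ell 𝕜 2 →L[𝕜] KaltonPeck 𝕜)‖ * ‖B‖ * ‖T‖ := by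
  obtain ⟨B', hB'⟩ := SelfExtension.exists_isBeta (U := U) hU
    (KaltonPeck.isSingular_selfExtension (𝕜 := 𝕜)) (by norm_num) T.toOp
  set e : WeakUltrapower 𝕜 2 U := WeakUltrapower.mk U (unitVectors 𝕜) unitVectors_mem_weaklyNull
  have h1 : ultraMap U KaltonPeck.incl (B' e).val = ksMap 𝕜 U T :=
    (SelfExtension.IsBeta.apply hB' e).trans (ksMap_apply T).symm
  have h2 : ultraMap U KaltonPeck.incl (B (B' e)).val = ksMap 𝕜 U (ksMul U A T) := by
    rw [ksMap_ksMul, ← h1]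
    exact SelfExtension.IsBeta.apply hB (B' e)
  have h3 : ‖B' e‖ ≤ ‖T‖ := by
    rw [← norm_ksMap, ← h1]
    exact norm_le_norm_ultraMap_incl _
  have h4 : ‖ksMul U A T‖ ≤
      ‖(KaltonPeck.incl : Ell 𝕜 2 →L[𝕜] KaltonPeck 𝕜)‖ * ‖B (B' e)‖ := by
    rw [← norm_ksMap, ← h2]
    exact norm_ultraMap_apply_le _ (B (B' e)).val
  rw [mul_assoc]
  refine h4.trans (mul_le_mul_of_nonneg_left ?_ (norm_nonneg _))
  exact (B.le_opNorm _).trans (mul_le_mul_of_nonneg_left h3 (norm_nonneg _))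

theorem norm_completion_le {V : Type*} [SeminormedAddCommGroup V] [NormedSpace 𝕜 V]
    (f : V →L[𝕜] V) {C : ℝ} (hC : 0 ≤ C) (h : ∀ v, ‖f v‖ ≤ C * ‖v‖) : ‖f.completion‖ ≤ C := by
  refine f.completion.opNorm_le_bound hC fun x => ?_
  induction x using UniformSpace.Completion.induction_on with
  | hp => exact isClosed_le (by fun_prop) (by fun_prop)
  | ih v =>
    rw [ContinuousLinearMap.completion_apply_coe, UniformSpace.Completion.norm_coe,
      UniformSpace.Completion.norm_coe]
    exact h v

theorem completion_add {V : Type*} [SeminormedAddCommGroup V] [NormedSpace 𝕜 V]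
    (f g : V →L[𝕜] V) : (f + g).completion = f.completion + g.completion := by
  refine DFunLike.coe_injective (UniformSpace.Completion.ext (ContinuousLinearMap.continuous _)
    (ContinuousLinearMap.continuous _) fun v => ?_)
  refine (ContinuousLinearMap.completion_apply_coe (f + g) v).trans ?_
  refine (UniformSpace.Completion.coe_add (f v) (g v)).trans ?_
  exact congrArg₂ (· + ·) (ContinuousLinearMap.completion_apply_coe f v).symm
    (ContinuousLinearMap.completion_apply_coe g v).symm

theorem completion_smul {V : Type*} [SeminormedAddCommGroup V] [NormedSpace 𝕜 V]
    (c : 𝕜) (f : V →L[𝕜] V) : (c • f).completion = c • f.completion := by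
  refine DFunLike.coe_injective (UniformSpace.Completion.ext (ContinuousLinearMap.continuous _)
    (ContinuousLinearMap.continuous _) fun v => ?_)
  refine (ContinuousLinearMap.completion_apply_coe (c • f) v).trans ?_
  refine (UniformSpace.Completion.coe_smul c (f v)).trans ?_
  exact congrArg (c • ·) (ContinuousLinearMap.completion_apply_coe f v).symm

theorem ksMul_add (A B : KaltonPeck 𝕜 →L[𝕜] KaltonPeck 𝕜) :
    ksMul U (A + B) = ksMul U A + ksMul U B :=
  ContinuousLinearMap.ext fun T => ContinuousLinearMap.add_comp A B T.toOp

theorem ksMul_smul (c : 𝕜) (A : KaltonPeck 𝕜 →L[𝕜] KaltonPeck 𝕜) :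
    ksMul U (c • A) = c • ksMul U A :=
  ContinuousLinearMap.ext fun T => ContinuousLinearMap.smul_comp c A T.toOp

theorem ksLambda_add (A B : KaltonPeck 𝕜 →L[𝕜] KaltonPeck 𝕜) :
    ksLambda U (A + B) = ksLambda U A + ksLambda U B := by
  rw [ksLambda, ksMul_add, completion_add]
  rfl

theorem ksLambda_smul (c : 𝕜) (A : KaltonPeck 𝕜 →L[𝕜] KaltonPeck 𝕜) :
    ksLambda U (c • A) = c • ksLambda U A := by
  rw [ksLambda, ksMul_smul, completion_smul]
  rfl

/-- A weakly null sequence with large images under `A` is replaced by normalized blocks with the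
same property up to `δ`. The operator on `Z_2` carrying the unit vectors to these blocks gives a
unit vector of `H` whose image under `Λ(A)` has norm at least `D - δ`. -/
theorem essBound_norm_ksLambda (A : KaltonPeck 𝕜 →L[𝕜] KaltonPeck 𝕜) :
    EssBound (A.comp KaltonPeck.incl) ‖ksLambda U A‖ := by
  intro x hx hx1 D hD
  rcases le_or_gt D 0 with hD0 | hD0
  · exact hD0.trans (norm_nonneg _)
  refine le_of_forall_pos_le_add fun δ' hδ' => ?_
  -- Requiring `δ < D` ensures that the blocks are nonzero and can be normalized; since their norms
  -- are at most one, normalization only enlarges the images.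
  obtain ⟨δ, hδ, hδδ', hδD⟩ : ∃ δ : ℝ, 0 < δ ∧ δ ≤ δ' ∧ δ < D :=
    ⟨min δ' (D / 2), by positivity, min_le_left _ _, (min_le_right _ _).trans_lt (by linarith)⟩
  set S : Ell 𝕜 2 →L[𝕜] KaltonPeck 𝕜 := A.comp KaltonPeck.incl with hS
  have hx0 := tendsto_apply_of_mem_weaklyNull hx
  obtain ⟨κ, n, hblk⟩ := exists_blocks (p := 2) (by norm_num) hx0 hx0
    (ε := fun _ => δ / (‖S‖ + 1)) (fun k => by positivity) (P := fun _ _ => True)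
    (fun _ => Eventually.of_forall fun _ => trivial)
  set r : ℕ → Ell 𝕜 2 := fun k => lpRestrict {j | κ j = k} (x (n k)) with hr
  have hSr : ∀ k, D - δ ≤ ‖S (r k)‖ := fun k => by
    have e1 : ‖S (x (n k) - r k)‖ ≤ δ := by
      refine (S.le_opNorm _).trans
        ((mul_le_mul_of_nonneg_left (hblk k).2.1 (norm_nonneg _)).trans ?_)
      rw [mul_div_assoc', div_le_iff₀ (by positivity)]
      nlinarith [norm_nonneg S]
    have e2 : ‖S (x (n k))‖ ≤ ‖S (x (n k) - r k)‖ + ‖S (r k)‖ := by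
      have : S (x (n k)) = S (x (n k) - r k) + S (r k) := by
        rw [← map_add, sub_add_cancel]
      rw [this]
      exact norm_add_le _ _
    linarith [hD (n k)]
  have hr0 : ∀ k, r k ≠ 0 := fun k h0 => by
    have := hSr k
    rw [h0, map_zero, norm_zero] at this
    linarith
  have hr1 : ∀ k, ‖r k‖ ≤ 1 := fun k => (norm_lpRestrict_le _ _).trans (hx1 _)
  set u : ℕ → Ell 𝕜 2 := fun k => ((‖r k‖⁻¹ : ℝ) : 𝕜) • r k with hu
  have hu1 : ∀ k, ‖u k‖ = 1 := fun k => KaltonPeck.norm_inv_norm_smul (hr0 k)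
  have hu0 : ∀ k j, κ j ≠ k → u k j = 0 := fun k j hj => by
    have : r k j = 0 := lpRestrict_fiber (fun k => x (n k)) k j hj
    simp only [hu, lp.coeFn_smul, Pi.smul_apply, this, smul_zero]
  have hSu : ∀ k, D - δ ≤ ‖S (u k)‖ := fun k => by
    have hpos := norm_pos_iff.2 (hr0 k)
    simp only [hu]
    rw [map_smul, norm_smul, RCLike.norm_ofReal, abs_of_pos (inv_pos.2 hpos)]
    refine (hSr k).trans (le_mul_of_one_le_left (norm_nonneg _) ?_)
    exact (one_le_inv₀ hpos).2 (hr1 k)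
  obtain ⟨T, hT⟩ := KaltonPeck.exists_blockOperator hu0 hu1
  let T' : KSPre 𝕜 U := T
  have hTn : ‖T'‖ = 1 := by
    refine tendsto_nhds_unique (ksPre_tendsto_norm 𝕜 U T') (tendsto_const_nhds.congr fun k => ?_)
    change 1 = ‖T (KaltonPeck.incl (lp.single 2 k 1))‖
    rw [hT, KaltonPeck.norm_incl, hu1]
  have hAT : D - δ ≤ ‖ksMul U A T'‖ := by
    refine ge_of_tendsto (ksPre_tendsto_norm 𝕜 U (ksMul U A T')) (Eventually.of_forall fun k => ?_)
    change D - δ ≤ ‖A (T (KaltonPeck.incl (lp.single 2 k 1)))‖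
    rw [hT]
    exact hSu k
  have hle := (ksLambda U A).le_opNorm (T' : KSSpace 𝕜 U)
  rw [ksLambda, ContinuousLinearMap.completion_apply_coe, UniformSpace.Completion.norm_coe,
    UniformSpace.Completion.norm_coe, hTn, mul_one] at hle
  have : ‖ksMul U A T'‖ ≤ ‖ksLambda U A‖ := hle
  linarith

theorem isClosed_range_ksLambda_iff (hU : (U : Filter ℕ) ≤ cofinite) :
    IsClosed (Set.range (ksLambda (𝕜 := 𝕜) U)) ↔
      ∃ K, ∀ T : KaltonPeck 𝕜 →L[𝕜] KaltonPeck 𝕜, ∃ T',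
        singNorm (T' - T) = 0 ∧ ‖T'‖ ≤ K * singNorm T := by
  have hE := KaltonPeck.isSingular_selfExtension (𝕜 := 𝕜)
  obtain ⟨β, hβ, -⟩ := SelfExtension.exists_betaMap (U := U) hU hE (by norm_num)
  obtain ⟨a, b, ha, -, hab⟩ := SelfExtension.exists_norm_beta_equiv hU hE (by norm_num)
    (by norm_num) hβ
  set i : ℝ := ‖(KaltonPeck.incl : Ell 𝕜 2 →L[𝕜] KaltonPeck 𝕜)‖ with hi
  have h1 : ∀ A : KaltonPeck 𝕜 →L[𝕜] KaltonPeck 𝕜, ‖ksLambda U A‖ ≤ i * ‖β A‖ := fun A =>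
    norm_completion_le _ (by positivity) (norm_ksMul_apply_le hU (hβ A))
  let L : (KaltonPeck 𝕜 →L[𝕜] KaltonPeck 𝕜) →L[𝕜] (KSSpace 𝕜 U →L[𝕜] KSSpace 𝕜 U) :=
    LinearMap.mkContinuous
      { toFun := ksLambda U
        map_add' := ksLambda_add
        map_smul' := ksLambda_smul }
      (i * ‖β‖) fun A => (h1 A).trans (by rw [mul_assoc]; gcongr; exact β.le_opNorm A)
  -- The constant `1` reflects that `ℓ_2` embeds isometrically in `Z_2`, so `c = 1` in
  -- `singNorm_le_of_essBound`.
  exact isClosed_range_iff_of_seminorm L singNorm (a := i * a) (b := 1)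
    (fun A => (h1 A).trans (by rw [mul_assoc]; gcongr; exact (hab A).1))
    (fun A => by
      have := SelfExtension.singNorm_le_of_essBound (T := A) hE (by norm_num) (by norm_num) one_pos
        (fun x => by rw [one_mul]; exact (KaltonPeck.norm_incl x).ge) (norm_nonneg _)
        (essBound_norm_ksLambda (U := U) A)
      rw [one_mul]
      rwa [div_one] at this) singNorm_nonneg

theorem kaltonPeck_tfae (hU : (U : Filter ℕ) ≤ cofinite) :
    List.TFAE [
      IsClosed (Set.range (ksLambda (𝕜 := 𝕜) U)),
      IsClosed ((KaltonPeck.selfExtension 𝕜).betaRange U),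
      IsSingNormComplete 𝕜 (KaltonPeck 𝕜) (KaltonPeck 𝕜),
      IsSingNormEquivalent 𝕜 (KaltonPeck 𝕜) (KaltonPeck 𝕜),
      IsClosed (KaltonPeck.selfExtension 𝕜).calkinImage,
      IsClosed ((KaltonPeck.selfExtension 𝕜).extK :
        Set (Ell 𝕜 2 →L[𝕜] KaltonPeck 𝕜))] := by
  -- The membership term selects the third remaining condition, equivalence of the norms, as the one
  -- to which (a) is linked.
  refine (List.tfae_cons_of_mem (List.mem_cons_of_mem _ (List.mem_cons_of_mem _
    List.mem_cons_self))).2 ⟨?_, SelfExtension.tfae hU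
      (KaltonPeck.isSingular_selfExtension (𝕜 := 𝕜)) (by norm_num) (by norm_num)⟩
  exact (isClosed_range_ksLambda_iff hU).trans SelfExtension.isSingNormEquivalent_iff.symm

end KaltonSwansonRepresentation

theorem mainTheorem9 {𝕜 : Type*} [RCLike 𝕜] (U : Ultrafilter ℕ)
    (hU : (U : Filter ℕ) ≤ Filter.cofinite) :
    (∀ (p : ℝ≥0∞) [Fact (1 ≤ p)], 1 < p → p < ∞ →
      ∀ (Y : Type v) [NormedAddCommGroup Y] [NormedSpace 𝕜 Y] [CompleteSpace Y]
        (E : SelfExtension 𝕜 p Y), E.IsSingular →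
        (∀ T : Y →L[𝕜] Y, ∃! B, E.IsBeta U T B) ∧
        List.TFAE [
          IsClosed (E.betaRange U),
          IsSingNormComplete 𝕜 Y Y,
          IsSingNormEquivalent 𝕜 Y Y,
          IsClosed E.calkinImage,
          IsClosed (E.extK : Set (Ell 𝕜 p →L[𝕜] Y))]) ∧
    ((∀ T : KaltonPeck 𝕜 →L[𝕜] KaltonPeck 𝕜,
        ∃! B, (KaltonPeck.selfExtension 𝕜).IsBeta U T B) ∧
      List.TFAE [
        IsClosed (Set.range (ksLambda (𝕜 := 𝕜) U)),
        IsClosed ((KaltonPeck.selfExtension 𝕜).betaRange U),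
        IsSingNormComplete 𝕜 (KaltonPeck 𝕜) (KaltonPeck 𝕜),
        IsSingNormEquivalent 𝕜 (KaltonPeck 𝕜) (KaltonPeck 𝕜),
        IsClosed (KaltonPeck.selfExtension 𝕜).calkinImage,
        IsClosed ((KaltonPeck.selfExtension 𝕜).extK :
          Set (Ell 𝕜 2 →L[𝕜] KaltonPeck 𝕜))]) :=
  ⟨fun _ _ h1 hp _ _ _ _ _ hE =>
      ⟨SelfExtension.existsUnique_isBeta hU hE hp.ne, SelfExtension.tfae hU hE hp.ne h1⟩,
    SelfExtension.existsUnique_isBeta hU KaltonPeck.isSingular_selfExtension (by norm_num),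
    kaltonPeck_tfae hU⟩
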